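/- Let $A$ and $B$ be $\mathbb{Z}_2$-graded $C^*$-algebras. **Operators.** Let $E$ be a right Hilbert $B$-module with inner product $(\cdot|\cdot)$. A $B$-linear operator $\mathcal{D}$ on $E$ is *regular* if it is closed, densely defined, has densely defined adjoint, and $1+\mathcal{D}^*\mathcal{D}$ has dense range; a closable operator is called regular if its closure is. For operators $S,T$ the space $\mathrm{Dom}\,S\cap\mathrm{Dom}\,T$ carries the inner product $(\phi|\psi)_{S,T}=(\phi|\psi)+(S\phi|S\psi)+(T\phi|T\psi)$ and the corresponding norm $\|\cdot\|_{S,T}$. If $\mathcal{D}$ is closed and regular with $\mathrm{Dom}\,\mathcal{D}\cap\mathrm{Dom}\,\mathcal{D}^*$ dense, $\mathrm{Re}\,\mathcal{D}$ and $\mathrm{Im}\,\mathcal{D}$ are the closures of $\frac12(\mathcal{D}+\mathcal{D}^*)$ and $-\frac i2(\mathcal{D}-\mathcal{D}^*)$ on $\mathrm{Dom}\,\mathcal{D}\cap\mathrm{Dom}\,\mathcal{D}^*$; the *Wick rotations* of $\mathcal{D}$ are $\mathcal{D}_\pm=\mathrm{Re}\,\mathcal{D}\pm\mathrm{Im}\,\mathcal{D}$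 on $\mathrm{Dom}\,\mathrm{Re}\,\mathcal{D}\cap\mathrm{Dom}\,\mathrm{Im}\,\mathcal{D}$. The *reverse Wick rotation* of a pair $(\mathcal{D}_1,\mathcal{D}_2)$ of closed regular symmetric operators with $\mathrm{Dom}\,\mathcal{D}_1\cap\mathrm{Dom}\,\mathcal{D}_2$ dense is the closure of $\frac12(\mathcal{D}_1+\mathcal{D}_2)+\frac i2(\mathcal{D}_1-\mathcal{D}_2)$ on $\mathrm{Dom}\,\mathcal{D}_1\cap\mathrm{Dom}\,\mathcal{D}_2$. A pair $(S,T)$ of regular self-adjoint operators is *almost anti-commuting* if there is a submodule $\mathcal{E}\subset\mathrm{Dom}\,T$, a core for $T$, such that for all $\mu\in\mathbb{R}\setminus\{0\}$ and $\xi\in\mathcal{E}$ one has $(S-i\mu)^{-1}\xi\in\mathrm{Dom}\,S\cap\mathrm{Dom}\,T$ and $T(S-i\mu)^{-1}\xi\in\mathrm{Dom}\,S$, and $(ST+TS)(S-i\mu)^{-1}\colon\mathcal{E}\to E$ extends to an adjointable operator in $\mathrm{End}_B(E)$. **Modules.** An *indefinite unbounded Kasparov $A$-$B$-module* $(\mathcal{A},{}_\pi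 E_B,\mathcal{D})$ consists of a $\mathbb{Z}_2$-graded countably generated right Hilbert $B$-module $E$, a graded $*$-homomorphism $\pi\colon A\to\mathrm{End}_B(E)$, a separable dense $*$-subalgebra $\mathcal{A}\subset A$, and a closed regular odd operator $\mathcal{D}$ on $E$ such that: 1. some linear subspace $\mathcal{E}\subset\mathrm{Dom}\,\mathcal{D}\cap\mathrm{Dom}\,\mathcal{D}^*$ is $\|\cdot\|_{\mathcal{D},\mathcal{D}^*}$-dense in $\mathrm{Dom}\,\mathcal{D}\cap\mathrm{Dom}\,\mathcal{D}^*$ and is a core for $\mathcal{D}$ and for $\mathcal{D}^*$; 2. $\mathrm{Re}\,\mathcal{D}$ and $\mathrm{Im}\,\mathcal{D}$ are regular and essentially self-adjoint on $\mathcal{E}$; 3. $(\mathrm{Re}\,\mathcal{D},\mathrm{Im}\,\mathcal{D})$ is almost anti-commuting; 4. $\pi(\mathcal{A})\mathcal{E}\subset\mathrm{Dom}\,\mathcal{D}\cap\mathrm{Dom}\,\mathcal{D}^*$, and the graded commutators of $\mathcal{D}$ and of $\mathcal{D}^*$ with $\pi(a)$ are bounded on $\mathcal{E}$ for each $a\in\mathcal{A}$;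 5. for each $a\in A$ the map $\pi(a)\colon(\mathrm{Dom}\,\mathcal{D}\cap\mathrm{Dom}\,\mathcal{D}^*,(\cdot|\cdot)_{\mathcal{D},\mathcal{D}^*})\to E$ is compact, i.e. a norm limit of finite-rank maps $\psi\mapsto\sum_i e_i\,(f_i|\psi)_{\mathcal{D},\mathcal{D}^*}$. It is an *unbounded Kasparov module* if moreover $\mathcal{D}=\mathcal{D}^*$. A *pair of unbounded Kasparov $A$-$B$-modules* $(\mathcal{A},E_B,\mathcal{D}_1,\mathcal{D}_2)$ consists of unbounded Kasparov modules $(\mathcal{A},E_B,\mathcal{D}_1)$, $(\mathcal{A},E_B,\mathcal{D}_2)$ with the same $\mathcal{A},\pi,E$ such that $\mathcal{D}_1$ and $\mathcal{D}_2$ have a common core $\mathcal{E}\subset\mathrm{Dom}\,\mathcal{D}_1\cap\mathrm{Dom}\,\mathcal{D}_2$ on which $\mathcal{D}_1+\mathcal{D}_2$ and $\mathcal{D}_1-\mathcal{D}_2$ are essentially self-adjoint, these two operators are regular, and (their closures) $(\mathcal{D}_1+\mathcal{D}_2,\mathcal{D}_1-\mathcal{D}_2)$ are almost anti-commuting. Two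 indefinite modules (or two pairs) with the same $\mathcal{A}$ are *unitarily equivalent* if there is an even unitary $U\colon E\to E'$ with $\pi'(a)=U\pi(a)U^*$ for all $a\in\mathcal{A}$ and $\mathcal{D}'=U\mathcal{D}U^*$ (respectively $\mathcal{D}'_j=U\mathcal{D}_jU^*$ for $j=1,2$). **Theorem.** If $(\mathcal{A},E_B,\mathcal{D})$ is an indefinite unbounded Kasparov $A$-$B$-module, then $(\mathcal{A},E_B,\mathcal{D}_+,\mathcal{D}_-)$ is a pair of unbounded Kasparov $A$-$B$-modules. If $(\mathcal{A},E_B,\mathcal{D}_1,\mathcal{D}_2)$ is a pair of unbounded Kasparov $A$-$B$-modules and $\mathcal{D}$ is its reverse Wick rotation, then $(\mathcal{A},E_B,\mathcal{D})$ is an indefinite unbounded Kasparov $A$-$B$-module. These two procedures are mutually inverse, so they give a bijection between indefinite unbounded Kasparov $A$-$B$-modules and pairs of unbounded Kasparov $A$-$B$-modules; and this bijection descends to a bijection between the corresponding sets of unitary equivalence classes. -/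

import Mathlib

open scoped RightActions

universe u v w

namespace IndefKasparov

/-- A `ℤ₂`-grading of a C⋆-algebra, given by its grading automorphism: an involutive
`⋆`-automorphism, equal to `+1` on the even part and to `-1` on the odd part. -/
class Z2Graded (A : Type u) [NonUnitalCStarAlgebra A] where
  /-- The grading automorphism. -/
  grading : A ≃⋆ₐ[ℂ] A
  grading_grading : ∀ a, grading (grading a) = a

/-! ### Unbounded operators on right Hilbert modules

A right Hilbert `B`-module is a complete `CStarModule Bᵐᵒᵖ E`: the right action is
`x <• b = MulOpposite.op b • x`. -/

section Operators

variable (B : Type v) [NonUnitalCStarAlgebra B] [PartialOrder B]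
  {E : Type w} [NormedAddCommGroup E] [NormedSpace ℂ E] [SMul Bᵐᵒᵖ E] [CStarModule Bᵐᵒᵖ E]

/-- The `B`-valued inner product `(x|y)` of a right Hilbert `B`-module. It is linear in `y` and
satisfies `(x | y <• b) = (x|y) * b`. -/
def rinner (x y : E) : B := (inner Bᵐᵒᵖ x y).unop

theorem rinner_smul (x y : E) (b : B) : rinner B x (y <• b) = rinner B x y * b := by
  simp [rinner]

/-- An everywhere defined operator on `E` belongs to `End_B(E)`. -/
def IsAdjointable (R : E →ₗ[ℂ] E) : Prop :=
  ∃ R' : E →ₗ[ℂ] E, ∀ x y, rinner B (R x) y = rinner B x (R' y)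

/-- The graph of the adjoint: all `(y, z)` with `(D x|y) = (x|z)` for every `x ∈ Dom D`. -/
def adjointGraph (D : E →ₗ.[ℂ] E) : Submodule ℂ (E × E) where
  carrier := {p | ∀ x : D.domain, rinner B (D x) p.1 = rinner B (x : E) p.2}
  zero_mem' := by intro x; simp [rinner]
  add_mem' := by
    intro p q hp hq x
    have h1 := hp x
    have h2 := hq x
    simp only [rinner, MulOpposite.unop_inj] at h1 h2
    simp [rinner, h1, h2]
  smul_mem' := by
    intro c p hp x
    have h1 := hp x
    simp only [rinner, MulOpposite.unop_inj] at h1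
    simp [rinner, h1]

/-- The adjoint `D*` (meaningful for densely defined `D`). -/
noncomputable def adjoint (D : E →ₗ.[ℂ] E) : E →ₗ.[ℂ] E := (adjointGraph B D).toLinearPMap

/-- A regular operator: closed, `B`-linear, densely defined with densely defined adjoint, and such
that `1 + D*D` has dense range. -/
structure IsRegular (D : E →ₗ.[ℂ] E) : Prop where
  closed : D.IsClosed
  smul_mem_graph : ∀ (b : B) (x y : E), (x, y) ∈ D.graph → (x <• b, y <• b) ∈ D.graph
  dense : Dense (D.domain : Set E)
  dense_adjoint : Dense ((adjoint B D).domain : Set E)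
  dense_range : Dense {e : E | ∃ x y z, (x, y) ∈ D.graph ∧ (y, z) ∈ (adjoint B D).graph ∧ e = x + z}

/-- `T` is (densely defined and) self-adjoint. -/
def IsSelfAdjointOp (T : E →ₗ.[ℂ] E) : Prop :=
  Dense (T.domain : Set E) ∧ adjoint B T = T

/-- `T` is essentially self-adjoint on the subspace `𝓔 ⊆ Dom T`. -/
def IsEssentiallySelfAdjointOn (T : E →ₗ.[ℂ] E) (𝓔 : Submodule ℂ E) : Prop :=
  𝓔 ≤ T.domain ∧ IsSelfAdjointOp B (T.domRestrict 𝓔).closure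

/-- The real part: the closure of `(D + D*)/2` on `Dom D ∩ Dom D*`. -/
noncomputable def rePart (D : E →ₗ.[ℂ] E) : E →ₗ.[ℂ] E :=
  ((1 / 2 : ℂ) • (D + adjoint B D)).closure

/-- The imaginary part: the closure of `-i(D - D*)/2` on `Dom D ∩ Dom D*`. -/
noncomputable def imPart (D : E →ₗ.[ℂ] E) : E →ₗ.[ℂ] E :=
  ((-Complex.I / 2 : ℂ) • (D - adjoint B D)).closure

/-- `D₊ = Re D + Im D` on `Dom (Re D) ∩ Dom (Im D)`. -/
noncomputable def wickPlus (D : E →ₗ.[ℂ] E) : E →ₗ.[ℂ] E := rePart B D + imPart B D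

/-- `D₋ = Re D - Im D` on `Dom (Re D) ∩ Dom (Im D)`. -/
noncomputable def wickMinus (D : E →ₗ.[ℂ] E) : E →ₗ.[ℂ] E := rePart B D - imPart B D

/-- The reverse Wick rotation: the closure of `(D₁ + D₂)/2 + i(D₁ - D₂)/2` on
`Dom D₁ ∩ Dom D₂`. -/
noncomputable def reverseWick (D₁ D₂ : E →ₗ.[ℂ] E) : E →ₗ.[ℂ] E :=
  ((1 / 2 : ℂ) • (D₁ + D₂) + (Complex.I / 2 : ℂ) • (D₁ - D₂)).closure

/-- The inner product `(φ|ψ) + (S φ|S ψ) + (T φ|T ψ)` on `Dom S ∩ Dom T`. -/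
def combinedInner (S T : E →ₗ.[ℂ] E) (φ ψ : ↥(S.domain ⊓ T.domain)) : B :=
  rinner B (φ : E) (ψ : E)
    + rinner B (S ⟨φ, φ.2.1⟩) (S ⟨ψ, ψ.2.1⟩) + rinner B (T ⟨φ, φ.2.2⟩) (T ⟨ψ, ψ.2.2⟩)

/-- The norm on `Dom S ∩ Dom T` belonging to `combinedInner`. -/
noncomputable def combinedNorm (S T : E →ₗ.[ℂ] E) (ψ : ↥(S.domain ⊓ T.domain)) : ℝ :=
  Real.sqrt ‖combinedInner B S T ψ ψ‖

/-- The composition of the inclusion `Dom S ∩ Dom T → E` with `K : E → E` is a compact operator of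
Hilbert `B`-modules, where `Dom S ∩ Dom T` carries `combinedInner`: it is a norm limit of
finite sums of the rank one operators `ψ ↦ e <• (f|ψ)`. -/
def IsCompactOnDomains (S T : E →ₗ.[ℂ] E) (K : E →ₗ[ℂ] E) : Prop :=
  ∀ ε : ℝ, 0 < ε → ∃ (n : ℕ) (e : Fin n → E) (f : Fin n → ↥(S.domain ⊓ T.domain)),
    ∀ ψ : ↥(S.domain ⊓ T.domain),
      ‖K (ψ : E) - ∑ i, e i <• combinedInner B S T (f i) ψ‖ ≤ ε * combinedNorm B S T ψ

/-- `η` lies in the domain of `{S, T} = ST + TS` and `{S, T} η = ζ`. -/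
def IsAnticommutatorValue (S T : E →ₗ.[ℂ] E) (η ζ : E) : Prop :=
  ∃ p q r s, (η, p) ∈ T.graph ∧ (p, q) ∈ S.graph ∧ (η, r) ∈ S.graph ∧ (r, s) ∈ T.graph ∧
    ζ = q + s

/-- `(S, T)` is an almost anti-commuting pair of regular self-adjoint operators. The element `η`
is `(S - iμ)⁻¹ ξ`. -/
structure IsAlmostAnticommuting (S T : E →ₗ.[ℂ] E) : Prop where
  regular_left : IsRegular B S
  selfAdjoint_left : IsSelfAdjointOp B S
  regular_right : IsRegular B T
  selfAdjoint_right : IsSelfAdjointOp B T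
  exists_core : ∃ 𝓔 : Submodule ℂ E, (∀ (b : B), ∀ x ∈ 𝓔, x <• b ∈ 𝓔) ∧ T.HasCore 𝓔 ∧
    (∀ ξ ∈ 𝓔, ∀ μ : ℝ, μ ≠ 0 → ∃ η p, (η, ξ + (Complex.I * μ) • η) ∈ S.graph ∧
      (η, p) ∈ T.graph ∧ p ∈ S.domain) ∧
    (∀ μ : ℝ, μ ≠ 0 → ∃ R : E →ₗ[ℂ] E, IsAdjointable B R ∧ ∀ ξ ∈ 𝓔, ∃ η,
      (η, ξ + (Complex.I * μ) • η) ∈ S.graph ∧ IsAnticommutatorValue S T η (R ξ))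

end Operators

/-! ### Kasparov modules -/

variable (A : Type u) (B : Type v) [NonUnitalCStarAlgebra A] [NonUnitalCStarAlgebra B]
  [PartialOrder B] [Z2Graded A] [Z2Graded B]

/-- The data `(𝒜, π, E_B)` underlying an unbounded Kasparov `A`-`B`-module: a `ℤ₂`-graded
countably generated right Hilbert `B`-module `E`, a graded `⋆`-homomorphism
`π : A → End_B(E)` and a separable dense `⋆`-subalgebra `𝒜` of `A`. -/
structure KasparovBimodule where
  /-- The Hilbert module. -/
  E : Type w
  [instNormedAddCommGroup : NormedAddCommGroup E]
  [instNormedSpace : NormedSpace ℂ E]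
  [instCompleteSpace : CompleteSpace E]
  [instSMul : SMul Bᵐᵒᵖ E]
  [instCStarModule : CStarModule Bᵐᵒᵖ E]
  /-- The grading operator, `+1` on the even and `-1` on the odd part of `E`. -/
  γ : E →ₗ[ℂ] E
  γ_γ : ∀ x, γ (γ x) = x
  γ_smul : ∀ (x : E) (b : B), γ (x <• b) = γ x <• Z2Graded.grading b
  γ_inner : ∀ x y, rinner B (γ x) (γ y) = Z2Graded.grading (rinner B x y)
  countably_generated : ∃ s : Set E, s.Countable ∧
    Dense (Submodule.span ℂ {z : E | ∃ x ∈ s, ∃ b : B, z = x <• b} : Set E)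
  /-- The left action of `A`. -/
  π : A →ₙₐ[ℂ] Module.End ℂ E
  π_star : ∀ a x y, rinner B (π a x) y = rinner B x (π (star a) y)
  π_grading : ∀ a x, γ (π a x) = π (Z2Graded.grading a) (γ x)
  /-- The smooth subalgebra. -/
  𝒜 : NonUnitalStarSubalgebra ℂ A
  separable : TopologicalSpace.IsSeparable (𝒜 : Set A)
  dense : Dense (𝒜 : Set A)

attribute [instance] KasparovBimodule.instNormedAddCommGroup KasparovBimodule.instNormedSpace
  KasparovBimodule.instCompleteSpace KasparovBimodule.instSMul KasparovBimodule.instCStarModule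

variable {A B}

/-- The graded commutators `[D, π(a)]_± = D π(a) - π(α(a)) D`, with `α` the grading automorphism
of `A` (so `D π(a) - π(a) D` for even and `D π(a) + π(a) D` for odd `a`), are bounded
on `𝓔`. -/
def HasBoundedCommutators (X : KasparovBimodule.{u, v, w} A B) (D : X.E →ₗ.[ℂ] X.E)
    (𝓔 : Submodule ℂ X.E) : Prop :=
  ∀ a ∈ X.𝒜, ∃ C : ℝ, ∀ ψ ∈ 𝓔, ∃ y z, (ψ, y) ∈ D.graph ∧ (X.π a ψ, z) ∈ D.graph ∧
    ‖z - X.π (Z2Graded.grading a) y‖ ≤ C * ‖ψ‖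

/-- `(𝒜, E_B, D)` is an indefinite unbounded Kasparov `A`-`B`-module. -/
structure IsIndefiniteKasparov (X : KasparovBimodule.{u, v, w} A B) (D : X.E →ₗ.[ℂ] X.E) :
    Prop where
  regular : IsRegular B D
  odd : ∀ x y, (x, y) ∈ D.graph → (X.γ x, -X.γ y) ∈ D.graph
  exists_core : ∃ 𝓔 : Submodule ℂ X.E,
    𝓔 ≤ D.domain ⊓ (adjoint B D).domain ∧
    (∀ ψ : ↥(D.domain ⊓ (adjoint B D).domain), ∀ ε : ℝ, 0 < ε →
      ∃ φ : ↥(D.domain ⊓ (adjoint B D).domain), (φ : X.E) ∈ 𝓔 ∧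
        combinedNorm B D (adjoint B D) (ψ - φ) < ε) ∧
    D.HasCore 𝓔 ∧ (adjoint B D).HasCore 𝓔 ∧
    IsRegular B (rePart B D) ∧ IsEssentiallySelfAdjointOn B (rePart B D) 𝓔 ∧
    IsRegular B (imPart B D) ∧ IsEssentiallySelfAdjointOn B (imPart B D) 𝓔 ∧
    (∀ a ∈ X.𝒜, ∀ ψ ∈ 𝓔, X.π a ψ ∈ D.domain ⊓ (adjoint B D).domain) ∧
    HasBoundedCommutators X D 𝓔 ∧ HasBoundedCommutators X (adjoint B D) 𝓔
  almostAnticommuting : IsAlmostAnticommuting B (rePart B D) (imPart B D)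
  compact : ∀ a : A, IsCompactOnDomains B D (adjoint B D) (X.π a)

/-- `(𝒜, E_B, D)` is an unbounded Kasparov `A`-`B`-module: the case of a self-adjoint `D`. (Then
`Re D = D` and `Im D = 0`, and what remains is that `D` is regular, self-adjoint and odd, has
bounded graded commutators with `π(𝒜)`, and has locally compact resolvent.) -/
def IsUnboundedKasparov (X : KasparovBimodule.{u, v, w} A B) (D : X.E →ₗ.[ℂ] X.E) : Prop :=
  IsIndefiniteKasparov X D ∧ IsSelfAdjointOp B D

/-- `(𝒜, E_B, D₁, D₂)` is a pair of unbounded Kasparov `A`-`B`-modules. -/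
structure IsKasparovPair (X : KasparovBimodule.{u, v, w} A B) (D₁ D₂ : X.E →ₗ.[ℂ] X.E) :
    Prop where
  left : IsUnboundedKasparov X D₁
  right : IsUnboundedKasparov X D₂
  exists_core : ∃ 𝓔 : Submodule ℂ X.E, 𝓔 ≤ D₁.domain ⊓ D₂.domain ∧
    D₁.HasCore 𝓔 ∧ D₂.HasCore 𝓔 ∧
    IsRegular B (D₁ + D₂).closure ∧ IsEssentiallySelfAdjointOn B (D₁ + D₂) 𝓔 ∧
    IsRegular B (D₁ - D₂).closure ∧ IsEssentiallySelfAdjointOn B (D₁ - D₂) 𝓔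
  almostAnticommuting : IsAlmostAnticommuting B (D₁ + D₂).closure (D₁ - D₂).closure

variable (A B) in
/-- Indefinite unbounded Kasparov `A`-`B`-modules `(𝒜, E_B, D)`. -/
def IndefiniteKasparovModule : Type (max u v (w + 1)) :=
  {M : (X : KasparovBimodule.{u, v, w} A B) × (X.E →ₗ.[ℂ] X.E) // IsIndefiniteKasparov M.1 M.2}

variable (A B) in
/-- Pairs of unbounded Kasparov `A`-`B`-modules `(𝒜, E_B, D₁, D₂)`. -/
def KasparovModulePair : Type (max u v (w + 1)) :=
  {N : (X : KasparovBimodule.{u, v, w} A B) × (X.E →ₗ.[ℂ] X.E) × (X.E →ₗ.[ℂ] X.E) //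
    IsKasparovPair N.1 N.2.1 N.2.2}

/-- `(𝒜, E, D) ↦ (𝒜, E, D₊, D₋)`. -/
noncomputable def wickRotation (M : (X : KasparovBimodule.{u, v, w} A B) × (X.E →ₗ.[ℂ] X.E)) :
    (X : KasparovBimodule.{u, v, w} A B) × (X.E →ₗ.[ℂ] X.E) × (X.E →ₗ.[ℂ] X.E) :=
  ⟨M.1, wickPlus B M.2, wickMinus B M.2⟩

/-- `(𝒜, E, D₁, D₂) ↦ (𝒜, E, D)` with `D` the reverse Wick rotation of `(D₁, D₂)`. -/
noncomputable def reverseWickRotation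
    (N : (X : KasparovBimodule.{u, v, w} A B) × (X.E →ₗ.[ℂ] X.E) × (X.E →ₗ.[ℂ] X.E)) :
    (X : KasparovBimodule.{u, v, w} A B) × (X.E →ₗ.[ℂ] X.E) :=
  ⟨N.1, reverseWick N.2.1 N.2.2⟩

/-! ### Unitary equivalence -/

/-- `U : E₁ → E₂` is an even unitary with `π₂(a) = U π₁(a) U*` for all `a ∈ 𝒜`. -/
structure IsEvenUnitary (X Y : KasparovBimodule.{u, v, w} A B) (U : X.E ≃ₗ[ℂ] Y.E) : Prop where
  inner : ∀ x y, rinner B (U x) (U y) = rinner B x y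
  even : ∀ x, U (X.γ x) = Y.γ (U x)
  subalgebra : X.𝒜 = Y.𝒜
  intertwines : ∀ a ∈ X.𝒜, ∀ y, Y.π a y = U (X.π a (U.symm y))

/-- `D₂ = U D₁ U*`, as an equality of unbounded operators. -/
def IsConjugate {X Y : KasparovBimodule.{u, v, w} A B} (U : X.E ≃ₗ[ℂ] Y.E)
    (D₁ : X.E →ₗ.[ℂ] X.E) (D₂ : Y.E →ₗ.[ℂ] Y.E) : Prop :=
  ∀ x y, (U x, U y) ∈ D₂.graph ↔ (x, y) ∈ D₁.graph

theorem IsEvenUnitary.refl (X : KasparovBimodule.{u, v, w} A B) :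
    IsEvenUnitary X X (LinearEquiv.refl ℂ X.E) :=
  ⟨fun _ _ => rfl, fun _ => rfl, rfl, fun _ _ _ => rfl⟩

theorem IsEvenUnitary.symm {X Y : KasparovBimodule.{u, v, w} A B} {U : X.E ≃ₗ[ℂ] Y.E}
    (h : IsEvenUnitary X Y U) : IsEvenUnitary Y X U.symm := by
  refine ⟨fun x y => ?_, fun x => ?_, h.subalgebra.symm, fun a ha y => ?_⟩
  · simpa using (h.inner (U.symm x) (U.symm y)).symm
  · apply U.injective
    simpa using (h.even (U.symm x)).symm
  · have := h.intertwines a (h.subalgebra ▸ ha) (U y)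
    simp [this]

theorem IsEvenUnitary.trans {X Y Z : KasparovBimodule.{u, v, w} A B} {U : X.E ≃ₗ[ℂ] Y.E}
    {V : Y.E ≃ₗ[ℂ] Z.E} (h : IsEvenUnitary X Y U) (k : IsEvenUnitary Y Z V) :
    IsEvenUnitary X Z (U.trans V) := by
  refine ⟨fun x y => ?_, fun x => ?_, h.subalgebra.trans k.subalgebra, fun a ha y => ?_⟩
  · simp [k.inner, h.inner]
  · simp [k.even, h.even]
  · simp [k.intertwines a (h.subalgebra ▸ ha), h.intertwines a ha]

theorem IsConjugate.symm {X Y : KasparovBimodule.{u, v, w} A B} {U : X.E ≃ₗ[ℂ] Y.E}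
    {D₁ : X.E →ₗ.[ℂ] X.E} {D₂ : Y.E →ₗ.[ℂ] Y.E} (h : IsConjugate U D₁ D₂) :
    IsConjugate U.symm D₂ D₁ := by
  intro x y
  simpa using (h (U.symm x) (U.symm y)).symm

theorem IsConjugate.trans {X Y Z : KasparovBimodule.{u, v, w} A B} {U : X.E ≃ₗ[ℂ] Y.E}
    {V : Y.E ≃ₗ[ℂ] Z.E} {D₁ : X.E →ₗ.[ℂ] X.E} {D₂ : Y.E →ₗ.[ℂ] Y.E} {D₃ : Z.E →ₗ.[ℂ] Z.E}
    (h : IsConjugate U D₁ D₂) (k : IsConjugate V D₂ D₃) : IsConjugate (U.trans V) D₁ D₃ :=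
  fun x y => (k (U x) (U y)).trans (h x y)

variable (A B) in
/-- Unitary equivalence of indefinite unbounded Kasparov modules. -/
def indefiniteSetoid : Setoid (IndefiniteKasparovModule.{u, v, w} A B) where
  r M N := ∃ U : M.1.1.E ≃ₗ[ℂ] N.1.1.E, IsEvenUnitary M.1.1 N.1.1 U ∧ IsConjugate U M.1.2 N.1.2
  iseqv :=
    { refl := fun M => ⟨_, .refl M.1.1, fun _ _ => Iff.rfl⟩
      symm := fun ⟨U, h, k⟩ => ⟨U.symm, h.symm, k.symm⟩
      trans := fun ⟨U, h, k⟩ ⟨V, h', k'⟩ => ⟨U.trans V, h.trans h', k.trans k'⟩ }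

variable (A B) in
/-- Unitary equivalence of pairs of unbounded Kasparov modules (one unitary for both
operators). -/
def pairSetoid : Setoid (KasparovModulePair.{u, v, w} A B) where
  r M N := ∃ U : M.1.1.E ≃ₗ[ℂ] N.1.1.E, IsEvenUnitary M.1.1 N.1.1 U ∧
    IsConjugate U M.1.2.1 N.1.2.1 ∧ IsConjugate U M.1.2.2 N.1.2.2
  iseqv :=
    { refl := fun M => ⟨_, .refl M.1.1, fun _ _ => Iff.rfl, fun _ _ => Iff.rfl⟩
      symm := fun ⟨U, h, k, l⟩ => ⟨U.symm, h.symm, k.symm, l.symm⟩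
      trans := fun ⟨U, h, k, l⟩ ⟨V, h', k', l'⟩ =>
        ⟨U.trans V, h.trans h', k.trans k', l.trans l'⟩ }

end IndefKasparov

/-!
Write `S = Re D` and `T = Im D`. All operators in sight are combinations of the almost
anti-commuting pair `(S, T)` on `W = Dom S ∩ Dom T`: there `D = S + iT`, `D* = S - iT`
and `D₊ = S + T`, `D₋ = S - T`. The theorem amounts to passing between these descriptions, and the
conditions on one side have to be derived from those on the other. Unbounded operators are handled
through their graphs, as subspaces of `E × E`.

*Self-adjointness of `S ± T`.* The range of `S + T - iκ` is dense for real `κ` of large absolute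
value (`IsAlmostCommRel.dense_range`). To see this, `S` is replaced by the bounded operator `S J_n`,
where `J_n = (1 + (i/n) S)⁻¹`; the sign of `n` makes the equation `T x + S J_n x - iκ x = y`
solvable, and averaging `J_m` and `J_{-m}` smooths the solution so that `S` and `T` apply to it.
Since the anticommutator is bounded relative to `S`, the remaining error is a fixed fraction
of `‖y‖`. As the graph norm of `S + T` controls `S x` and `T x`, the sum is closed on `W`, hence
regular and self-adjoint there (`IsAlmostCommRel.isSelfAdjointRel_add`).

*Regularity of the closure of `S + iT`.* The argument for dense range works equally for almost
commuting pairs. On `E ⊕ E` the matrices `diag(S, -S)` and `[[0, T], [T, 0]]` almost commute, and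
their sum is unitarily equivalent to `[[0, S - iT], [S + iT, 0]]`. So the latter has self-adjoint
closure, which says that the closure of `S + iT` is regular with adjoint the closure of `S - iT`
(`IsAlmostCommRel.isSelfAdjointRel_add_I`, `IsAlmostAnticommuting.isRegular_closure_add_I`).

*Compactness.* On `W` the inner product given by `D` and `D*` has the quadratic form
`(x|x) + 2 (S x|S x) + 2 (T x|T x)`, and the one given by `S + T`, counted twice, has
`(x|x) + 2 ((S + T) x|(S + T) x)`. They differ by twice the form of the anticommutator, which
on `x` is `(k|·)` for some vector `k ∈ E` (`IsAlmostCommRel.exists_anticommutator`). Hence a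
functional given by one inner product is given by the other as soon as each `(k|·)` is represented
in it, which means solving `h + 2 (S + T)² h = k`, respectively `h + 2 (S² + T²) h = k` in the weak
sense (`IsAlmostCommRel.exists_form_solution`). So finite rank maps for one inner product are of
finite rank for the other (`IsCompactOnDomains.of_representable`).

*Converse.* For a pair `(D₁, D₂)` let `S` and `T` be half the closures of `D₁ + D₂` and `D₁ - D₂`.
By the first step `S + T` and `S - T` are self-adjoint; they extend `D₁` and `D₂`, and self-adjoint
operators have no proper self-adjoint extensions, so `D₁ = S + T` and `D₂ = S - T`. The real and
imaginary part of the reverse Wick rotation are `S` and `T`. So the two constructions are inverse to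
each other, and both are compatible with conjugation by a unitary.
-/

namespace IndefKasparov

open Complex Filter Topology

/-! ### The inner product of a right Hilbert module -/

section InnerProduct

variable {B : Type v} [NonUnitalCStarAlgebra B] [PartialOrder B]
  {E : Type w} [NormedAddCommGroup E] [NormedSpace ℂ E] [SMul Bᵐᵒᵖ E] [CStarModule Bᵐᵒᵖ E]

@[simp] theorem rinner_add_left (x y z : E) : rinner B (x + y) z = rinner B x z + rinner B y z := by
  simp [rinner]
@[simp] theorem rinner_add_right (x y z : E) :
    rinner B x (y + z) = rinner B x y + rinner B x z := by simp [rinner]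
@[simp] theorem rinner_sub_left (x y z : E) : rinner B (x - y) z = rinner B x z - rinner B y z := by
  simp [rinner]
@[simp] theorem rinner_sub_right (x y z : E) :
    rinner B x (y - z) = rinner B x y - rinner B x z := by simp [rinner]
@[simp] theorem rinner_neg_left (x y : E) : rinner B (-x) y = -rinner B x y := by simp [rinner]
@[simp] theorem rinner_neg_right (x y : E) : rinner B x (-y) = -rinner B x y := by simp [rinner]
@[simp] theorem rinner_zero_left (x : E) : rinner B 0 x = 0 := by simp [rinner]
@[simp] theorem rinner_zero_right (x : E) : rinner B x 0 = 0 := by simp [rinner]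
@[simp] theorem rinner_csmul_left (c : ℂ) (x y : E) :
    rinner B (c • x) y = (starRingEnd ℂ c) • rinner B x y := by simp [rinner]
@[simp] theorem rinner_csmul_right (c : ℂ) (x y : E) :
    rinner B x (c • y) = c • rinner B x y := by simp [rinner]
theorem star_rinner (x y : E) : star (rinner B x y) = rinner B y x := by
  simp [rinner, ← MulOpposite.unop_star]
theorem rinner_smul_left (x y : E) (b : B) : rinner B (x <• b) y = star b * rinner B x y := by
  simp [rinner]

theorem rinner_self_nonneg (x : E) : 0 ≤ rinner B x x := by
  have : (0 : Bᵐᵒᵖ) ≤ inner Bᵐᵒᵖ x x := CStarModule.inner_self_nonneg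
  exact MulOpposite.unop_le_unop.mpr this

theorem norm_rinner_self (x : E) : ‖rinner B x x‖ = ‖x‖ ^ 2 := by
  rw [CStarModule.norm_sq_eq Bᵐᵒᵖ, rinner, MulOpposite.norm_unop]

variable (B) in
theorem eq_zero_of_rinner_self {x : E} (h : rinner B x x = 0) : x = 0 := by
  have := norm_rinner_self (B := B) x
  rw [h, norm_zero] at this
  exact norm_eq_zero.mp (pow_eq_zero_iff two_ne_zero |>.mp this.symm)

variable (B) in
theorem ext_rinner {x y : E} (h : ∀ z : E, rinner B z x = rinner B z y) : x = y := by
  refine sub_eq_zero.mp (eq_zero_of_rinner_self B ?_)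
  rw [rinner_sub_right, h, sub_self]

theorem norm_smul_le_right (x : E) (b : B) : ‖x <• b‖ ≤ ‖x‖ * ‖b‖ := by
  refine le_of_sq_le_sq ?_ (by positivity)
  rw [← norm_rinner_self (B := B), rinner_smul, rinner_smul_left]
  calc ‖star b * rinner B x x * b‖ ≤ ‖star b‖ * ‖rinner B x x‖ * ‖b‖ :=
        (norm_mul_le _ _).trans (by gcongr; exact norm_mul_le _ _)
    _ = (‖x‖ * ‖b‖) ^ 2 := by rw [norm_star, norm_rinner_self]; ring

variable (B) in
/-- Right multiplication by `b`, as a bounded operator (`x <• b` is not assumed to be additive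
in `x`: it follows from the inner product). -/
noncomputable def rightMulL (b : B) : E →L[ℂ] E :=
  LinearMap.mkContinuous
    { toFun := fun x => x <• b
      map_add' := fun x y => ext_rinner B fun z => by simp [rinner_smul, add_mul]
      map_smul' := fun c x => ext_rinner B fun z => by simp [rinner_smul, smul_mul_assoc] } ‖b‖
    fun x => by simpa [mul_comm] using norm_smul_le_right x b

@[simp] theorem rightMulL_apply (b : B) (x : E) : rightMulL B b x = x <• b := rfl

variable [StarOrderedRing B]

theorem norm_rinner_le (x y : E) : ‖rinner B x y‖ ≤ ‖x‖ * ‖y‖ := by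
  rw [rinner, MulOpposite.norm_unop]
  exact CStarModule.norm_inner_le E

variable (B) in
theorem continuous_rinner : Continuous fun p : E × E => rinner B p.1 p.2 := by
  have : Continuous fun p : E × E => inner Bᵐᵒᵖ p.1 p.2 := CStarModule.continuous_inner
  exact MulOpposite.continuous_unop.comp this

variable (B) in
theorem Continuous.rinner' {X : Type*} [TopologicalSpace X] {f g : X → E} (hf : Continuous f)
    (hg : Continuous g) : Continuous fun x => rinner B (f x) (g x) :=
  (continuous_rinner B).comp (hf.prodMk hg)

variable (B) in
/-- `‖x‖ ≤ ‖((x|x) + b)^{1/2}‖` for `b ≥ 0`. -/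
theorem sq_norm_le_of_nonneg (x : E) {b : B} (hb : 0 ≤ b) : ‖x‖ ^ 2 ≤ ‖rinner B x x + b‖ := by
  rw [← norm_rinner_self (B := B)]
  exact CStarAlgebra.norm_le_norm_of_nonneg_of_le (rinner_self_nonneg x) (by simpa using hb)

variable (B) in
/-- A vector orthogonal to a dense set vanishes. -/
theorem eq_zero_of_dense {s : Set E} (hs : Dense s) {y : E} (h : ∀ x ∈ s, rinner B x y = 0) :
    y = 0 := by
  refine eq_zero_of_rinner_self B ?_
  have hc : Continuous fun x : E => rinner B x y :=
    Continuous.rinner' B continuous_id continuous_const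
  have : (fun x : E => rinner B x y) = fun _ => 0 :=
    Continuous.ext_on hs hc continuous_const fun x hx => h x hx
  exact congrFun this y

end InnerProduct

/-! ### Accretive relations -/

section Relations

variable {B : Type v} [NonUnitalCStarAlgebra B] [PartialOrder B] [StarOrderedRing B]
  {E : Type w} [NormedAddCommGroup E] [NormedSpace ℂ E] [SMul Bᵐᵒᵖ E] [CStarModule Bᵐᵒᵖ E]

variable (B) in
/-- If `Re (h|k) ≥ 0` then `t‖h‖ ≤ ‖k + t h‖`. -/
theorem accretive_bound {h k : E} (hk : 0 ≤ rinner B h k + rinner B k h) {t : ℝ} (ht : 0 < t) :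
    t * ‖h‖ ≤ ‖k + (t : ℂ) • h‖ := by
  have h1 : (2 * t) * ‖h‖ ^ 2 ≤ 2 * (‖h‖ * ‖k + (t : ℂ) • h‖) := by
    have e : rinner B h (k + (t : ℂ) • h) + rinner B (k + (t : ℂ) • h) h
        = ((2 * t : ℝ) : ℂ) • rinner B h h + (rinner B h k + rinner B k h) := by
      simp only [rinner_add_left, rinner_add_right, rinner_csmul_left, rinner_csmul_right,
        Complex.conj_ofReal]
      push_cast
      rw [mul_smul, two_smul]
      abel
    have hn : (0 : B) ≤ ((2 * t : ℝ) : ℂ) • rinner B h h := by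
      rw [Complex.coe_smul]
      exact smul_nonneg (by positivity) (rinner_self_nonneg h)
    calc (2 * t) * ‖h‖ ^ 2 = ‖((2 * t : ℝ) : ℂ) • rinner B h h‖ := by
          rw [norm_smul, norm_rinner_self, Complex.norm_real, Real.norm_of_nonneg (by positivity)]
      _ ≤ ‖rinner B h (k + (t : ℂ) • h) + rinner B (k + (t : ℂ) • h) h‖ := by
          rw [e]
          exact CStarAlgebra.norm_le_norm_of_nonneg_of_le hn (by simpa using hk)
      _ ≤ ‖h‖ * ‖k + (t : ℂ) • h‖ + ‖k + (t : ℂ) • h‖ * ‖h‖ :=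
          (norm_add_le _ _).trans (add_le_add (norm_rinner_le _ _) (norm_rinner_le _ _))
      _ = _ := by ring
  rcases eq_or_lt_of_le (norm_nonneg h) with h0 | h0
  · rw [← h0]; simp
  · nlinarith

/-- A bounded perturbation `P` with `‖P‖ < t` of a surjection `A + t` with `‖(A + t)⁻¹‖ ≤ t⁻¹` is
surjective. -/
theorem surjective_add_of_norm_lt [CompleteSpace E] {A : Submodule ℂ (E × E)} {t : ℝ} (ht : 0 < t)
    (hb : ∀ p ∈ A, t * ‖p.1‖ ≤ ‖p.2 + (t : ℂ) • p.1‖)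
    (hs : ∀ y, ∃ p ∈ A, p.2 + (t : ℂ) • p.1 = y) (P : E →L[ℂ] E) (hP : ‖P‖ < t) (y : E) :
    ∃ p ∈ A, p.2 + (t : ℂ) • p.1 + P p.1 = y := by
  choose g hg hgy using hs
  have huniq : ∀ p ∈ A, (g (p.2 + (t : ℂ) • p.1)).1 = p.1 := by
    intro p hp
    have h1 := hb _ (A.sub_mem (hg (p.2 + (t : ℂ) • p.1)) hp)
    have h2 := hgy (p.2 + (t : ℂ) • p.1)
    have h3 : (g (p.2 + (t : ℂ) • p.1) - p).2 + (t : ℂ) • (g (p.2 + (t : ℂ) • p.1) - p).1 = 0 := by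
      simp only [Prod.snd_sub, Prod.fst_sub, smul_sub]
      rw [sub_add_sub_comm, h2, sub_self]
    rw [h3, norm_zero] at h1
    have h4 : ‖(g (p.2 + (t : ℂ) • p.1) - p).1‖ ≤ 0 := by
      by_contra! h
      nlinarith [mul_pos ht h]
    simpa [sub_eq_zero] using h4
  let G : E →L[ℂ] E := LinearMap.mkContinuous
    { toFun := fun z => (g z).1
      map_add' := fun a b => by
        have := huniq _ (A.add_mem (hg a) (hg b))
        rw [Prod.snd_add, Prod.fst_add, smul_add, add_add_add_comm, hgy, hgy] at this
        exact this
      map_smul' := fun c a => by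
        have := huniq _ (A.smul_mem c (hg a))
        rw [Prod.smul_snd, Prod.smul_fst, smul_comm, ← smul_add, hgy] at this
        exact this } t⁻¹ fun z => by
      have := hb _ (hg z)
      rw [hgy] at this
      rw [inv_mul_eq_div, le_div_iff₀ ht, mul_comm]
      exact this
  have hG : ‖G‖ ≤ t⁻¹ := LinearMap.mkContinuous_norm_le _ (by positivity) _
  have hlt : ‖-(P.comp G)‖ < 1 := by
    rw [norm_neg]
    calc ‖P.comp G‖ ≤ ‖P‖ * ‖G‖ := P.opNorm_comp_le G
      _ ≤ ‖P‖ * t⁻¹ := by gcongr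
      _ < t * t⁻¹ := by gcongr
      _ = 1 := mul_inv_cancel₀ ht.ne'
  obtain ⟨U, hU⟩ := isUnit_one_sub_of_norm_lt_one hlt
  -- with `w = (1 + P G)⁻¹ y`, the solution is `G w`
  refine ⟨g ((↑U⁻¹ : E →L[ℂ] E) y), hg _, ?_⟩
  rw [hgy]
  have h5 : (U : E →L[ℂ] E) ((↑U⁻¹ : E →L[ℂ] E) y) = y := by
    exact congrArg (fun T : E →L[ℂ] E => T y) U.mul_inv
  rw [hU] at h5
  simpa [G] using h5

variable (B) in
/-- If `A` is accretive and `A + t₀` is surjective for one `t₀ > 0`, then `A + t` is surjective for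
all `t > 0`. -/
theorem accretive_surjective [CompleteSpace E] {A : Submodule ℂ (E × E)}
    (hA : ∀ p ∈ A, 0 ≤ rinner B p.1 p.2 + rinner B p.2 p.1) {t₀ : ℝ} (ht₀ : 0 < t₀)
    (hs : ∀ y, ∃ p ∈ A, p.2 + (t₀ : ℂ) • p.1 = y) {t : ℝ} (ht : 0 < t) (y : E) :
    ∃ p ∈ A, p.2 + (t : ℂ) • p.1 = y := by
  have step : ∀ a : ℝ, 0 < a → (∀ y, ∃ p ∈ A, p.2 + (a : ℂ) • p.1 = y) →
      ∀ b : ℝ, 0 < b → b < 2 * a → ∀ y, ∃ p ∈ A, p.2 + (b : ℂ) • p.1 = y := by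
    intro a ha hs b hb hba y
    have hn : ‖((b - a : ℝ) : ℂ) • ContinuousLinearMap.id ℂ E‖ < a := by
      rw [norm_smul]
      have : |b - a| < a := by rw [abs_lt]; constructor <;> linarith
      calc ‖((b - a : ℝ) : ℂ)‖ * ‖ContinuousLinearMap.id ℂ E‖ ≤ |b - a| * 1 := by
            rw [Complex.norm_real, Real.norm_eq_abs]
            gcongr
            exact ContinuousLinearMap.norm_id_le
        _ < a := by simpa
    obtain ⟨p, hp, h⟩ := surjective_add_of_norm_lt ha (fun p hp => accretive_bound B (hA p hp) ha)
      hs _ hn y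
    refine ⟨p, hp, ?_⟩
    rw [← h]
    simp only [_root_.smul_apply, ContinuousLinearMap.id_apply]
    rw [add_assoc, ← add_smul]
    push_cast
    rw [add_sub_cancel]
  -- each step may enlarge `t` by any factor below `2`, or diminish it arbitrarily
  have up : ∀ n : ℕ, ∀ y, ∃ p ∈ A, p.2 + (((3 / 2 : ℝ) ^ n * t₀ : ℝ) : ℂ) • p.1 = y := by
    intro n
    induction n with
    | zero => simpa using hs
    | succ n ih =>
      have : 0 < (3 / 2 : ℝ) ^ n * t₀ := by positivity
      refine step _ this ih _ (by positivity) ?_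
      rw [pow_succ]
      linarith
  obtain ⟨n, hn⟩ := pow_unbounded_of_one_lt (t / t₀) (show (1 : ℝ) < 3 / 2 by norm_num)
  refine step _ (by positivity) (up n) t ht ?_ y
  rw [div_lt_iff₀ ht₀] at hn
  nlinarith

/-! ### Self-adjoint relations and their resolvents -/

variable (B) in
/-- The graph of a regular self-adjoint operator, characterized by symmetry, density of the
domain and surjectivity of `G - iμ` for real `μ ≠ 0`. -/
structure IsSelfAdjointRel (G : Submodule ℂ (E × E)) : Prop where
  symm : ∀ p ∈ G, ∀ q ∈ G, rinner B p.2 q.1 = rinner B p.1 q.2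
  dense : Dense {x : E | ∃ y, (x, y) ∈ G}
  surj : ∀ μ : ℝ, μ ≠ 0 → ∀ y, ∃ p ∈ G, p.2 - (I * μ) • p.1 = y

omit [StarOrderedRing B] in
/-- For symmetric `G` one has `(u|u) + μ⁻²(s|s) = (y|y)` with `y = u + (i/μ)s`, `(u, s) ∈ G`. -/
theorem rinner_add_smul_self {G : Submodule ℂ (E × E)}
    (hG : ∀ p ∈ G, ∀ q ∈ G, rinner B p.2 q.1 = rinner B p.1 q.2) {p : E × E} (hp : p ∈ G) (μ : ℝ) :
    rinner B (p.1 + (I / μ) • p.2) (p.1 + (I / μ) • p.2)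
      = rinner B p.1 p.1 + rinner B ((I / μ) • p.2) ((I / μ) • p.2) := by
  simp only [rinner_add_left, rinner_add_right, rinner_csmul_left, rinner_csmul_right]
  rw [hG p hp p hp]
  have : (starRingEnd ℂ) (I / μ) = -(I / μ) := by simp [neg_div]
  rw [this]
  simp only [neg_smul, smul_add]
  abel

variable (B) in
/-- The resolvent estimates for `y = u + (i/μ)s`: `‖u‖ ≤ ‖y‖` and `‖s‖ / |μ| ≤ ‖y‖`. -/
theorem norm_le_of_symm {G : Submodule ℂ (E × E)}
    (hG : ∀ p ∈ G, ∀ q ∈ G, rinner B p.2 q.1 = rinner B p.1 q.2) {p : E × E} (hp : p ∈ G) (μ : ℝ) :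
    ‖p.1‖ ≤ ‖p.1 + (I / μ) • p.2‖ ∧ ‖(I / μ) • p.2‖ ≤ ‖p.1 + (I / μ) • p.2‖ := by
  constructor
  · refine le_of_sq_le_sq ?_ (norm_nonneg _)
    rw [← norm_rinner_self (B := B) (p.1 + (I / μ) • p.2), rinner_add_smul_self hG hp]
    exact sq_norm_le_of_nonneg B _ (rinner_self_nonneg _)
  · refine le_of_sq_le_sq ?_ (norm_nonneg _)
    rw [← norm_rinner_self (B := B) (p.1 + (I / μ) • p.2), rinner_add_smul_self hG hp, add_comm]
    exact sq_norm_le_of_nonneg B _ (rinner_self_nonneg _)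

theorem I_div_mul_neg {μ : ℝ} (hμ : μ ≠ 0) : (I / μ : ℂ) * (-(I * μ)) = 1 := by
  have : (μ : ℂ) ≠ 0 := by exact_mod_cast hμ
  field_simp
  simp

theorem add_smul_smul_sub {F : Type*} [AddCommGroup F] [Module ℂ F] {μ : ℝ} (hμ : μ ≠ 0) (x y : F) :
    y + (I / μ : ℂ) • ((-(I * μ) : ℂ) • (x - y)) = x := by
  rw [smul_smul, I_div_mul_neg hμ, one_smul, add_sub_cancel]

/-- The resolvent `(1 + (i/μ) G)⁻¹` as a bounded operator. Its value at `x` is the `z` with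
`(z, -iμ(x - z)) ∈ G`. -/
theorem exists_smoothing {G : Submodule ℂ (E × E)} (hG : IsSelfAdjointRel B G) {μ : ℝ}
    (hμ : μ ≠ 0) : ∃ J : E →L[ℂ] E, ∀ x, (J x, (-(I * μ)) • (x - J x)) ∈ G := by
  have hI := I_div_mul_neg hμ
  have hI' : (-(I * μ)) * (I / μ : ℂ) = 1 := by rw [mul_comm, hI]
  have hs : ∀ y, ∃ p ∈ G, p.1 + (I / μ) • p.2 = y := by
    intro y
    obtain ⟨p, hp, h⟩ := hG.surj μ hμ ((-(I * μ)) • y)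
    refine ⟨p, hp, ?_⟩
    have := congrArg (fun z => (I / μ : ℂ) • z) h
    simp only [smul_smul, hI, one_smul] at this
    rw [← this, smul_sub, smul_smul, sub_eq_add_neg, ← neg_smul, ← mul_neg, hI, one_smul, add_comm]
  choose g hg hgy using hs
  have huniq : ∀ p ∈ G, (g (p.1 + (I / μ) • p.2)).1 = p.1 := by
    intro p hp
    have h1 := (norm_le_of_symm B hG.symm (G.sub_mem (hg (p.1 + (I / μ) • p.2)) hp) μ).1
    have h3 : (g (p.1 + (I / μ) • p.2) - p).1 + (I / μ : ℂ) • (g (p.1 + (I / μ) • p.2) - p).2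
        = 0 := by
      simp only [Prod.snd_sub, Prod.fst_sub, smul_sub]
      rw [sub_add_sub_comm, hgy, sub_self]
    rw [h3, norm_zero] at h1
    simpa [sub_eq_zero] using h1
  refine ⟨LinearMap.mkContinuous
    { toFun := fun z => (g z).1
      map_add' := fun a b => by
        have := huniq _ (G.add_mem (hg a) (hg b))
        rw [Prod.snd_add, Prod.fst_add, smul_add, add_add_add_comm, hgy, hgy] at this
        exact this
      map_smul' := fun c a => by
        have := huniq _ (G.smul_mem c (hg a))
        rw [Prod.smul_snd, Prod.smul_fst, smul_comm, ← smul_add, hgy] at this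
        exact this } 1 fun z => by
      have := (norm_le_of_symm B hG.symm (hg z) μ).1
      rw [hgy] at this
      simpa using this, fun x => ?_⟩
  change ((g x).1, _ • (x - (g x).1)) ∈ G
  have h4 : (-(I * μ) : ℂ) • (x - (g x).1) = (g x).2 := by
    rw [sub_eq_iff_eq_add'.mpr (hgy x).symm, smul_smul, hI', one_smul]
  rw [h4]
  exact hg x

open scoped Classical in
/-- The operator `(1 + (i/μ) G)⁻¹`. As `μ → ±∞` it converges strongly to the identity. -/
noncomputable def smoothing (G : Submodule ℂ (E × E)) (μ : ℝ) : E →L[ℂ] E :=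
  if h : ∃ J : E →L[ℂ] E, ∀ x, (J x, (-(I * μ)) • (x - J x)) ∈ G then h.choose else 0

namespace IsSelfAdjointRel

variable {G : Submodule ℂ (E × E)} (hG : IsSelfAdjointRel B G) {μ : ℝ} (hμ : μ ≠ 0)
include hG hμ

theorem smoothing_mem (x : E) : (smoothing G μ x, (-(I * μ)) • (x - smoothing G μ x)) ∈ G := by
  rw [smoothing, dif_pos (exists_smoothing hG hμ)]
  exact (exists_smoothing hG hμ).choose_spec x

theorem smoothing_eq {p : E × E} (hp : p ∈ G) : smoothing G μ (p.1 + (I / μ) • p.2) = p.1 := by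
  set x := p.1 + (I / μ) • p.2 with hx
  have hm := G.sub_mem (hG.smoothing_mem hμ x) hp
  have h1 := (norm_le_of_symm B hG.symm hm μ).1
  have hI := I_div_mul_neg hμ
  have h3 : (smoothing G μ x - p.1) + (I / μ : ℂ) • ((-(I * μ) : ℂ) • (x - smoothing G μ x) - p.2)
      = 0 := by
    rw [smul_sub, smul_smul, hI, one_smul]
    rw [show (I / μ : ℂ) • p.2 = x - p.1 by rw [hx]; abel]
    abel
  simp only [Prod.fst_sub, Prod.snd_sub] at h1
  rw [h3, norm_zero] at h1
  simpa [sub_eq_zero] using h1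

theorem norm_smoothing_le (x : E) : ‖smoothing G μ x‖ ≤ ‖x‖ := by
  have := (norm_le_of_symm B hG.symm (hG.smoothing_mem hμ x) μ).1
  rwa [add_smul_smul_sub hμ] at this

theorem norm_sub_smoothing_le (x : E) : ‖x - smoothing G μ x‖ ≤ ‖x‖ := by
  have := (norm_le_of_symm B hG.symm (hG.smoothing_mem hμ x) μ).2
  rw [add_smul_smul_sub hμ] at this
  have hI := I_div_mul_neg hμ
  rwa [smul_smul, hI, one_smul] at this

/-- `G` commutes with its smoothing operators. -/
theorem smoothing_mem_of_mem {p : E × E} (hp : p ∈ G) :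
    (smoothing G μ p.1, smoothing G μ p.2) ∈ G := by
  have h1 := hG.smoothing_mem hμ p.1
  have h2 := hG.smoothing_eq hμ (G.smul_mem (-(I * μ) : ℂ) (G.sub_mem hp h1))
  simp only [Prod.smul_fst, Prod.smul_snd, Prod.fst_sub, Prod.snd_sub] at h2
  have hI := I_div_mul_neg hμ
  rw [smul_smul (I / μ : ℂ), hI, one_smul, add_sub_cancel] at h2
  rw [h2]
  exact h1

/-- For `y = (u, s) ∈ G`, `‖u - J u‖ ≤ ‖s‖ / |μ|`. -/
theorem norm_sub_smoothing_le_of_mem {p : E × E} (hp : p ∈ G) :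
    ‖p.1 - smoothing G μ p.1‖ ≤ ‖p.2‖ / |μ| := by
  have h := hG.smoothing_eq hμ hp
  rw [map_add, map_smul] at h
  have : p.1 - smoothing G μ p.1 = (I / μ : ℂ) • smoothing G μ p.2 := by
    rw [sub_eq_iff_eq_add', h]
  rw [this, norm_smul, norm_div, Complex.norm_I, Complex.norm_real, Real.norm_eq_abs]
  have := hG.norm_smoothing_le hμ p.2
  rw [one_div, inv_mul_eq_div]
  gcongr

theorem smoothing_comm {ν : ℝ} (hν : ν ≠ 0) (x : E) :
    smoothing G μ (smoothing G ν x) = smoothing G ν (smoothing G μ x) := by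
  have h1 := hG.smoothing_mem_of_mem hμ (hG.smoothing_mem hν x)
  have h2 := hG.smoothing_eq hν h1
  simp only at h2
  rw [← map_smul, ← map_add, add_smul_smul_sub hν] at h2
  exact h2.symm

end IsSelfAdjointRel

end Relations

/-! ### Almost commuting and almost anti-commuting relations -/

section AlmostCommuting

variable {B : Type v} [NonUnitalCStarAlgebra B] [PartialOrder B] [StarOrderedRing B]
  {E : Type w} [NormedAddCommGroup E] [NormedSpace ℂ E] [SMul Bᵐᵒᵖ E] [CStarModule Bᵐᵒᵖ E]

/-- Almost commuting (`ε = 1`) or almost anti-commuting (`ε = -1`) self-adjoint relations `S`, `T`: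
the resolvents of `S` preserve `Dom T`, and `S T - ε T S` is defined on all
`z ∈ Dom S ∩ Dom T` with `S z ∈ Dom T`, where it is bounded relative to `S`. -/
structure IsAlmostCommRel (ε : ℝ) (S T : Submodule ℂ (E × E)) (C : ℝ) : Prop where
  sign : ε = 1 ∨ ε = -1
  nonneg : 0 ≤ C
  resolvent : ∀ μ : ℝ, μ ≠ 0 → ∀ u s, (u, s) ∈ S →
    (∃ y, (u + (I / μ : ℂ) • s, y) ∈ T) → ∃ t, (u, t) ∈ T
  comm : ∀ z s t w, (z, s) ∈ S → (z, t) ∈ T → (s, w) ∈ T →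
    ∃ v, (t, v) ∈ S ∧ ‖v - (ε : ℂ) • w‖ ≤ C * (‖s‖ + ‖z‖)

/-- `T J_μ u = J_{εμ} (T u + (iε/μ) k)`, where `k` is the value of `S T - ε T S` at `J_μ u`. -/
theorem IsAlmostCommRel.exists_smoothing {ε C : ℝ} {S T : Submodule ℂ (E × E)}
    (h : IsAlmostCommRel ε S T C) (hS : IsSelfAdjointRel B S) {μ : ℝ} (hμ : μ ≠ 0) {u t : E}
    (hut : (u, t) ∈ T) :
    ∃ t' k w, (smoothing S μ u, t') ∈ T ∧ ((-(I * μ) : ℂ) • (u - smoothing S μ u), w) ∈ T ∧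
      t' = smoothing S (ε * μ) (t + (I * ε / μ : ℂ) • k) ∧
      ‖k‖ ≤ C * (‖(-(I * μ) : ℂ) • (u - smoothing S μ u)‖ + ‖smoothing S μ u‖) := by
  set z := smoothing S μ u with hz
  set s := (-(I * μ) : ℂ) • (u - z) with hs
  have hzs : (z, s) ∈ S := hS.smoothing_mem hμ u
  have hu : z + (I / μ : ℂ) • s = u := add_smul_smul_sub hμ u z
  obtain ⟨t', ht'⟩ := h.resolvent μ hμ z s hzs ⟨t, by rwa [hu]⟩
  obtain ⟨w, hsw, ht⟩ : ∃ w, (s, w) ∈ T ∧ t' + (I / μ : ℂ) • w = t :=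
    ⟨(-(I * μ) : ℂ) • (t - t'), T.smul_mem (-(I * μ) : ℂ) (T.sub_mem hut ht'),
      add_smul_smul_sub hμ t t'⟩
  obtain ⟨v, hv, hk⟩ := h.comm z s t' w hzs ht' hsw
  refine ⟨t', v - (ε : ℂ) • w, w, ht', hsw, ?_, hk⟩
  have hε : (ε : ℂ) * ε = 1 := by rcases h.sign with h | h <;> simp [h]
  have hε0 : ε ≠ 0 := by rcases h.sign with h | h <;> simp [h]
  have e1 : t + (I * ε / μ : ℂ) • (v - (ε : ℂ) • w) = t' + (I / ((ε * μ : ℝ) : ℂ)) • v := by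
    rw [← ht, smul_sub, smul_smul]
    have e2 : (I * ε / μ * ε : ℂ) = I / μ := by
      rw [div_mul_eq_mul_div, mul_assoc, hε, mul_one]
    have e3 : (I / ((ε * μ : ℝ) : ℂ)) = I * ε / μ := by
      have h0 : (ε : ℂ) ≠ 0 := by exact_mod_cast hε0
      have : (μ : ℂ) ≠ 0 := by exact_mod_cast hμ
      push_cast
      rw [div_eq_div_iff (mul_ne_zero h0 this) this]
      linear_combination (-(I * μ)) * hε
    rw [e2, e3]
    abel
  rw [e1]
  exact (hS.smoothing_eq (mul_ne_zero hε0 hμ) hv).symm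

variable [CompleteSpace E]

/-- Solution of `T x + S J_n x - iκ x = y`. The sign condition `0 < κ n` makes the bounded
perturbation `S J_n` of `T` dissipative with respect to `- iκ`. -/
theorem IsSelfAdjointRel.exists_smoothed_sum {S T : Submodule ℂ (E × E)}
    (hS : IsSelfAdjointRel B S) (hT : IsSelfAdjointRel B T) {κ n : ℝ} (hκn : 0 < κ * n) (y : E) :
    ∃ x t, (x, t) ∈ T ∧ t + (-(I * n) : ℂ) • (x - smoothing S n x) - (I * κ) • x = y ∧
      |κ| * ‖x‖ ≤ ‖y‖ ∧ |κ| * ‖(-(I * n) : ℂ) • (x - smoothing S n x)‖ ^ 2 ≤ |n| * ‖y‖ ^ 2 := by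
  have hκ : κ ≠ 0 := by rintro rfl; simp at hκn
  have hn : n ≠ 0 := by rintro rfl; simp at hκn
  have hκ' : 0 < |κ| := abs_pos.mpr hκ
  obtain ⟨σ, hσκ, hσ, hσn⟩ : ∃ σ : ℝ, σ * κ = |κ| ∧ σ * σ = 1 ∧ σ / n = 1 / |n| := by
    rcases lt_or_gt_of_ne hκ with h | h
    · have : n < 0 := by nlinarith
      exact ⟨-1, by rw [abs_of_neg h]; ring, by ring, by rw [abs_of_neg this]; field_simp⟩
    · have : 0 < n := by nlinarith
      exact ⟨1, by rw [abs_of_pos h]; ring, by ring, by rw [abs_of_pos this]⟩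
  have hσ0 : σ ≠ 0 := by rintro rfl; simp at hσ
  have hσC : (σ : ℂ) * σ = 1 := by exact_mod_cast hσ
  have hIσ : (I * σ : ℂ) * (I * σ) = -1 := by linear_combination I_sq * σ * σ - hσC
  set P : E →L[ℂ] E := (-(I * n) : ℂ) • (ContinuousLinearMap.id ℂ E - smoothing S n) with hP
  have hPx : ∀ x, P x = (-(I * n) : ℂ) • (x - smoothing S n x) := fun x => by simp [hP]
  -- the relation `iσ (T + S J_n)`, with `σ` the sign of `κ`, is accretive
  have hacc0 : ∀ p ∈ T,
      rinner B p.1 ((I * σ : ℂ) • p.2) + rinner B ((I * σ : ℂ) • p.2) p.1 = 0 := by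
    intro p hp
    rw [rinner_csmul_left, rinner_csmul_right, hT.symm p hp p hp]
    simp
  -- `Re (x | iσ P x) = |n|⁻¹ (P x|P x)`, because `σ` is also the sign of `n`
  have haccP : ∀ x, rinner B x ((I * σ : ℂ) • P x) + rinner B ((I * σ : ℂ) • P x) x
      = ((2 * (1 / |n|) : ℝ) : ℂ) • rinner B (P x) (P x) := by
    intro x
    have hm := hS.smoothing_mem hn x
    rw [← hPx] at hm
    have hx : smoothing S n x + (I / n : ℂ) • P x = x := by
      rw [hPx]; exact add_smul_smul_sub hn x _
    have h1 := hS.symm _ hm _ hm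
    simp only at h1
    have h2 : rinner B x (P x) = rinner B (smoothing S n x) (P x)
        + (starRingEnd ℂ (I / n)) • rinner B (P x) (P x) := by
      rw [← rinner_csmul_left, ← rinner_add_left, hx]
    have h3 : rinner B (P x) x = rinner B (smoothing S n x) (P x)
        + (I / n : ℂ) • rinner B (P x) (P x) := by
      rw [← h1, ← rinner_csmul_right, ← rinner_add_right, hx]
    rw [rinner_csmul_left, rinner_csmul_right, h2, h3]
    have c1 : (starRingEnd ℂ) (I * (σ : ℂ)) = -(I * σ) := by simp
    have c2 : (starRingEnd ℂ) (I / (n : ℂ)) = -(I / n) := by simp [neg_div]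
    rw [c1, c2, ← hσn]
    have hnC : (n : ℂ) ≠ 0 := by exact_mod_cast hn
    match_scalars
    · ring
    · field_simp
      linear_combination (-2 * σ : ℂ) * I_sq
  let A₀ : Submodule ℂ (E × E) :=
    T.map (LinearMap.prod (LinearMap.fst ℂ E E) ((I * σ : ℂ) • LinearMap.snd ℂ E E))
  let A : Submodule ℂ (E × E) :=
    T.map (LinearMap.prod (LinearMap.fst ℂ E E)
      ((I * σ : ℂ) • (LinearMap.snd ℂ E E + (P : E →ₗ[ℂ] E) ∘ₗ LinearMap.fst ℂ E E)))
  have hA₀ : ∀ p ∈ A₀, 0 ≤ rinner B p.1 p.2 + rinner B p.2 p.1 := by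
    rintro _ ⟨p, hp, rfl⟩
    exact (hacc0 p hp).symm.le
  have hA_eq : ∀ p ∈ T, rinner B p.1 ((I * σ : ℂ) • (p.2 + P p.1))
      + rinner B ((I * σ : ℂ) • (p.2 + P p.1)) p.1
      = ((2 * (1 / |n|) : ℝ) : ℂ) • rinner B (P p.1) (P p.1) := by
    intro p hp
    rw [← haccP, smul_add, rinner_add_left, rinner_add_right, add_add_add_comm, hacc0 p hp,
      zero_add]
  have hpos : ∀ x, (0 : B) ≤ ((2 * (1 / |n|) : ℝ) : ℂ) • rinner B (P x) (P x) := fun x => by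
    rw [Complex.coe_smul]
    exact smul_nonneg (by positivity) (rinner_self_nonneg _)
  have hA : ∀ p ∈ A, 0 ≤ rinner B p.1 p.2 + rinner B p.2 p.1 := by
    rintro _ ⟨p, hp, rfl⟩
    exact (hpos p.1).trans (hA_eq p hp).symm.le
  have hA₀s : ∀ t : ℝ, 0 < t → ∀ y, ∃ p ∈ A₀, p.2 + (t : ℂ) • p.1 = y := by
    intro t ht y
    obtain ⟨p, hp, hpy⟩ := hT.surj (σ * t) (mul_ne_zero hσ0 ht.ne') (-(I * σ : ℂ) • y)
    refine ⟨_, ⟨p, hp, rfl⟩, ?_⟩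
    change (I * σ : ℂ) • p.2 + (t : ℂ) • p.1 = y
    have := congrArg (fun z => (I * σ : ℂ) • z) hpy
    simp only [smul_sub, smul_smul] at this
    rw [mul_neg, hIσ, neg_neg, one_smul] at this
    rw [← this, sub_eq_add_neg, ← neg_smul]
    congr 2
    push_cast
    linear_combination (t : ℂ) * hIσ
  have hsurj : ∀ y, ∃ p ∈ A, p.2 + ((|κ| : ℝ) : ℂ) • p.1 = y := by
    set t₀ := ‖(I * σ : ℂ) • P‖ + 1 with ht₀
    have ht₀' : 0 < t₀ := by positivity
    refine accretive_surjective B hA ht₀' ?_ hκ'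
    intro y
    obtain ⟨_, ⟨p, hp, rfl⟩, hpy⟩ := surjective_add_of_norm_lt ht₀'
      (fun p hp => accretive_bound B (hA₀ p hp) ht₀') (hA₀s t₀ ht₀') ((I * σ : ℂ) • P)
      (by rw [ht₀]; linarith) y
    refine ⟨_, ⟨p, hp, rfl⟩, ?_⟩
    rw [← hpy]
    change (I * σ : ℂ) • (p.2 + P p.1) + _ = (I * σ : ℂ) • p.2 + _ + (I * σ : ℂ) • P p.1
    simp only [smul_add]
    exact add_right_comm _ _ _
  obtain ⟨_, ⟨p, hp, rfl⟩, hpy⟩ := hsurj ((I * σ : ℂ) • y)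
  change (I * σ : ℂ) • (p.2 + P p.1) + ((|κ| : ℝ) : ℂ) • p.1 = _ at hpy
  have hnormI : ‖(I * σ : ℂ)‖ = 1 := by
    have : |σ| * |σ| = 1 := by rw [← abs_mul, hσ, abs_one]
    rw [norm_mul, Complex.norm_I, one_mul, Complex.norm_real, Real.norm_eq_abs]
    nlinarith [abs_nonneg σ]
  have hb1 : |κ| * ‖p.1‖ ≤ ‖y‖ := by
    have := accretive_bound B ((hpos p.1).trans (hA_eq p hp).symm.le) hκ'
    rw [hpy, norm_smul, hnormI, one_mul] at this
    exact this
  refine ⟨p.1, p.2, hp, ?_, hb1, ?_⟩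
  · rw [← hPx]
    have := congrArg (fun z => (-(I * σ) : ℂ) • z) hpy
    simp only [smul_add, smul_smul, neg_mul, hIσ, neg_neg, one_smul] at this
    rw [← this, sub_eq_add_neg, ← neg_smul]
    congr 2
    rw [← hσκ]
    push_cast
    linear_combination (I * κ) * hσC
  · rw [← hPx]
    have e : rinner B p.1 ((I * σ : ℂ) • y) + rinner B ((I * σ : ℂ) • y) p.1
        = ((2 * (1 / |n|) : ℝ) : ℂ) • rinner B (P p.1) (P p.1)
          + ((2 * |κ| : ℝ) : ℂ) • rinner B p.1 p.1 := by
      rw [← hpy, rinner_add_left, rinner_add_right, add_add_add_comm, hA_eq p hp, rinner_csmul_left,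
        rinner_csmul_right, Complex.conj_ofReal, ← add_smul]
      congr 2
      push_cast
      ring
    have h2 : (2 * (1 / |n|)) * ‖P p.1‖ ^ 2 ≤ 2 * (‖p.1‖ * ‖y‖) := by
      calc (2 * (1 / |n|)) * ‖P p.1‖ ^ 2
          = ‖((2 * (1 / |n|) : ℝ) : ℂ) • rinner B (P p.1) (P p.1)‖ := by
            rw [norm_smul, norm_rinner_self, Complex.norm_real,
              Real.norm_of_nonneg (by positivity)]
        _ ≤ ‖rinner B p.1 ((I * σ : ℂ) • y) + rinner B ((I * σ : ℂ) • y) p.1‖ := by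
            rw [e]
            refine CStarAlgebra.norm_le_norm_of_nonneg_of_le (hpos _) ?_
            rw [le_add_iff_nonneg_right, Complex.coe_smul]
            exact smul_nonneg (by positivity) (rinner_self_nonneg _)
        _ ≤ ‖p.1‖ * ‖(I * σ : ℂ) • y‖ + ‖(I * σ : ℂ) • y‖ * ‖p.1‖ :=
            (norm_add_le _ _).trans (add_le_add (norm_rinner_le _ _) (norm_rinner_le _ _))
        _ = 2 * (‖p.1‖ * ‖y‖) := by rw [norm_smul, hnormI]; ring
    have hn' : 0 < |n| := abs_pos.mpr hn
    have h3 : ‖P p.1‖ ^ 2 ≤ |n| * (‖p.1‖ * ‖y‖) := by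
      have h4 : (2 * (1 / |n|)) * ‖P p.1‖ ^ 2 = 2 * (‖P p.1‖ ^ 2 / |n|) := by ring
      rw [h4] at h2
      have h5 : ‖P p.1‖ ^ 2 / |n| ≤ ‖p.1‖ * ‖y‖ := by linarith
      rwa [div_le_iff₀' hn'] at h5
    calc |κ| * ‖P p.1‖ ^ 2 ≤ |κ| * (|n| * (‖p.1‖ * ‖y‖)) := by gcongr
      _ = |n| * ((|κ| * ‖p.1‖) * ‖y‖) := by ring
      _ ≤ |n| * (‖y‖ * ‖y‖) := by gcongr
      _ = _ := by ring

set_option maxHeartbeats 1600000 in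
/-- For large `|κ|` every `y ∈ Dom S` is approximated up to half its norm by the range of
`S + T - iκ`. With `x` as in `exists_smoothed_sum` and `u = J_n x`, the approximate preimage of `y`
is `½ (J_m + J_{-m}) u`, where `m = κM` and `n = κM⁴`. The commutator error is `O(1/|κ|)`, all other
errors are `O(1/M)`. -/
theorem IsAlmostCommRel.exists_approx {ε C : ℝ} {S T : Submodule ℂ (E × E)}
    (h : IsAlmostCommRel ε S T C) (hS : IsSelfAdjointRel B S) (hT : IsSelfAdjointRel B T) {κ : ℝ}
    (hκ1 : 1 ≤ |κ|) (hκC : 8 * C ≤ |κ|) {y y' : E} (hy : (y, y') ∈ S) :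
    ∃ z s t w, (z, s) ∈ S ∧ (z, t) ∈ T ∧ (s, w) ∈ T ∧ ‖s + t - (I * κ) • z - y‖ ≤ 1 / 2 * ‖y‖ := by
  rcases eq_or_ne y 0 with rfl | hy0
  · exact ⟨0, 0, 0, 0, S.zero_mem, T.zero_mem, T.zero_mem, by simp⟩
  have hY : 0 < ‖y‖ := norm_pos_iff.mpr hy0
  have hC := h.nonneg
  have hκ0 : κ ≠ 0 := by rintro rfl; norm_num at hκ1
  -- the errors other than the commutator `e` below add up to at most `Q / M ≤ ‖y‖ / 4`
  set Q := 3 * ‖y‖ + 2 * C * ‖y‖ + 2 * ‖y'‖ with hQ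
  set M : ℝ := 1 + 4 * Q / ‖y‖ with hM
  have hQ0 : 0 ≤ Q := by positivity
  have hM1 : 1 ≤ M := by rw [hM, le_add_iff_nonneg_right]; positivity
  have hM0 : 0 < M := by linarith
  have hQM : Q / M ≤ ‖y‖ / 4 := by
    rw [div_le_iff₀ hM0, hM]
    field_simp
    nlinarith
  set m := κ * M with hm
  set n := κ * M ^ 4 with hn
  have hm0 : m ≠ 0 := mul_ne_zero hκ0 hM0.ne'
  have hm0' : -m ≠ 0 := neg_ne_zero.mpr hm0
  have hn0 : n ≠ 0 := mul_ne_zero hκ0 (by positivity)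
  have hmabs : |m| = |κ| * M := by rw [hm, abs_mul, abs_of_pos hM0]
  have hnabs : |n| = |κ| * M ^ 4 := by rw [hn, abs_mul, abs_of_pos (pow_pos hM0 4)]
  have hmM : M ≤ |m| := by rw [hmabs]; nlinarith
  have hnM : M ^ 4 ≤ |n| := by rw [hnabs]; nlinarith [pow_pos hM0 4]
  have hM4 : M ≤ M ^ 4 := by
    calc M = M ^ 1 := (pow_one M).symm
      _ ≤ M ^ 4 := pow_le_pow_right₀ hM1 (by norm_num)
  have hκn : 0 < κ * n := by
    rw [hn, ← mul_assoc]
    have : 0 < κ * κ := mul_self_pos.mpr hκ0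
    positivity
  obtain ⟨x, t, hxt, hxy, hbx, hbs⟩ := hS.exists_smoothed_sum hT hκn y
  have hsm := hS.smoothing_mem hn0 x
  set u := smoothing S n x with hu
  set s := (-(I * n) : ℂ) • (x - u) with hs
  have hux : u + (I / n : ℂ) • s = x := add_smul_smul_sub hn0 x u
  have hx : ‖x‖ ≤ ‖y‖ := by nlinarith [norm_nonneg x]
  have hx' : |κ| * ‖x‖ ≤ ‖y‖ := hbx
  have hu_le : ‖u‖ ≤ ‖x‖ := hS.norm_smoothing_le hn0 x
  have hs_le : ‖s‖ ≤ M ^ 2 * ‖y‖ := by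
    refine le_of_sq_le_sq ?_ (by positivity)
    rw [hnabs, mul_assoc] at hbs
    have := le_of_mul_le_mul_left hbs (by linarith : 0 < |κ|)
    calc ‖s‖ ^ 2 ≤ M ^ 4 * ‖y‖ ^ 2 := this
      _ = _ := by ring
  -- `T u`
  obtain ⟨tu, k, -, htu, -, htu_eq, hk⟩ := h.exists_smoothing hS hn0 hxt
  rw [← hu, ← hs] at hk
  rw [← hu] at htu
  have hεn : ε * n ≠ 0 := mul_ne_zero (by rcases h.sign with h | h <;> simp [h]) hn0
  have hεm : ε * m ≠ 0 := mul_ne_zero (by rcases h.sign with h | h <;> simp [h]) hm0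
  have hεm' : ε * -m ≠ 0 := mul_ne_zero (by rcases h.sign with h | h <;> simp [h]) hm0'
  have hεn_abs : |ε * n| = |n| := by rcases h.sign with h | h <;> simp [h]
  -- `T J_{± m} u`
  obtain ⟨t₁, k₁, w₁, ht₁, hw₁, ht₁_eq, hk₁⟩ := h.exists_smoothing hS hm0 htu
  obtain ⟨t₂, k₂, w₂, ht₂, hw₂, ht₂_eq, hk₂⟩ := h.exists_smoothing hS hm0' htu
  have hs₁ := hS.smoothing_mem hm0 u
  have hs₂ := hS.smoothing_mem hm0' u
  set q : E →L[ℂ] E := (1 / 2 : ℂ) • (smoothing S m + smoothing S (-m)) with hq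
  have hqx : ∀ a, q a = (1 / 2 : ℂ) • (smoothing S m a + smoothing S (-m) a) := fun a => by
    simp [hq]
  have half : ∀ a b : E, ∀ r : ℝ, ‖a‖ ≤ r → ‖b‖ ≤ r → ‖(1 / 2 : ℂ) • (a + b)‖ ≤ r := by
    intro a b r ha hb
    rw [norm_smul]
    have : ‖(1 / 2 : ℂ)‖ = 1 / 2 := by norm_num
    rw [this]
    linarith [norm_add_le a b]
  have hq_le : ∀ a, ‖q a‖ ≤ ‖a‖ := fun a => by
    rw [hqx]
    exact half _ _ _ (hS.norm_smoothing_le hm0 a) (hS.norm_smoothing_le hm0' a)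
  have hqS : ∀ p ∈ S, (q p.1, q p.2) ∈ S := fun p hp => by
    rw [hqx, hqx]
    exact S.smul_mem _ (S.add_mem (hS.smoothing_mem_of_mem hm0 hp)
      (hS.smoothing_mem_of_mem hm0' hp))
  -- `T q u = q T u + e`
  set e : E := (1 / 2 : ℂ) • (smoothing S (ε * m) ((I * ε / m : ℂ) • k₁)
    + smoothing S (ε * -m) ((I * ε / ((-m : ℝ) : ℂ)) • k₂)) with he
  have hqT : (q u, q tu + e) ∈ T := by
    have h1 := T.smul_mem (1 / 2 : ℂ) (T.add_mem ht₁ ht₂)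
    have h2 : (1 / 2 : ℂ) • (t₁ + t₂) = q tu + e := by
      rw [he, hqx, ← smul_add, ht₁_eq, ht₂_eq, map_add, map_add]
      congr 1
      rcases h.sign with h | h
      · rw [h, one_mul, one_mul]; abel
      · rw [h, neg_one_mul, neg_one_mul, neg_neg]; abel
    rw [← h2, hqx]
    exact h1
  have hqw : ∃ w, (q s, w) ∈ T := by
    -- `S q u` is a combination of `u` and `J_{± m} u`, all of which lie in `Dom T`
    refine ⟨(1 / 2 : ℂ) • (w₁ + w₂), ?_⟩
    have h1 := T.smul_mem (1 / 2 : ℂ) (T.add_mem hw₁ hw₂)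
    have h2 := S.sub_mem (hS.smoothing_mem_of_mem hm0 hsm) hs₁
    have h3 := S.sub_mem (hS.smoothing_mem_of_mem hm0' hsm) hs₂
    have zero_snd : ∀ a : E, ((0 : E), a) ∈ S → a = 0 := fun a ha => by
      refine eq_zero_of_dense B hS.dense fun x' hx' => ?_
      obtain ⟨y', hy'⟩ := hx'
      have := hS.symm _ hy' _ ha
      simpa using this.symm
    simp only [Prod.mk_sub_mk, sub_self] at h2 h3
    rw [hqx, sub_eq_zero.mp (zero_snd _ h2), sub_eq_zero.mp (zero_snd _ h3)]
    exact h1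
  obtain ⟨w, hw⟩ := hqw
  refine ⟨q u, q s, q tu + e, w, hqS _ hsm, hqT, hw, ?_⟩
  set J' := smoothing S (ε * n) with hJ'
  have hJ'_le : ∀ a, ‖J' a‖ ≤ ‖a‖ := hS.norm_smoothing_le hεn
  have hcomm : ∀ a, q (J' a) = J' (q a) := fun a => by
    rw [hqx, hqx, map_smul, map_add, hS.smoothing_comm hm0 hεn, hS.smoothing_comm hm0' hεn]
  -- apply `J' = J_{εn}` and `q` to the equation for `x`, and use `T u = J' (T x + (iε/n) k)`
  have hdecomp : q s + (q tu + e) - (I * κ) • q u - y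
      = (q s - J' (q s)) + q ((I * κ) • (J' x - u)) + q (J' ((I * ε / n : ℂ) • k)) + e
        + q (J' y - y) + (q y - y) := by
    have h1 : t = y - s + (I * κ) • x := by rw [← hxy]; abel
    rw [htu_eq, h1, ← hcomm]
    simp only [map_add, map_sub, map_smul, smul_sub]
    abel
  rw [hdecomp]
  -- `‖S q s‖ ≤ |m| ‖s‖ ≤ |m| M² ‖y‖`, and `n = m M³`
  have b1 : ‖q s - J' (q s)‖ ≤ ‖y‖ / M := by
    have hv : ∃ v, (q s, v) ∈ S ∧ ‖v‖ ≤ |m| * ‖s‖ := by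
      refine ⟨(1 / 2 : ℂ) • ((-(I * m) : ℂ) • (s - smoothing S m s)
        + (-(I * ((-m : ℝ) : ℂ)) : ℂ) • (s - smoothing S (-m) s)), ?_, ?_⟩
      · rw [hqx]
        exact S.smul_mem _ (S.add_mem (hS.smoothing_mem hm0 s) (hS.smoothing_mem hm0' s))
      · refine half _ _ _ ?_ ?_
        · rw [norm_smul, norm_neg, norm_mul, Complex.norm_I, one_mul, Complex.norm_real,
            Real.norm_eq_abs]
          gcongr
          exact hS.norm_sub_smoothing_le hm0 s
        · rw [norm_smul, norm_neg, norm_mul, Complex.norm_I, one_mul, Complex.norm_real,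
            Real.norm_eq_abs, abs_neg]
          gcongr
          exact hS.norm_sub_smoothing_le hm0' s
    obtain ⟨v, hv, hvle⟩ := hv
    have := hS.norm_sub_smoothing_le_of_mem hεn hv
    rw [hεn_abs] at this
    refine this.trans ?_
    calc ‖v‖ / |n| ≤ (|m| * (M ^ 2 * ‖y‖)) / |n| := by
          gcongr
          exact hvle.trans (by gcongr)
      _ = ‖y‖ / M := by
          rw [hmabs, hnabs]
          have : |κ| ≠ 0 := by positivity
          field_simp
  have hsn : ‖s‖ / |n| ≤ ‖y‖ / (|κ| * M) := by
    calc ‖s‖ / |n| ≤ (M ^ 2 * ‖y‖) / (|κ| * M ^ 4) := by rw [hnabs]; gcongr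
      _ = ‖y‖ / (|κ| * M) * (1 / M) := by
          have : |κ| ≠ 0 := by positivity
          field_simp
      _ ≤ ‖y‖ / (|κ| * M) * 1 := by
          gcongr
          rw [div_le_one hM0]; exact hM1
      _ = _ := mul_one _
  have b2 : ‖q ((I * κ) • (J' x - u))‖ ≤ 2 * ‖y‖ / M := by
    refine (hq_le _).trans ?_
    rw [norm_smul, norm_mul, Complex.norm_I, one_mul, Complex.norm_real, Real.norm_eq_abs]
    have h1 : J' x - u = (I / n : ℂ) • J' s - (u - J' u) := by
      conv_lhs => rw [← hux]
      rw [map_add, map_smul]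
      abel
    have h2 : ‖(I / n : ℂ) • J' s‖ ≤ ‖s‖ / |n| := by
      rw [norm_smul, norm_div, Complex.norm_I, Complex.norm_real, Real.norm_eq_abs, one_div,
        inv_mul_eq_div]
      gcongr
      exact hJ'_le s
    have h3 := hS.norm_sub_smoothing_le_of_mem hεn hsm
    rw [hεn_abs] at h3
    simp only at h3
    calc |κ| * ‖J' x - u‖ ≤ |κ| * (‖s‖ / |n| + ‖s‖ / |n|) := by
          rw [h1]
          gcongr
          exact (norm_sub_le _ _).trans (add_le_add h2 h3)
      _ ≤ |κ| * (‖y‖ / (|κ| * M) + ‖y‖ / (|κ| * M)) := by gcongr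
      _ = 2 * ‖y‖ / M := by
          have : |κ| ≠ 0 := by positivity
          field_simp
          ring
  have nI : ∀ r : ℝ, ‖(I * ε / r : ℂ)‖ = 1 / |r| := by
    intro r
    rw [norm_div, norm_mul, Complex.norm_I, Complex.norm_real, Complex.norm_real, Real.norm_eq_abs,
      Real.norm_eq_abs]
    rcases h.sign with h | h <;> simp [h]
  have b3 : ‖q (J' ((I * ε / n : ℂ) • k))‖ ≤ 2 * C * ‖y‖ / M := by
    refine (hq_le _).trans ((hJ'_le _).trans ?_)
    rw [norm_smul, nI]
    have h1 : ‖u‖ / |n| ≤ ‖y‖ / M := by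
      gcongr
      · exact hu_le.trans hx
      · exact hM4.trans hnM
    have h2 : ‖s‖ / |n| ≤ ‖y‖ / M := hsn.trans (by gcongr; rw [← hmabs]; exact hmM)
    calc 1 / |n| * ‖k‖ ≤ 1 / |n| * (C * (‖s‖ + ‖u‖)) := by gcongr
      _ = C * (‖s‖ / |n| + ‖u‖ / |n|) := by ring
      _ ≤ C * (‖y‖ / M + ‖y‖ / M) := by gcongr
      _ = _ := by ring
  have b4 : ‖e‖ ≤ ‖y‖ / 4 := by
    have aux : ∀ k' : E, ∀ r : ℝ, |r| = |m| → r ≠ 0 → ε * r ≠ 0 →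
        ‖k'‖ ≤ C * (‖(-(I * r) : ℂ) • (u - smoothing S r u)‖ + ‖smoothing S r u‖) →
        ‖smoothing S (ε * r) ((I * ε / r : ℂ) • k')‖ ≤ ‖y‖ / 4 := by
      intro k' r hr hr0 hεr hk'
      refine (hS.norm_smoothing_le hεr _).trans ?_
      rw [norm_smul, nI, hr]
      have h1 : ‖(-(I * r) : ℂ) • (u - smoothing S r u)‖ ≤ |m| * ‖u‖ := by
        rw [norm_smul, norm_neg, norm_mul, Complex.norm_I, one_mul, Complex.norm_real,
            Real.norm_eq_abs, hr]
        gcongr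
        exact hS.norm_sub_smoothing_le hr0 u
      have h2 := hS.norm_smoothing_le hr0 u
      have hm1 : 1 ≤ |m| := hM1.trans hmM
      calc 1 / |m| * ‖k'‖ ≤ 1 / |m| * (C * (|m| * ‖u‖ + |m| * ‖u‖)) := by
            gcongr
            refine hk'.trans ?_
            gcongr
            exact h2.trans (by nlinarith [norm_nonneg u])
        _ = 2 * C * ‖u‖ := by
            have : |m| ≠ 0 := by positivity
            field_simp
            ring
        _ ≤ |κ| / 4 * ‖x‖ := by
            gcongr
            linarith
        _ ≤ ‖y‖ / 4 := by linarith
    refine half _ _ _ (aux k₁ m rfl hm0 hεm hk₁) (aux k₂ (-m) (abs_neg m) hm0' hεm' hk₂)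
  have b5 : ‖q (J' y - y)‖ ≤ ‖y'‖ / M := by
    refine (hq_le _).trans ?_
    rw [norm_sub_rev]
    have := hS.norm_sub_smoothing_le_of_mem hεn hy
    rw [hεn_abs] at this
    refine this.trans ?_
    simp only
    gcongr
    exact hM4.trans hnM
  have b6 : ‖q y - y‖ ≤ ‖y'‖ / M := by
    have h1 : q y - y = (1 / 2 : ℂ) • ((smoothing S m y - y) + (smoothing S (-m) y - y)) := by
      rw [hqx]
      module
    have h2 := hS.norm_sub_smoothing_le_of_mem hm0 hy
    have h3 := hS.norm_sub_smoothing_le_of_mem hm0' hy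
    have h4 : ‖y'‖ / |m| ≤ ‖y'‖ / M := by gcongr
    rw [h1]
    refine half _ _ _ ?_ ?_
    · rw [norm_sub_rev]; exact h2.trans h4
    · rw [norm_sub_rev]; rw [abs_neg] at h3; exact h3.trans h4
  calc _ ≤ ‖y‖ / M + 2 * ‖y‖ / M + 2 * C * ‖y‖ / M + ‖y‖ / 4 + ‖y'‖ / M + ‖y'‖ / M := by
        refine (norm_add_le _ _).trans (add_le_add ?_ b6)
        refine (norm_add_le _ _).trans (add_le_add ?_ b5)
        refine (norm_add_le _ _).trans (add_le_add ?_ b4)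
        refine (norm_add_le _ _).trans (add_le_add ?_ b3)
        exact (norm_add_le _ _).trans (add_le_add b1 b2)
    _ = Q / M + ‖y‖ / 4 := by rw [hQ]; ring
    _ ≤ ‖y‖ / 4 + ‖y‖ / 4 := by gcongr
    _ = 1 / 2 * ‖y‖ := by ring

omit [CompleteSpace E] [SMul Bᵐᵒᵖ E] [CStarModule Bᵐᵒᵖ E] in
/-- A subspace `R` is dense if every `y` in a dense set has distance at most `‖y‖/2` from `R`. -/
theorem dense_of_half {R : Submodule ℂ E} {D : Set E} (hD : Dense D)
    (h : ∀ y ∈ D, ∃ r ∈ R, ‖r - y‖ ≤ 1 / 2 * ‖y‖) (y : E) {δ : ℝ} (hδ : 0 < δ) :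
    ∃ r ∈ R, ‖r - y‖ < δ := by
  have htop : ∀ y, y ∈ R.topologicalClosure := by
    by_contra! hne
    obtain ⟨x₀, hx₀, hdist⟩ := riesz_lemma (F := R.topologicalClosure)
      R.isClosed_topologicalClosure hne (show (3 / 4 : ℝ) < 1 by norm_num)
    have hx : 0 < ‖x₀‖ := norm_pos_iff.mpr fun h0 => hx₀ (by rw [h0]; exact Submodule.zero_mem _)
    obtain ⟨y, hy, hyd⟩ := Metric.dense_iff.mp hD x₀ (1 / 8 * ‖x₀‖) (by positivity)
    rw [Metric.mem_ball, dist_eq_norm] at hy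
    obtain ⟨r, hr, hry⟩ := h y hyd
    have h1 := hdist r (R.le_topologicalClosure hr)
    have h2 : ‖x₀ - r‖ ≤ ‖y - x₀‖ + ‖r - y‖ := by
      rw [show x₀ - r = -((y - x₀) + (r - y)) by abel, norm_neg]
      exact norm_add_le _ _
    have h3 : ‖y‖ ≤ ‖x₀‖ + ‖y - x₀‖ := by
      have := norm_add_le x₀ (y - x₀)
      rwa [add_sub_cancel] at this
    linarith
  obtain ⟨r, hr, h1⟩ := Metric.mem_closure_iff.mp (htop y) δ hδ
  exact ⟨r, hr, by rwa [dist_comm, dist_eq_norm] at h1⟩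

/-- For large `|κ|`, the operator `S + T - iκ` has dense range, already on those
`z ∈ Dom S ∩ Dom T` for which `S z ∈ Dom T`. -/
theorem IsAlmostCommRel.dense_range {ε C : ℝ} {S T : Submodule ℂ (E × E)}
    (h : IsAlmostCommRel ε S T C) (hS : IsSelfAdjointRel B S) (hT : IsSelfAdjointRel B T) {κ : ℝ}
    (hκ1 : 1 ≤ |κ|) (hκC : 8 * C ≤ |κ|) (y : E) {δ : ℝ} (hδ : 0 < δ) :
    ∃ z s t w, (z, s) ∈ S ∧ (z, t) ∈ T ∧ (s, w) ∈ T ∧ ‖s + t - (I * κ) • z - y‖ < δ := by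
  let R : Submodule ℂ E :=
    { carrier := {r | ∃ z s t w, (z, s) ∈ S ∧ (z, t) ∈ T ∧ (s, w) ∈ T ∧
        s + t - (I * κ : ℂ) • z = r}
      zero_mem' := ⟨0, 0, 0, 0, S.zero_mem, T.zero_mem, T.zero_mem, by simp⟩
      add_mem' := by
        rintro _ _ ⟨z, s, t, w, h1, h2, h3, rfl⟩ ⟨z', s', t', w', h1', h2', h3', rfl⟩
        exact ⟨z + z', s + s', t + t', w + w', S.add_mem h1 h1', T.add_mem h2 h2',
          T.add_mem h3 h3', by rw [smul_add]; abel⟩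
      smul_mem' := by
        rintro c _ ⟨z, s, t, w, h1, h2, h3, rfl⟩
        exact ⟨c • z, c • s, c • t, c • w, S.smul_mem c h1, T.smul_mem c h2, T.smul_mem c h3, by
          rw [smul_sub, smul_add, smul_comm]⟩ }
  obtain ⟨_, ⟨z, s, t, w, h1, h2, h3, rfl⟩, hr⟩ := dense_of_half (R := R) hS.dense
    (fun y ⟨y', hy'⟩ => by
      obtain ⟨z, s, t, w, h1, h2, h3, h4⟩ := h.exists_approx hS hT hκ1 hκC hy'
      exact ⟨_, ⟨z, s, t, w, h1, h2, h3, rfl⟩, h4⟩) y hδ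
  exact ⟨z, s, t, w, h1, h2, h3, hr⟩

end AlmostCommuting

/-! ### Criteria for self-adjointness -/

section SelfAdjointRelations

variable {B : Type v} [NonUnitalCStarAlgebra B] [PartialOrder B] [StarOrderedRing B]
  {E : Type w} [NormedAddCommGroup E] [NormedSpace ℂ E] [SMul Bᵐᵒᵖ E] [CStarModule Bᵐᵒᵖ E]

namespace IsSelfAdjointRel

variable {G : Submodule ℂ (E × E)} (hG : IsSelfAdjointRel B G)
include hG

omit [StarOrderedRing B] in
/-- Self-adjoint relations contain their adjoint. -/
theorem mem_of_adjoint {p : E × E} (h : ∀ q ∈ G, rinner B q.2 p.1 = rinner B q.1 p.2) : p ∈ G := by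
  obtain ⟨r, hr, hrp⟩ := hG.surj 1 one_ne_zero (p.2 - I • p.1)
  rw [Complex.ofReal_one, mul_one] at hrp
  have h2 : (p - r).2 = I • (p - r).1 := by
    simp only [Prod.snd_sub, Prod.fst_sub, smul_sub]
    rw [sub_eq_sub_iff_sub_eq_sub, ← hrp]
  have h3 : ∀ q ∈ G, rinner B q.2 (p - r).1 = rinner B q.1 (p - r).2 := fun q hq => by
    simp only [Prod.fst_sub, Prod.snd_sub, rinner_sub_right]
    rw [h q hq, hG.symm q hq r hr]
  have h4 : (p - r).1 = 0 := by
    obtain ⟨q, hq, hqp⟩ := hG.surj (-1) (by norm_num) (p - r).1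
    have h5 : rinner B (q.2 - (I * ((-1 : ℝ) : ℂ)) • q.1) (p - r).1 = 0 := by
      rw [rinner_sub_left, h3 q hq, h2]
      simp [smul_sub]
    rw [hqp] at h5
    exact eq_zero_of_rinner_self B h5
  have h5 : p - r = 0 := Prod.ext h4 (by rw [h2, h4]; simp)
  rw [sub_eq_zero.mp h5]
  exact hr

theorem isClosed : IsClosed (G : Set (E × E)) := by
  have : (G : Set (E × E)) = ⋂ q ∈ G, {p : E × E | rinner B q.2 p.1 = rinner B q.1 p.2} := by
    ext p
    simp only [SetLike.mem_coe, Set.mem_iInter, Set.mem_ofPred_eq]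
    exact ⟨fun hp q hq => hG.symm q hq p hp, hG.mem_of_adjoint⟩
  rw [this]
  refine isClosed_biInter fun q _ => isClosed_eq ?_ ?_
  · exact Continuous.rinner' B continuous_const continuous_fst
  · exact Continuous.rinner' B continuous_const continuous_snd

theorem eq_zero_of_mem {a : E} (ha : ((0 : E), a) ∈ G) : a = 0 := by
  refine eq_zero_of_dense B hG.dense fun x' ⟨y', hy'⟩ => ?_
  simpa using (hG.symm _ hy' _ ha).symm

theorem snd_unique {x a b : E} (ha : (x, a) ∈ G) (hb : (x, b) ∈ G) : a = b := by
  have := G.sub_mem ha hb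
  rw [Prod.mk_sub_mk, sub_self] at this
  exact sub_eq_zero.mp (hG.eq_zero_of_mem this)

/-- Strong convergence of the smoothing operators to the identity. -/
theorem exists_smoothing_close (y : E) {δ : ℝ} (hδ : 0 < δ) :
    ∃ M : ℝ, 0 < M ∧ ∀ μ : ℝ, M ≤ |μ| → ‖y - smoothing G μ y‖ < δ := by
  obtain ⟨y₀, hy₀, u, hu⟩ := Metric.dense_iff.mp hG.dense y (δ / 2) (by positivity)
  rw [Metric.mem_ball, dist_comm, dist_eq_norm] at hy₀
  refine ⟨2 * ‖u‖ / δ + 1, by positivity, fun μ hμ => ?_⟩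
  have hμ0 : 0 < |μ| := lt_of_lt_of_le (by positivity) hμ
  have hμ' : μ ≠ 0 := abs_pos.mp hμ0
  have h1 := hG.norm_sub_smoothing_le hμ' (y - y₀)
  have h2 := hG.norm_sub_smoothing_le_of_mem hμ' hu
  have h3 : ‖u‖ / |μ| < δ / 2 := by
    rw [div_lt_iff₀ hμ0]
    have : δ / 2 * (2 * ‖u‖ / δ + 1) ≤ δ / 2 * |μ| := by gcongr
    have h4 : δ / 2 * (2 * ‖u‖ / δ + 1) = ‖u‖ + δ / 2 := by field_simp
    linarith
  calc ‖y - smoothing G μ y‖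
      = ‖((y - y₀) - smoothing G μ (y - y₀)) + (y₀ - smoothing G μ y₀)‖ := by
        rw [map_sub]; congr 1; abel
    _ ≤ ‖y - y₀‖ + ‖u‖ / |μ| := (norm_add_le _ _).trans (add_le_add h1 h2)
    _ < δ := by linarith

end IsSelfAdjointRel

omit [SMul Bᵐᵒᵖ E] [CStarModule Bᵐᵒᵖ E] [NormedSpace ℂ E] in
theorem cauchySeq_of_norm_sub_le {F : Type*} [NormedAddCommGroup F] {a : ℕ → E} {r : ℕ → F} (K : ℝ)
    (h : ∀ k l, ‖a k - a l‖ ≤ K * ‖r k - r l‖) (hr : CauchySeq r) : CauchySeq a := by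
  rw [Metric.cauchySeq_iff] at hr ⊢
  intro ε hε
  obtain ⟨N, hN⟩ := hr (ε / (|K| + 1)) (by positivity)
  refine ⟨N, fun m hm n hn => ?_⟩
  have := hN m hm n hn
  rw [dist_eq_norm] at this ⊢
  rw [lt_div_iff₀ (by positivity)] at this
  have h1 := h m n
  have h2 : K * ‖r m - r n‖ ≤ |K| * ‖r m - r n‖ := by gcongr; exact le_abs_self K
  nlinarith [norm_nonneg (r m - r n)]

variable [CompleteSpace E]

variable (B) in
/-- For closed accretive `A`, the range of `A + t` is closed. -/
theorem accretive_surjective_of_dense {A : Submodule ℂ (E × E)} (hcl : IsClosed (A : Set (E × E)))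
    (hA : ∀ p ∈ A, 0 ≤ rinner B p.1 p.2 + rinner B p.2 p.1) {t : ℝ} (ht : 0 < t)
    (hs : ∀ y, ∀ δ : ℝ, 0 < δ → ∃ p ∈ A, ‖p.2 + (t : ℂ) • p.1 - y‖ < δ) (y : E) :
    ∃ p ∈ A, p.2 + (t : ℂ) • p.1 = y := by
  choose p hp hpy using fun n : ℕ => hs y (1 / ((n : ℝ) + 1)) (by positivity)
  have hr : Tendsto (fun n => (p n).2 + (t : ℂ) • (p n).1) atTop (𝓝 y) := by
    rw [tendsto_iff_norm_sub_tendsto_zero]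
    exact squeeze_zero (fun n => norm_nonneg _) (fun n => (hpy n).le)
      tendsto_one_div_add_atTop_nhds_zero_nat
  have h1 : CauchySeq fun n => (p n).1 := by
    refine cauchySeq_of_norm_sub_le t⁻¹ (fun k l => ?_) hr.cauchySeq
    have := accretive_bound B (hA _ (A.sub_mem (hp k) (hp l))) ht
    rw [inv_mul_eq_div, le_div_iff₀ ht, mul_comm]
    have e : (p k).2 + (t : ℂ) • (p k).1 - ((p l).2 + (t : ℂ) • (p l).1)
        = (p k - p l).2 + (t : ℂ) • (p k - p l).1 := by
      rw [Prod.snd_sub, Prod.fst_sub]; module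
    rw [e]
    exact this
  obtain ⟨x, hx⟩ := cauchySeq_tendsto_of_complete h1
  have h2 : Tendsto (fun n => (p n).2) atTop (𝓝 (y - (t : ℂ) • x)) := by
    have := hr.sub (hx.const_smul (t : ℂ))
    simpa using this
  refine ⟨(x, y - (t : ℂ) • x), hcl.mem_of_tendsto (hx.prodMk_nhds h2)
    (Eventually.of_forall fun n => hp n), ?_⟩
  simp

/-- A closed symmetric densely defined relation `G` is self-adjoint as soon as `G - iκ` has dense
range for one positive and for one negative `κ`. -/
theorem IsSelfAdjointRel.of_dense_range {G : Submodule ℂ (E × E)}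
    (hcl : IsClosed (G : Set (E × E)))
    (symm : ∀ p ∈ G, ∀ q ∈ G, rinner B p.2 q.1 = rinner B p.1 q.2)
    (dense : Dense {x : E | ∃ y, (x, y) ∈ G}) {κ : ℝ} (hκ : 0 < κ)
    (hs : ∀ σ : ℝ, σ = 1 ∨ σ = -1 → ∀ y, ∀ δ : ℝ, 0 < δ →
      ∃ p ∈ G, ‖p.2 - (I * ((σ * κ : ℝ) : ℂ)) • p.1 - y‖ < δ) :
    IsSelfAdjointRel B G := by
  refine ⟨symm, dense, fun μ hμ y => ?_⟩
  obtain ⟨σ, hσ, hσμ⟩ : ∃ σ : ℝ, (σ = 1 ∨ σ = -1) ∧ μ = σ * |μ| := by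
    rcases abs_choice μ with h | h
    · exact ⟨1, Or.inl rfl, by rw [h, one_mul]⟩
    · exact ⟨-1, Or.inr rfl, by rw [h]; ring⟩
  have hσC : (σ : ℂ) * σ = 1 := by rcases hσ with h | h <;> simp [h]
  have hIσ : (I * σ : ℂ) * (I * σ) = -1 := by linear_combination I_sq * σ * σ - hσC
  have hnormI : ‖(I * σ : ℂ)‖ = 1 := by rcases hσ with h | h <;> simp [h]
  let A : Submodule ℂ (E × E) :=
    G.comap (LinearMap.prod (LinearMap.fst ℂ E E) ((-(I * σ) : ℂ) • LinearMap.snd ℂ E E))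
  have hmem : ∀ p : E × E, p ∈ A ↔ (p.1, (-(I * σ) : ℂ) • p.2) ∈ G := fun p => Iff.rfl
  have hGA : ∀ p ∈ G, (p.1, (I * σ : ℂ) • p.2) ∈ A := fun p hp => by
    rw [hmem]
    simp only [smul_smul, neg_mul, hIσ, neg_neg, one_smul]
    exact hp
  -- `A = iσ G` is accretive, even with vanishing real part
  have hA : ∀ p ∈ A, 0 ≤ rinner B p.1 p.2 + rinner B p.2 p.1 := by
    intro p hp
    have h1 := symm _ hp _ hp
    change rinner B ((-(I * σ) : ℂ) • p.2) p.1 = rinner B p.1 ((-(I * σ) : ℂ) • p.2) at h1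
    rw [rinner_csmul_left, rinner_csmul_right] at h1
    have h2 : (starRingEnd ℂ) (-(I * (σ : ℂ))) = I * σ := by simp
    rw [h2] at h1
    have h3 : (I * σ : ℂ) • (rinner B p.1 p.2 + rinner B p.2 p.1) = 0 := by
      rw [smul_add, h1, neg_smul, add_neg_cancel]
    have h4 : (I * σ : ℂ) ≠ 0 := fun h0 => by
      rw [h0, norm_zero] at hnormI
      exact one_ne_zero hnormI.symm
    exact ((smul_eq_zero.mp h3).resolve_left h4).symm.le
  have hAcl : IsClosed (A : Set (E × E)) := by
    refine hcl.preimage (f := fun p : E × E => (p.1, (-(I * σ) : ℂ) • p.2)) ?_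
    fun_prop
  have hAd : ∀ y, ∀ δ : ℝ, 0 < δ → ∃ p ∈ A, ‖p.2 + (κ : ℂ) • p.1 - y‖ < δ := by
    intro y δ hδ
    obtain ⟨p, hp, hpy⟩ := hs σ hσ (-(I * σ : ℂ) • y) δ hδ
    refine ⟨_, hGA p hp, ?_⟩
    have : (I * σ : ℂ) • p.2 + (κ : ℂ) • p.1 - y
        = (I * σ : ℂ) • (p.2 - (I * ((σ * κ : ℝ) : ℂ)) • p.1 - -(I * σ : ℂ) • y) := by
      simp only [smul_sub, smul_smul, mul_neg, hIσ]
      have : (I * σ * (I * ((σ * κ : ℝ) : ℂ)) : ℂ) = -κ := by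
        push_cast
        linear_combination (κ : ℂ) * hIσ
      rw [this]
      module
    rw [this, norm_smul, hnormI, one_mul]
    exact hpy
  obtain ⟨p, hp, hpy⟩ := accretive_surjective B hA hκ
    (accretive_surjective_of_dense B hAcl hA hκ hAd) (abs_pos.mpr hμ) ((I * σ : ℂ) • y)
  refine ⟨_, hp, ?_⟩
  change (-(I * σ) : ℂ) • p.2 - (I * μ : ℂ) • p.1 = y
  have h4 := congrArg (fun z => (-(I * σ) : ℂ) • z) hpy
  simp only [smul_add, smul_smul, neg_mul, hIσ, neg_neg, one_smul] at h4
  have hμC : (μ : ℂ) = σ * ((|μ| : ℝ) : ℂ) := by exact_mod_cast hσμ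
  rw [← h4, sub_eq_add_neg, ← neg_smul, hμC]
  congr 2
  ring

end SelfAdjointRelations

/-! ### Sums of almost anti-commuting operators -/

section Sum

variable {B : Type v} [NonUnitalCStarAlgebra B] [PartialOrder B] [StarOrderedRing B]
  {E : Type w} [NormedAddCommGroup E] [NormedSpace ℂ E] [SMul Bᵐᵒᵖ E] [CStarModule Bᵐᵒᵖ E]

/-- The graph of `a S + b T` on `Dom S ∩ Dom T`. -/
def combRel (a b : ℂ) (S T : Submodule ℂ (E × E)) : Submodule ℂ (E × E) where
  carrier := {p | ∃ s t, (p.1, s) ∈ S ∧ (p.1, t) ∈ T ∧ p.2 = a • s + b • t}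
  zero_mem' := ⟨0, 0, S.zero_mem, T.zero_mem, by simp⟩
  add_mem' := by
    rintro p q ⟨s, t, hs, ht, h⟩ ⟨s', t', hs', ht', h'⟩
    exact ⟨s + s', t + t', S.add_mem hs hs', T.add_mem ht ht', by
      rw [Prod.snd_add, h, h']; module⟩
  smul_mem' := by
    rintro c p ⟨s, t, hs, ht, h⟩
    exact ⟨c • s, c • t, S.smul_mem c hs, T.smul_mem c ht, by rw [Prod.smul_snd, h]; module⟩

theorem mem_combRel {a b : ℂ} {S T : Submodule ℂ (E × E)} {p : E × E} :
    p ∈ combRel a b S T ↔ ∃ s t, (p.1, s) ∈ S ∧ (p.1, t) ∈ T ∧ p.2 = a • s + b • t := Iff.rfl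

namespace IsAlmostCommRel

variable {ε C : ℝ} {S T : Submodule ℂ (E × E)} (h : IsAlmostCommRel ε S T C)
  (hS : IsSelfAdjointRel B S) (hT : IsSelfAdjointRel B T)
include h hS hT

omit hT in
/-- Those `z ∈ Dom S ∩ Dom T` with `S z ∈ Dom T` are dense in `Dom S ∩ Dom T` with respect to the
joint graph norm. -/
theorem exists_core_close {x s t : E} (hs : (x, s) ∈ S) (ht : (x, t) ∈ T) {δ : ℝ} (hδ : 0 < δ) :
    ∃ z s' t' w, (z, s') ∈ S ∧ (z, t') ∈ T ∧ (s', w) ∈ T ∧ ‖z - x‖ < δ ∧ ‖s' - s‖ < δ ∧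
      ‖t' - t‖ < δ := by
  obtain ⟨M₁, hM₁, h₁⟩ := hS.exists_smoothing_close x hδ
  obtain ⟨M₂, hM₂, h₂⟩ := hS.exists_smoothing_close s hδ
  obtain ⟨M₃, hM₃, h₃⟩ := hS.exists_smoothing_close t (half_pos hδ)
  have hC := h.nonneg
  set r := 2 * C * (‖s‖ + ‖x‖) / δ + 1 with hr
  have hr0 : 0 < r := by positivity
  set μ := M₁ + M₂ + M₃ + r with hμ
  have hμ0 : 0 < μ := by positivity
  have hμabs : |μ| = μ := abs_of_pos hμ0
  obtain ⟨t', k, w, ht', hw, heq, hk⟩ := h.exists_smoothing hS hμ0.ne' ht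
  have hzs := hS.smoothing_mem hμ0.ne' x
  have hzs' := hS.smoothing_mem_of_mem hμ0.ne' hs
  have e1 := hS.snd_unique hzs hzs'
  refine ⟨_, _, t', w, hzs, ht', hw, ?_, ?_, ?_⟩
  · rw [norm_sub_rev]
    exact h₁ μ (by rw [hμabs]; linarith)
  · rw [e1, norm_sub_rev]
    exact h₂ μ (by rw [hμabs]; linarith)
  · have hε : |ε| = 1 := by rcases h.sign with h | h <;> simp [h]
    have hεμ : ε * μ ≠ 0 := by
      refine mul_ne_zero ?_ hμ0.ne'
      rintro rfl; simp at hε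
    have h5 := h₃ (ε * μ) (by rw [abs_mul, hε, one_mul, hμabs]; linarith)
    have h6 : ‖smoothing S (ε * μ) ((I * ε / μ : ℂ) • k)‖ < δ / 2 := by
      refine (hS.norm_smoothing_le hεμ _).trans_lt ?_
      rw [norm_smul, norm_div, norm_mul, Complex.norm_I, Complex.norm_real, Complex.norm_real,
        Real.norm_eq_abs, Real.norm_eq_abs, hε, hμabs, mul_one, one_div, inv_mul_eq_div,
        div_lt_iff₀ hμ0]
      have h7 : ‖k‖ ≤ C * (‖s‖ + ‖x‖) := by
        refine hk.trans ?_
        gcongr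
        · rw [e1]; exact hS.norm_smoothing_le hμ0.ne' s
        · exact hS.norm_smoothing_le hμ0.ne' x
      have h8 : C * (‖s‖ + ‖x‖) < δ / 2 * r := by
        rw [hr]
        field_simp
        nlinarith
      have h9 : δ / 2 * r ≤ δ / 2 * μ := by
        gcongr
        linarith
      linarith
    rw [heq, map_add]
    calc _ = ‖-(t - smoothing S (ε * μ) t) + smoothing S (ε * μ) ((I * ε / μ : ℂ) • k)‖ := by
          congr 1; abel
      _ ≤ ‖t - smoothing S (ε * μ) t‖ + ‖smoothing S (ε * μ) ((I * ε / μ : ℂ) • k)‖ := by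
          refine (norm_add_le _ _).trans ?_
          rw [norm_neg]
      _ < δ := by linarith

/-- `Dom S ∩ Dom T` is dense. -/
theorem dense_inter : Dense {x : E | ∃ s t, (x, s) ∈ S ∧ (x, t) ∈ T} := by
  rw [Metric.dense_iff]
  intro x r hr
  obtain ⟨u, hux, s, hus⟩ := Metric.dense_iff.mp hS.dense x (r / 2) (half_pos hr)
  obtain ⟨y, hyu, t, hyt⟩ := Metric.dense_iff.mp hT.dense (u + (I / (1 : ℝ) : ℂ) • s) (r / 2)
    (half_pos hr)
  have hm := hS.smoothing_mem one_ne_zero y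
  obtain ⟨t', ht'⟩ := h.resolvent 1 one_ne_zero _ _ hm
    ⟨t, by rw [add_smul_smul_sub one_ne_zero]; exact hyt⟩
  refine ⟨smoothing S 1 y, ?_, _, t', hm, ht'⟩
  rw [Metric.mem_ball] at hux hyu ⊢
  have h1 := hS.smoothing_eq one_ne_zero hus
  simp only at h1
  calc dist (smoothing S 1 y) x ≤ dist (smoothing S 1 y) u + dist u x := dist_triangle _ _ _
    _ ≤ dist y (u + (I / (1 : ℝ) : ℂ) • s) + dist u x := by
        gcongr
        conv_lhs => rw [← h1]
        rw [dist_eq_norm, dist_eq_norm, ← map_sub]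
        exact hS.norm_smoothing_le one_ne_zero _
    _ < r := by linarith

end IsAlmostCommRel

namespace IsAlmostCommRel

variable {C : ℝ} {S T : Submodule ℂ (E × E)} (h : IsAlmostCommRel (-1) S T C)
  (hS : IsSelfAdjointRel B S) (hT : IsSelfAdjointRel B T)
include h hS hT

variable [CompleteSpace E]

/-- The form `(S x|T x') + (T x|S x')` is represented by a vector `k = {S, T} x`, even where the
anticommutator is only defined in the sense of forms. -/
theorem exists_anticommutator {x s t : E} (hs : (x, s) ∈ S) (ht : (x, t) ∈ T) :
    ∃ k, ‖k‖ ≤ C * (‖s‖ + ‖x‖) ∧ ∀ x' s' t', (x', s') ∈ S → (x', t') ∈ T →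
      rinner B s t' + rinner B t s' = rinner B k x' := by
  -- if `S z ∈ Dom T`, then `k = S T z + T S z`; the general case follows by approximation
  have core : ∀ z s t w, (z, s) ∈ S → (z, t) ∈ T → (s, w) ∈ T →
      ∃ k, ‖k‖ ≤ C * (‖s‖ + ‖z‖) ∧ ∀ x' s' t', (x', s') ∈ S → (x', t') ∈ T →
      rinner B s t' + rinner B t s' = rinner B k x' := by
    intro z s t w hs ht hw
    obtain ⟨v, hv, hvw⟩ := h.comm z s t w hs ht hw
    refine ⟨v + w, by simpa using hvw, fun x' s' t' hs' ht' => ?_⟩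
    rw [rinner_add_left, ← hT.symm _ hw _ ht', ← hS.symm _ hv _ hs', add_comm]
  choose z s' t' w hz hz' hw hδ1 hδ2 hδ3 using fun n : ℕ =>
    h.exists_core_close hS hs ht (δ := 1 / ((n : ℝ) + 1)) (by positivity)
  choose k hk hkr using fun n => core _ _ _ _ (hz n) (hz' n) (hw n)
  have lim : ∀ (a : ℕ → E) (b : E), (∀ n, ‖a n - b‖ < 1 / ((n : ℝ) + 1)) →
      Tendsto a atTop (𝓝 b) := fun a b hab => by
    rw [tendsto_iff_norm_sub_tendsto_zero]
    exact squeeze_zero (fun n => norm_nonneg _) (fun n => (hab n).le)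
      tendsto_one_div_add_atTop_nhds_zero_nat
  have l1 := lim _ _ hδ1
  have l2 := lim _ _ hδ2
  have l3 := lim _ _ hδ3
  have hd := h.dense_inter hS hT
  have hkc : CauchySeq k := by
    refine cauchySeq_of_norm_sub_le (2 * C) (fun m n => ?_) (l2.prodMk_nhds l1).cauchySeq
    obtain ⟨k', hk', hk'r⟩ := core (z m - z n) (s' m - s' n) (t' m - t' n) (w m - w n)
      (S.sub_mem (hz m) (hz n)) (T.sub_mem (hz' m) (hz' n))
      (T.sub_mem (hw m) (hw n))
    have : k m - k n = k' := by
      refine sub_eq_zero.mp (eq_zero_of_dense B hd fun x' ⟨s'', t'', h1, h2⟩ => ?_)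
      rw [← star_rinner]
      have e1 := hk'r x' s'' t'' h1 h2
      have e2 : rinner B (k m - k n - k') x' = 0 := by
        rw [rinner_sub_left, rinner_sub_left, ← hkr m x' s'' t'' h1 h2, ← hkr n x' s'' t'' h1 h2,
          ← e1, rinner_sub_left, rinner_sub_left]
        abel
      rw [e2, star_zero]
    rw [this]
    have h1 := norm_fst_le ((s' m, z m) - (s' n, z n))
    have h2 := norm_snd_le ((s' m, z m) - (s' n, z n))
    have hC := h.nonneg
    calc ‖k'‖ ≤ C * (‖s' m - s' n‖ + ‖z m - z n‖) := hk'
      _ ≤ C * (‖(s' m, z m) - (s' n, z n)‖ + ‖(s' m, z m) - (s' n, z n)‖) := by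
          gcongr <;> assumption
      _ = _ := by ring
  obtain ⟨k₀, hk₀⟩ := cauchySeq_tendsto_of_complete hkc
  refine ⟨k₀, ?_, fun x' s'' t'' h1 h2 => ?_⟩
  · exact le_of_tendsto_of_tendsto' hk₀.norm ((l2.norm.add l1.norm).const_mul C) hk
  · have c1 : ∀ b : E, Continuous fun a : E => rinner B a b := fun b =>
      Continuous.rinner' B continuous_id continuous_const
    refine tendsto_nhds_unique ?_ (((c1 x').tendsto k₀).comp hk₀)
    have := (((c1 t'').tendsto s).comp l2).add (((c1 s'').tendsto t).comp l3)
    refine this.congr fun n => ?_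
    exact hkr n x' s'' t'' h1 h2

/-- The graph norm of `S + T` dominates `S` and `T`. -/
theorem norm_le_sum {x s t : E} (hs : (x, s) ∈ S) (ht : (x, t) ∈ T) :
    ‖s‖ ≤ ‖s + t‖ + (C + 1) * ‖x‖ ∧ ‖t‖ ≤ 2 * ‖s + t‖ + (C + 1) * ‖x‖ := by
  obtain ⟨k, hk, hkr⟩ := h.exists_anticommutator hS hT hs ht
  have h1 := hkr x s t hs ht
  have hC := h.nonneg
  have h2 : rinner B s s + rinner B t t = rinner B (s + t) (s + t) - rinner B k x := by
    rw [← h1]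
    simp only [rinner_add_left, rinner_add_right]
    abel
  have h3 : ‖s‖ ^ 2 ≤ ‖s + t‖ ^ 2 + C * (‖s‖ + ‖x‖) * ‖x‖ := by
    calc ‖s‖ ^ 2 ≤ ‖rinner B s s + rinner B t t‖ := sq_norm_le_of_nonneg B s (rinner_self_nonneg t)
      _ ≤ ‖s + t‖ ^ 2 + ‖k‖ * ‖x‖ := by
          rw [h2, ← norm_rinner_self (B := B) (s + t)]
          exact (norm_sub_le _ _).trans (add_le_add le_rfl (norm_rinner_le _ _))
      _ ≤ _ := by gcongr
  have h4 : ‖s‖ ≤ ‖s + t‖ + (C + 1) * ‖x‖ := by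
    by_contra! hlt
    have a := norm_nonneg s
    have b := norm_nonneg (s + t)
    have c := norm_nonneg x
    have d : 0 ≤ C * ‖x‖ := by positivity
    nlinarith [mul_nonneg d c, mul_nonneg b c, mul_nonneg b d]
  refine ⟨h4, ?_⟩
  have h5 : ‖t‖ ≤ ‖s + t‖ + ‖s‖ := by
    have := norm_sub_le (s + t) s
    rwa [add_sub_cancel_left] at this
  linarith

/-- The sum of an almost anti-commuting pair is self-adjoint and regular on
`Dom S ∩ Dom T`. -/
theorem isSelfAdjointRel_add : IsSelfAdjointRel B (combRel 1 1 S T) := by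
  refine IsSelfAdjointRel.of_dense_range (κ := 8 * C + 1) ?_ ?_ ?_ ?_ ?_
  · refine isClosed_of_closure_subset fun p hp => ?_
    obtain ⟨q, hq, hqp⟩ := mem_closure_iff_seq_limit.mp hp
    choose s t hs ht hst using hq
    simp only [one_smul] at hst
    have hs' : CauchySeq s := by
      refine cauchySeq_of_norm_sub_le (C + 2) (fun m n => ?_) hqp.cauchySeq
      have h1 := (h.norm_le_sum hS hT (x := (q m).1 - (q n).1) (s := s m - s n) (t := t m - t n)
        (S.sub_mem (hs m) (hs n)) (T.sub_mem (ht m) (ht n))).1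
      rw [sub_add_sub_comm, ← hst, ← hst] at h1
      have hC := h.nonneg
      have h2 := norm_fst_le (q m - q n)
      have h3 := norm_snd_le (q m - q n)
      calc _ ≤ _ := h1
        _ ≤ ‖q m - q n‖ + (C + 1) * ‖q m - q n‖ := by gcongr <;> assumption
        _ = _ := by ring
    obtain ⟨s₀, hs₀⟩ := cauchySeq_tendsto_of_complete hs'
    have h1 : Tendsto (fun n => (q n).1) atTop (𝓝 p.1) := (continuous_fst.tendsto p).comp hqp
    have h2 : Tendsto (fun n => (q n).2) atTop (𝓝 p.2) := (continuous_snd.tendsto p).comp hqp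
    have h3 : Tendsto t atTop (𝓝 (p.2 - s₀)) := by
      refine (h2.sub hs₀).congr fun n => ?_
      rw [hst]; abel
    refine ⟨s₀, p.2 - s₀, hS.isClosed.mem_of_tendsto (h1.prodMk_nhds hs₀)
      (Eventually.of_forall hs), hT.isClosed.mem_of_tendsto (h1.prodMk_nhds h3)
      (Eventually.of_forall ht), by simp⟩
  · rintro p ⟨s, t, hs, ht, hst⟩ q ⟨s', t', hs', ht', hst'⟩
    rw [hst, hst']
    simp only [one_smul, rinner_add_left, rinner_add_right]
    rw [hS.symm _ hs _ hs', hT.symm _ ht _ ht']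
  · refine (h.dense_inter hS hT).mono ?_
    rintro x ⟨s, t, hs, ht⟩
    exact ⟨_, s, t, hs, ht, rfl⟩
  · have := h.nonneg; positivity
  · intro σ hσ y δ hδ
    have hC := h.nonneg
    have habs : |σ * (8 * C + 1)| = 8 * C + 1 := by
      have : 0 < 8 * C + 1 := by positivity
      rw [abs_mul, abs_of_pos this]
      rcases hσ with h | h <;> simp [h]
    obtain ⟨z, s, t, w, h1, h2, -, h3⟩ := h.dense_range hS hT (κ := σ * (8 * C + 1))
      (by rw [habs]; linarith) (by rw [habs]; linarith) y hδ
    exact ⟨(z, s + t), ⟨s, t, h1, h2, by simp⟩, h3⟩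

end IsAlmostCommRel

end Sum

/-! ### The weak equation for the joint inner product -/

section FormSolution

variable {B : Type v} [NonUnitalCStarAlgebra B] [PartialOrder B] [StarOrderedRing B]
  {E : Type w} [NormedAddCommGroup E] [NormedSpace ℂ E] [SMul Bᵐᵒᵖ E] [CStarModule Bᵐᵒᵖ E]

/-- `(G - iμ)⁻¹` has norm at most `|μ|⁻¹`, and `G (G - iμ)⁻¹` has norm at most `1`. -/
theorem IsSelfAdjointRel.norm_le_sub {G : Submodule ℂ (E × E)} (hG : IsSelfAdjointRel B G) {μ : ℝ}
    (hμ : μ ≠ 0) {p : E × E} (hp : p ∈ G) :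
    |μ| * ‖p.1‖ ≤ ‖p.2 - (I * μ : ℂ) • p.1‖ ∧ ‖p.2‖ ≤ ‖p.2 - (I * μ : ℂ) • p.1‖ := by
  obtain ⟨h1, h2⟩ := norm_le_of_symm B hG.symm hp μ
  have hI := I_div_mul_neg hμ
  have e : p.2 - (I * μ : ℂ) • p.1 = (-(I * μ) : ℂ) • (p.1 + (I / μ : ℂ) • p.2) := by
    rw [smul_add, smul_smul, mul_comm (-(I * μ : ℂ)), hI]
    module
  have n : ‖(-(I * μ) : ℂ)‖ = |μ| := by
    rw [norm_neg, norm_mul, Complex.norm_I, one_mul, Complex.norm_real, Real.norm_eq_abs]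
  rw [e, norm_smul, n]
  refine ⟨by gcongr, ?_⟩
  rw [norm_smul, norm_div, Complex.norm_I, Complex.norm_real, Real.norm_eq_abs] at h2
  have : 0 < |μ| := abs_pos.mpr hμ
  rwa [one_div, inv_mul_eq_div, div_le_iff₀' this] at h2

variable [CompleteSpace E]

/-- For an almost anti-commuting pair the inclusion of `Dom S ∩ Dom T`, with the inner product
`(x|x') + 2 (S x|S x') + 2 (T x|T x')`, into `E` has an adjoint: every `k ∈ E` is represented by
some `x`. The associated accretive relation is a small perturbation of `2 (S + T)²`. -/
theorem IsAlmostCommRel.exists_form_solution {C : ℝ} {S T : Submodule ℂ (E × E)}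
    (h : IsAlmostCommRel (-1) S T C) (hS : IsSelfAdjointRel B S) (hT : IsSelfAdjointRel B T)
    (k : E) :
    ∃ x s t, (x, s) ∈ S ∧ (x, t) ∈ T ∧ ∀ x' s' t', (x', s') ∈ S → (x', t') ∈ T →
      rinner B x x' + (2 : ℂ) • (rinner B s s' + rinner B t t') = rinner B k x' := by
  have hC := h.nonneg
  -- the operator `2 (S² + T²)` in the sense of forms
  let A : Submodule ℂ (E × E) :=
    { carrier := {p | ∃ s t, (p.1, s) ∈ S ∧ (p.1, t) ∈ T ∧ ∀ x' s' t', (x', s') ∈ S → (x', t') ∈ T →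
        (2 : ℂ) • (rinner B s s' + rinner B t t') = rinner B p.2 x'}
      zero_mem' := ⟨0, 0, S.zero_mem, T.zero_mem, by simp⟩
      add_mem' := by
        rintro p q ⟨s, t, hs, ht, hp⟩ ⟨s₁, t₁, hs₁, ht₁, hq⟩
        refine ⟨s + s₁, t + t₁, S.add_mem hs hs₁, T.add_mem ht ht₁, fun x' s' t' hs' ht' => ?_⟩
        simp only [Prod.snd_add, rinner_add_left]
        rw [← hp x' s' t' hs' ht', ← hq x' s' t' hs' ht']
        module
      smul_mem' := by
        rintro c p ⟨s, t, hs, ht, hp⟩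
        refine ⟨c • s, c • t, S.smul_mem c hs, T.smul_mem c ht, fun x' s' t' hs' ht' => ?_⟩
        simp only [Prod.smul_snd, rinner_csmul_left]
        rw [← hp x' s' t' hs' ht']
        module }
  have hself : ∀ (p : E × E) (s t : E), (p.1, s) ∈ S → (p.1, t) ∈ T →
      (∀ x' s' t', (x', s') ∈ S → (x', t') ∈ T →
        (2 : ℂ) • (rinner B s s' + rinner B t t') = rinner B p.2 x') →
      ‖s‖ ≤ ‖p‖ ∧ ‖t‖ ≤ ‖p‖ := by
    intro p s t hs ht hp
    have h1 := hp _ _ _ hs ht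
    have h2 : ‖rinner B s s + rinner B t t‖ ≤ ‖p‖ ^ 2 := by
      have h3 : 2 * ‖rinner B s s + rinner B t t‖ ≤ ‖p‖ * ‖p‖ := by
        calc 2 * ‖rinner B s s + rinner B t t‖ = ‖(2 : ℂ) • (rinner B s s + rinner B t t)‖ := by
              rw [norm_smul]; norm_num
          _ ≤ ‖p.2‖ * ‖p.1‖ := by rw [h1]; exact norm_rinner_le _ _
          _ ≤ ‖p‖ * ‖p‖ := by
              gcongr
              · exact norm_snd_le p
              · exact norm_fst_le p
      nlinarith [norm_nonneg (rinner B s s + rinner B t t)]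
    constructor
    · refine le_of_sq_le_sq ?_ (norm_nonneg _)
      exact (sq_norm_le_of_nonneg B s (rinner_self_nonneg t)).trans h2
    · refine le_of_sq_le_sq ?_ (norm_nonneg _)
      rw [add_comm] at h2
      exact (sq_norm_le_of_nonneg B t (rinner_self_nonneg s)).trans h2
  have hacc : ∀ p ∈ A, 0 ≤ rinner B p.1 p.2 + rinner B p.2 p.1 := by
    rintro p ⟨s, t, hs, ht, hp⟩
    have h1 := hp _ _ _ hs ht
    have h2 : 0 ≤ rinner B p.2 p.1 := by
      rw [← h1, show (2 : ℂ) = ((2 : ℝ) : ℂ) by norm_num, Complex.coe_smul]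
      exact smul_nonneg (by norm_num) (add_nonneg (rinner_self_nonneg _) (rinner_self_nonneg _))
    have h3 : rinner B p.1 p.2 = rinner B p.2 p.1 := by
      rw [← star_rinner]
      exact (IsSelfAdjoint.of_nonneg h2).star_eq
    rw [h3]
    exact add_nonneg h2 h2
  have hcl : IsClosed (A : Set (E × E)) := by
    refine isClosed_of_closure_subset fun p hp => ?_
    obtain ⟨q, hq, hqp⟩ := mem_closure_iff_seq_limit.mp hp
    choose s t hs ht hst using hq
    have hdiff : ∀ m n, ‖s m - s n‖ ≤ ‖q m - q n‖ ∧ ‖t m - t n‖ ≤ ‖q m - q n‖ := by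
      intro m n
      refine hself (q m - q n) _ _ (S.sub_mem (hs m) (hs n)) (T.sub_mem (ht m) (ht n)) ?_
      intro x' s' t' hs' ht'
      simp only [Prod.snd_sub, rinner_sub_left]
      rw [← hst m x' s' t' hs' ht', ← hst n x' s' t' hs' ht']
      module
    obtain ⟨s₀, hs₀⟩ := cauchySeq_tendsto_of_complete
      (cauchySeq_of_norm_sub_le 1 (fun m n => by simpa using (hdiff m n).1) hqp.cauchySeq)
    obtain ⟨t₀, ht₀⟩ := cauchySeq_tendsto_of_complete
      (cauchySeq_of_norm_sub_le 1 (fun m n => by simpa using (hdiff m n).2) hqp.cauchySeq)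
    have h1 : Tendsto (fun n => (q n).1) atTop (𝓝 p.1) := (continuous_fst.tendsto p).comp hqp
    have h2 : Tendsto (fun n => (q n).2) atTop (𝓝 p.2) := (continuous_snd.tendsto p).comp hqp
    refine ⟨s₀, t₀, hS.isClosed.mem_of_tendsto (h1.prodMk_nhds hs₀) (Eventually.of_forall hs),
      hT.isClosed.mem_of_tendsto (h1.prodMk_nhds ht₀) (Eventually.of_forall ht),
      fun x' s' t' hs' ht' => ?_⟩
    have c1 : ∀ b : E, Continuous fun a : E => rinner B a b := fun b =>
      Continuous.rinner' B continuous_id continuous_const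
    refine tendsto_nhds_unique ?_ (((c1 x').tendsto p.2).comp h2)
    have := ((((c1 s').tendsto s₀).comp hs₀).add (((c1 t').tendsto t₀).comp ht₀)).const_smul (2 : ℂ)
    exact this.congr fun n => hst n x' s' t' hs' ht'
  -- Since `2 ((S + T)² + μ²) r = 2 (S + T - iμ) (S + T + iμ) r = y` is solvable, `A + 2μ²` has
  -- dense range once the anticommutator term `2 a` is at most `‖y‖ / 2`; this fixes `μ`.
  have hD := h.isSelfAdjointRel_add hS hT
  set μ : ℝ := 2 * C * (C + 3) + 1 with hμ
  have hμ1 : 1 ≤ μ := by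
    rw [hμ, le_add_iff_nonneg_left]; positivity
  have hμ0 : 0 < μ := by linarith
  set lam : ℝ := 2 * μ ^ 2 with hlam
  have hlam0 : 0 < lam := by positivity
  let R : Submodule ℂ E := A.map (LinearMap.snd ℂ E E + (lam : ℂ) • LinearMap.fst ℂ E E)
  have hhalf : ∀ y ∈ (Set.univ : Set E), ∃ r ∈ R, ‖r - y‖ ≤ 1 / 2 * ‖y‖ := by
    intro y _
    obtain ⟨p, hp, hpy⟩ := hD.surj μ hμ0.ne' ((1 / 2 : ℂ) • y)
    obtain ⟨r, hr, hrp⟩ := hD.surj (-μ) (neg_ne_zero.mpr hμ0.ne') p.1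
    have n1 := (hD.norm_le_sub hμ0.ne' hp).1
    have n2 := (hD.norm_le_sub (neg_ne_zero.mpr hμ0.ne') hr).1
    have n3 := (hD.norm_le_sub (neg_ne_zero.mpr hμ0.ne') hr).2
    rw [hpy, norm_smul, abs_of_pos hμ0] at n1
    rw [hrp, abs_neg, abs_of_pos hμ0] at n2
    rw [hrp] at n3
    have n0 : ‖(1 / 2 : ℂ)‖ = 1 / 2 := by norm_num
    rw [n0] at n1
    obtain ⟨s, t, hs, ht, hst⟩ := hr
    simp only [one_smul] at hst
    obtain ⟨a, ha, hka⟩ := h.exists_anticommutator hS hT hs ht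
    have n4 := (h.norm_le_sum hS hT hs ht).1
    rw [← hst] at n4
    -- `(S + T)² r.1`
    set d₂ := p.2 + (-(I * μ) : ℂ) • r.2 with hd₂
    have hd : (r.2, d₂) ∈ combRel 1 1 S T := by
      have := (combRel 1 1 S T).add_mem hp
        ((combRel 1 1 S T).smul_mem (-(I * μ) : ℂ) ⟨s, t, hs, ht, by simpa using hst⟩)
      have e : p.1 + (-(I * μ) : ℂ) • r.1 = r.2 := by
        rw [← hrp]
        push_cast
        module
      rw [← e]
      exact this
    have hA : (r.1, (2 : ℂ) • d₂ - (2 : ℂ) • a) ∈ A := by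
      refine ⟨s, t, hs, ht, fun x' s' t' hs' ht' => ?_⟩
      have e1 := hka x' s' t' hs' ht'
      have e2 := hD.symm _ hd (x', s' + t') ⟨s', t', hs', ht', by simp⟩
      simp only [rinner_sub_left, rinner_csmul_left, map_ofNat]
      simp only at e2
      rw [e2, ← e1, hst]
      simp only [rinner_add_left, rinner_add_right]
      module
    refine ⟨_, ⟨_, hA, rfl⟩, ?_⟩
    change ‖((2 : ℂ) • d₂ - (2 : ℂ) • a) + (lam : ℂ) • r.1 - y‖ ≤ _
    have e : ((2 : ℂ) • d₂ - (2 : ℂ) • a) + (lam : ℂ) • r.1 - y = -((2 : ℂ) • a) := by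
      have e1 : p.2 = (1 / 2 : ℂ) • y + (I * μ : ℂ) • p.1 := by rw [← hpy]; abel
      rw [hd₂, e1, ← hrp, hlam]
      push_cast
      match_scalars <;> ring_nf
      simp
    rw [e, norm_neg, norm_smul]
    have n5 : ‖(2 : ℂ)‖ = 2 := by norm_num
    rw [n5]
    have n6 : ‖r.1‖ ≤ ‖p.1‖ := by nlinarith [norm_nonneg r.1]
    have n7 : 2 * C * (C + 3) * ‖p.1‖ ≤ 1 / 2 * ‖y‖ := by nlinarith [norm_nonneg p.1]
    calc 2 * ‖a‖ ≤ 2 * (C * ((‖r.2‖ + (C + 1) * ‖r.1‖) + ‖r.1‖)) := by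
          gcongr
          exact ha.trans (by gcongr)
      _ ≤ 2 * (C * ((‖p.1‖ + (C + 1) * ‖p.1‖) + ‖p.1‖)) := by gcongr
      _ = 2 * C * (C + 3) * ‖p.1‖ := by ring
      _ ≤ _ := n7
  obtain ⟨p, ⟨s, t, hs, ht, hp⟩, hpk⟩ := accretive_surjective B hacc hlam0
    (accretive_surjective_of_dense B hcl hacc hlam0 fun y δ hδ => by
      obtain ⟨_, ⟨p, hp, rfl⟩, hr⟩ := dense_of_half (R := R) dense_univ hhalf y hδ
      exact ⟨p, hp, hr⟩) one_pos k
  refine ⟨p.1, s, t, hs, ht, fun x' s' t' hs' ht' => ?_⟩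
  rw [hp x' s' t' hs' ht', ← hpk]
  simp [add_comm]

end FormSolution

/-! ### Doubling: an operator and its adjoint as one self-adjoint relation -/

section Doubling

variable {B : Type v} [NonUnitalCStarAlgebra B] [PartialOrder B] [StarOrderedRing B]
  {E : Type w} [NormedAddCommGroup E] [NormedSpace ℂ E] [SMul Bᵐᵒᵖ E] [CStarModule Bᵐᵒᵖ E]

variable (B E) in
/-- The right Hilbert module `E ⊕ E`. -/
abbrev Double : Type w := WithCStarModule Bᵐᵒᵖ (E × E)

theorem rinner_double (x y : Double B E) :
    rinner B x y = rinner B x.1 y.1 + rinner B x.2 y.2 := rfl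

variable (B) in
/-- The vector `(a, b)` of `E ⊕ E`. -/
def dpair (a b : E) : Double B E := (WithCStarModule.equiv Bᵐᵒᵖ (E × E)).symm (a, b)

omit [StarOrderedRing B] in
theorem norm_dpair_le (a b : E) : ‖dpair B a b‖ ≤ ‖a‖ + ‖b‖ :=
  WithCStarModule.prod_norm_le_norm_add (dpair B a b)

theorem norm_fst_le_double (x : Double B E) : ‖x.1‖ ≤ ‖x‖ :=
  (le_max_left _ _).trans (WithCStarModule.max_le_prod_norm x)

theorem norm_snd_le_double (x : Double B E) : ‖x.2‖ ≤ ‖x‖ :=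
  (le_max_right _ _).trans (WithCStarModule.max_le_prod_norm x)

theorem continuous_fst_double : Continuous fun x : Double B E => x.1 :=
  continuous_fst.comp WithCStarModule.uniformEquiv.continuous

theorem continuous_snd_double : Continuous fun x : Double B E => x.2 :=
  continuous_snd.comp WithCStarModule.uniformEquiv.continuous

variable (B) in
/-- The matrix `[[0, D'], [D, 0]]` on `E ⊕ E`. -/
def offDiagRel (D D' : Submodule ℂ (E × E)) : Submodule ℂ (Double B E × Double B E) where
  carrier := {p | (p.1.1, p.2.2) ∈ D ∧ (p.1.2, p.2.1) ∈ D'}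
  zero_mem' := ⟨D.zero_mem, D'.zero_mem⟩
  add_mem' := fun hp hq => ⟨D.add_mem hp.1 hq.1, D'.add_mem hp.2 hq.2⟩
  smul_mem' := fun c _ hp => ⟨D.smul_mem c hp.1, D'.smul_mem c hp.2⟩

variable (B) in
/-- The matrix `[[S, 0], [0, -S]]` on `E ⊕ E`. -/
def diagRel (S : Submodule ℂ (E × E)) : Submodule ℂ (Double B E × Double B E) where
  carrier := {p | (p.1.1, p.2.1) ∈ S ∧ (p.1.2, -p.2.2) ∈ S}
  zero_mem' := ⟨S.zero_mem, by
    change ((0 : E), -(0 : E)) ∈ S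
    rw [neg_zero]
    exact S.zero_mem⟩
  add_mem' := fun {p q} hp hq => ⟨S.add_mem hp.1 hq.1, by
    change (p.1.2 + q.1.2, -(p.2.2 + q.2.2)) ∈ S
    rw [neg_add]
    exact S.add_mem hp.2 hq.2⟩
  smul_mem' := fun c p hp => ⟨S.smul_mem c hp.1, by
    change (c • p.1.2, -(c • p.2.2)) ∈ S
    rw [← smul_neg]
    exact S.smul_mem c hp.2⟩

theorem dense_double {s t : Set E} (hs : Dense s) (ht : Dense t) :
    Dense {x : Double B E | x.1 ∈ s ∧ x.2 ∈ t} := by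
  rw [Metric.dense_iff]
  intro x r hr
  obtain ⟨a, ha, has⟩ := Metric.dense_iff.mp hs x.1 (r / 2) (half_pos hr)
  obtain ⟨b, hb, hbt⟩ := Metric.dense_iff.mp ht x.2 (r / 2) (half_pos hr)
  rw [Metric.mem_ball, dist_eq_norm] at ha hb
  refine ⟨dpair B a b, ?_, has, hbt⟩
  rw [Metric.mem_ball, dist_eq_norm]
  have : dpair B a b - x = dpair B (a - x.1) (b - x.2) := rfl
  rw [this]
  linarith [norm_dpair_le (B := B) (a - x.1) (b - x.2)]

theorem offDiagRel_symm {D D' : Submodule ℂ (E × E)}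
    (h : ∀ p ∈ D, ∀ q ∈ D', rinner B p.2 q.1 = rinner B p.1 q.2) :
    ∀ p ∈ offDiagRel B D D', ∀ q ∈ offDiagRel B D D', rinner B p.2 q.1 = rinner B p.1 q.2 := by
  intro p hp q hq
  rw [rinner_double, rinner_double]
  have h1 := h _ hp.1 _ hq.2
  have h2 := congrArg star (h _ hq.1 _ hp.2)
  simp only [star_rinner] at h1 h2
  rw [h1, ← h2, add_comm]

theorem isClosed_offDiagRel {D D' : Submodule ℂ (E × E)} (hD : IsClosed (D : Set (E × E)))
    (hD' : IsClosed (D' : Set (E × E))) :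
    IsClosed (offDiagRel B D D' : Set (Double B E × Double B E)) := by
  have f1 : Continuous fun p : Double B E × Double B E => (p.1.1, p.2.2) :=
    (continuous_fst_double.comp continuous_fst).prodMk (continuous_snd_double.comp continuous_snd)
  have f2 : Continuous fun p : Double B E × Double B E => (p.1.2, p.2.1) :=
    (continuous_snd_double.comp continuous_fst).prodMk (continuous_fst_double.comp continuous_snd)
  exact (hD.preimage f1).inter (hD'.preimage f2)

/-- Consequences of the self-adjointness of `[[0, D'], [D, 0]]`: `D* ⊆ D'`. -/
theorem IsSelfAdjointRel.mem_snd_of_adjoint {D D' : Submodule ℂ (E × E)}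
    (h : IsSelfAdjointRel B (offDiagRel B D D')) {p : E × E}
    (hp : ∀ q ∈ D, rinner B q.2 p.1 = rinner B q.1 p.2) : p ∈ D' := by
  have := h.mem_of_adjoint (p := (dpair B 0 p.1, dpair B p.2 0)) fun q hq => by
    rw [rinner_double, rinner_double]
    change rinner B q.2.1 0 + rinner B q.2.2 p.1 = rinner B q.1.1 p.2 + rinner B q.1.2 0
    rw [rinner_zero_right, rinner_zero_right, zero_add, add_zero]
    exact hp _ hq.1
  exact this.2

/-- Consequences of the self-adjointness of `[[0, D'], [D, 0]]`: `D'* ⊆ D`. -/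
theorem IsSelfAdjointRel.mem_fst_of_adjoint {D D' : Submodule ℂ (E × E)}
    (h : IsSelfAdjointRel B (offDiagRel B D D')) {p : E × E}
    (hp : ∀ q ∈ D', rinner B q.2 p.1 = rinner B q.1 p.2) : p ∈ D := by
  have := h.mem_of_adjoint (p := (dpair B p.1 0, dpair B 0 p.2)) fun q hq => by
    rw [rinner_double, rinner_double]
    change rinner B q.2.1 p.1 + rinner B q.2.2 0 = rinner B q.1.1 0 + rinner B q.1.2 p.2
    rw [rinner_zero_right, rinner_zero_right, zero_add, add_zero]
    exact hp _ hq.2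
  exact this.1

/-- Consequences of the self-adjointness of `[[0, D'], [D, 0]]`: `1 + D' D` is surjective. -/
theorem IsSelfAdjointRel.exists_one_add {D D' : Submodule ℂ (E × E)}
    (h : IsSelfAdjointRel B (offDiagRel B D D')) (e : E) :
    ∃ x y z, (x, y) ∈ D ∧ (y, z) ∈ D' ∧ e = x + z := by
  obtain ⟨p, ⟨hp1, hp2⟩, hpy⟩ := h.surj 1 one_ne_zero (dpair B (-I • e) 0)
  have h1 : p.2.1 - (I * ((1 : ℝ) : ℂ)) • p.1.1 = -I • e :=
    congrArg (fun x : Double B E => x.1) hpy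
  have h2 : p.2.2 - (I * ((1 : ℝ) : ℂ)) • p.1.2 = 0 := congrArg (fun x : Double B E => x.2) hpy
  simp only [Complex.ofReal_one, mul_one] at h1 h2
  refine ⟨p.1.1, p.2.2, I • p.2.1, hp1, ?_, ?_⟩
  · rw [sub_eq_zero.mp h2]
    exact D'.smul_mem I hp2
  · have := congrArg (fun x => I • x) h1
    simp only [smul_sub, smul_neg, smul_smul, I_mul_I, neg_neg, one_smul, neg_smul,
      sub_neg_eq_add] at this
    rw [← this]
    abel

/-- For a regular operator `D` with adjoint `D'`, `[[0, D'], [D, 0]]` is self-adjoint. -/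
theorem isSelfAdjointRel_offDiagRel [CompleteSpace E] {D D' : Submodule ℂ (E × E)}
    (hD : IsClosed (D : Set (E × E))) (hd : Dense {x : E | ∃ y, (x, y) ∈ D})
    (hadj : ∀ p, p ∈ D' ↔ ∀ q ∈ D, rinner B q.2 p.1 = rinner B q.1 p.2)
    (hd' : Dense {x : E | ∃ y, (x, y) ∈ D'})
    (hr : Dense {e : E | ∃ x y z, (x, y) ∈ D ∧ (y, z) ∈ D' ∧ e = x + z}) :
    IsSelfAdjointRel B (offDiagRel B D D') := by
  have hD' : IsClosed (D' : Set (E × E)) := by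
    have : (D' : Set (E × E)) = ⋂ q ∈ D, {p : E × E | rinner B q.2 p.1 = rinner B q.1 p.2} := by
      ext p
      simp only [SetLike.mem_coe, Set.mem_iInter, Set.mem_ofPred_eq]
      exact hadj p
    rw [this]
    refine isClosed_biInter fun q _ => isClosed_eq ?_ ?_
    · exact Continuous.rinner' B continuous_const continuous_fst
    · exact Continuous.rinner' B continuous_const continuous_snd
  refine IsSelfAdjointRel.of_dense_range (κ := 1) (isClosed_offDiagRel hD hD')
    (offDiagRel_symm fun p hp q hq => (hadj q).mp hq p hp) ?_ one_pos ?_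
  · refine (dense_double hd hd').mono ?_
    rintro x ⟨⟨y, hy⟩, ⟨z, hz⟩⟩
    exact ⟨dpair B z y, hy, hz⟩
  · intro σ hσ y δ hδ
    have hσ2 : (σ : ℂ) * σ = 1 := by rcases hσ with h | h <;> simp [h]
    have hσn : ‖(I * σ : ℂ)‖ = 1 := by rcases hσ with h | h <;> simp [h]
    have hIσ : (I * σ : ℂ) * (I * σ) = -1 := by linear_combination I_sq * σ * σ - hσ2
    -- Replace `y.2` by `z ∈ Dom D'`. Then `(u, iσ (z - D u))` solves the system up to a small error
    -- if `u + D' D u` is close to `D' z + iσ y.1`.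
    obtain ⟨z, hz, z', hzz'⟩ := Metric.dense_iff.mp hd' y.2 (δ / 2) (half_pos hδ)
    obtain ⟨e, he, u, w, q, huw, hwq, heq⟩ := Metric.dense_iff.mp hr (z' + (I * σ : ℂ) • y.1)
      (δ / 2) (half_pos hδ)
    rw [Metric.mem_ball, dist_eq_norm] at hz he
    refine ⟨(dpair B u ((I * σ : ℂ) • (z - w)), dpair B ((I * σ : ℂ) • (z' - q)) w),
      ⟨huw, D'.smul_mem _ (D'.sub_mem hzz' hwq)⟩, ?_⟩
    have : dpair B ((I * σ : ℂ) • (z' - q)) w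
        - (I * ((σ * 1 : ℝ) : ℂ)) • dpair B u ((I * σ : ℂ) • (z - w)) - y
        = dpair B (-((I * σ : ℂ) • (e - (z' + (I * σ : ℂ) • y.1)))) (z - y.2) := by
      refine Prod.ext ?_ ?_
      · change (I * σ : ℂ) • (z' - q) - (I * ((σ * 1 : ℝ) : ℂ)) • u - y.1
          = -((I * σ : ℂ) • (e - (z' + (I * σ : ℂ) • y.1)))
        rw [heq, mul_one, smul_sub (I * σ : ℂ) (u + q), smul_add (I * σ : ℂ) z', smul_smul, hIσ]
        module
      · change w - (I * ((σ * 1 : ℝ) : ℂ)) • ((I * σ : ℂ) • (z - w)) - y.2 = z - y.2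
        rw [mul_one, smul_smul, hIσ]
        module
    rw [this]
    refine (norm_dpair_le _ _).trans_lt ?_
    rw [norm_neg, norm_smul, hσn, one_mul]
    linarith

end Doubling

/-! ### The closure of `S + iT` -/

section DoublingSum

variable {B : Type v} [NonUnitalCStarAlgebra B] [PartialOrder B] [StarOrderedRing B]
  {E : Type w} [NormedAddCommGroup E] [NormedSpace ℂ E] [SMul Bᵐᵒᵖ E] [CStarModule Bᵐᵒᵖ E]

theorem IsSelfAdjointRel.diagRel {S : Submodule ℂ (E × E)} (hS : IsSelfAdjointRel B S) :
    IsSelfAdjointRel B (diagRel B S) := by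
  refine ⟨fun p hp q hq => ?_, ?_, fun μ hμ y => ?_⟩
  · rw [rinner_double, rinner_double]
    have h1 := hS.symm _ hp.1 _ hq.1
    have h2 := hS.symm _ hp.2 _ hq.2
    simp only [rinner_neg_left, rinner_neg_right, neg_inj] at h1 h2
    rw [h1, h2]
  · refine (dense_double hS.dense hS.dense).mono ?_
    rintro x ⟨⟨y, hy⟩, ⟨z, hz⟩⟩
    refine ⟨dpair B y (-z), hy, ?_⟩
    change (x.2, - -z) ∈ S
    rw [neg_neg]
    exact hz
  · obtain ⟨p, hp, hpy⟩ := hS.surj μ hμ y.1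
    obtain ⟨q, hq, hqy⟩ := hS.surj (-μ) (neg_ne_zero.mpr hμ) (-y.2)
    refine ⟨(dpair B p.1 q.1, dpair B p.2 (-q.2)), ⟨hp, ?_⟩, Prod.ext hpy ?_⟩
    · change (q.1, - -q.2) ∈ S
      rw [neg_neg]
      exact hq
    · change -q.2 - (I * μ : ℂ) • q.1 = y.2
      rw [← neg_neg y.2, ← hqy]
      push_cast
      module

theorem IsSelfAdjointRel.offDiagRel_self {T : Submodule ℂ (E × E)} (hT : IsSelfAdjointRel B T) :
    IsSelfAdjointRel B (offDiagRel B T T) := by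
  refine ⟨offDiagRel_symm hT.symm, ?_, fun μ hμ y => ?_⟩
  · refine (dense_double hT.dense hT.dense).mono ?_
    rintro x ⟨⟨y, hy⟩, ⟨z, hz⟩⟩
    exact ⟨dpair B z y, hy, hz⟩
  · -- diagonalize: the eigenvectors are `x.1 + x.2` and `x.1 - x.2`
    obtain ⟨p, hp, hpy⟩ := hT.surj μ hμ (y.1 + y.2)
    obtain ⟨q, hq, hqy⟩ := hT.surj (-μ) (neg_ne_zero.mpr hμ) (y.2 - y.1)
    refine ⟨(dpair B ((1 / 2 : ℂ) • (p.1 + q.1)) ((1 / 2 : ℂ) • (p.1 - q.1)),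
      dpair B ((1 / 2 : ℂ) • (p.2 - q.2)) ((1 / 2 : ℂ) • (p.2 + q.2))),
      ⟨T.smul_mem _ (T.add_mem hp hq), T.smul_mem _ (T.sub_mem hp hq)⟩, Prod.ext ?_ ?_⟩
    · change (1 / 2 : ℂ) • (p.2 - q.2) - (I * μ : ℂ) • ((1 / 2 : ℂ) • (p.1 + q.1)) = y.1
      have : y.1 = (1 / 2 : ℂ) • ((y.1 + y.2) - (y.2 - y.1)) := by module
      rw [this, ← hpy, ← hqy]
      push_cast
      module
    · change (1 / 2 : ℂ) • (p.2 + q.2) - (I * μ : ℂ) • ((1 / 2 : ℂ) • (p.1 - q.1)) = y.2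
      have : y.2 = (1 / 2 : ℂ) • ((y.1 + y.2) + (y.2 - y.1)) := by module
      rw [this, ← hpy, ← hqy]
      push_cast
      module

/-- If `S` and `T` almost anti-commute, then `diag(S, -S)` and `offdiag(T, T)` almost commute. -/
theorem IsAlmostCommRel.double {C : ℝ} {S T : Submodule ℂ (E × E)}
    (h : IsAlmostCommRel (-1) S T C) :
    IsAlmostCommRel 1 (diagRel B S) (offDiagRel B T T) (2 * C) := by
  have hC := h.nonneg
  refine ⟨Or.inl rfl, by positivity, fun μ hμ u s hus ⟨y, hy⟩ => ?_, fun z s t w hs ht hw => ?_⟩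
  · obtain ⟨t₁, h₁⟩ := h.resolvent μ hμ _ _ hus.1 ⟨_, hy.1⟩
    obtain ⟨t₂, h₂⟩ := h.resolvent (-μ) (neg_ne_zero.mpr hμ) _ _ hus.2 ⟨y.1, by
      have e : u.2 + (I / ((-μ : ℝ) : ℂ)) • (-s.2) = u.2 + (I / μ : ℂ) • s.2 := by
        push_cast
        rw [div_neg, neg_smul, smul_neg, neg_neg]
      rw [e]
      exact hy.2⟩
    exact ⟨dpair B t₂ t₁, h₁, h₂⟩
  · obtain ⟨v, hv, hvw⟩ := h.comm _ _ _ _ hs.1 ht.1 hw.1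
    obtain ⟨v', hv', hvw'⟩ := h.comm _ _ _ (-w.1) hs.2 ht.2 (by
      have := T.smul_mem (-1 : ℂ) hw.2
      simp only [neg_smul, one_smul] at this
      exact this)
    refine ⟨dpair B v' (-v), ⟨hv', ?_⟩, ?_⟩
    · change (t.2, - -v) ∈ S
      rw [neg_neg]
      exact hv
    · have e : dpair B v' (-v) - ((1 : ℝ) : ℂ) • w
          = dpair B (v' - ((-1 : ℝ) : ℂ) • (-w.1)) (-(v - ((-1 : ℝ) : ℂ) • w.2)) := by
        refine Prod.ext ?_ ?_
        · change v' - ((1 : ℝ) : ℂ) • w.1 = v' - ((-1 : ℝ) : ℂ) • (-w.1)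
          push_cast
          module
        · change -v - ((1 : ℝ) : ℂ) • w.2 = -(v - ((-1 : ℝ) : ℂ) • w.2)
          push_cast
          module
      rw [e]
      refine (norm_dpair_le _ _).trans ?_
      rw [norm_neg]
      rw [norm_neg] at hvw'
      have n1 := norm_fst_le_double s
      have n2 := norm_snd_le_double s
      have n3 := norm_fst_le_double z
      have n4 := norm_snd_le_double z
      calc _ ≤ C * (‖s.2‖ + ‖z.2‖) + C * (‖s.1‖ + ‖z.1‖) := add_le_add hvw' hvw
        _ ≤ C * (‖s‖ + ‖z‖) + C * (‖s‖ + ‖z‖) := by gcongr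
        _ = _ := by ring

variable [CompleteSpace E]

/-- The closure of `S + iT` is a regular operator with adjoint the closure of `S - iT`, expressed as
the self-adjointness of a matrix. That matrix is unitarily equivalent to the closure of
`[[S, T], [T, -S]]`, the sum of an almost commuting pair. -/
theorem IsAlmostCommRel.isSelfAdjointRel_add_I {C : ℝ} {S T : Submodule ℂ (E × E)}
    (h : IsAlmostCommRel (-1) S T C) (hS : IsSelfAdjointRel B S) (hT : IsSelfAdjointRel B T) :
    IsSelfAdjointRel B (offDiagRel B (combRel 1 I S T).topologicalClosure
      (combRel 1 (-I) S T).topologicalClosure) := by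
  have hC := h.nonneg
  have hd := h.dense_inter hS hT
  have hsymm : ∀ p ∈ (combRel 1 I S T).topologicalClosure,
      ∀ q ∈ (combRel 1 (-I) S T).topologicalClosure, rinner B p.2 q.1 = rinner B p.1 q.2 := by
    intro p hp q hq
    have h0 : ∀ p ∈ combRel 1 I S T, ∀ q ∈ combRel 1 (-I) S T,
        rinner B p.2 q.1 = rinner B p.1 q.2 := by
      rintro p ⟨s, t, hs, ht, hp⟩ q ⟨s', t', hs', ht', hq⟩
      rw [hp, hq]
      have h1 := hS.symm _ hs _ hs'
      have h2 := hT.symm _ ht _ ht'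
      simp only at h1 h2
      simp only [one_smul, rinner_add_left, rinner_add_right, rinner_csmul_left,
        rinner_csmul_right, conj_I, h1, h2]
    have hcl : IsClosed {r : (E × E) × (E × E) | rinner B r.1.2 r.2.1 = rinner B r.1.1 r.2.2} :=
      isClosed_eq (Continuous.rinner' B (by fun_prop) (by fun_prop))
        (Continuous.rinner' B (by fun_prop) (by fun_prop))
    have hsub : closure ((combRel 1 I S T : Set (E × E)) ×ˢ (combRel 1 (-I) S T : Set (E × E)))
        ⊆ {r : (E × E) × (E × E) | rinner B r.1.2 r.2.1 = rinner B r.1.1 r.2.2} :=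
      closure_minimal (fun r hr => h0 _ hr.1 _ hr.2) hcl
    rw [closure_prod_eq] at hsub
    exact hsub (Set.mk_mem_prod hp hq)
  refine IsSelfAdjointRel.of_dense_range (κ := 16 * C + 1)
    (isClosed_offDiagRel (Submodule.isClosed_topologicalClosure _)
      (Submodule.isClosed_topologicalClosure _)) (offDiagRel_symm hsymm) ?_ (by positivity) ?_
  · refine (dense_double hd hd).mono ?_
    rintro x ⟨⟨s, t, hs, ht⟩, ⟨s', t', hs', ht'⟩⟩
    exact ⟨dpair B ((1 : ℂ) • s' + (-I) • t') ((1 : ℂ) • s + I • t),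
      Submodule.le_topologicalClosure _ ⟨s, t, hs, ht, rfl⟩,
      Submodule.le_topologicalClosure _ ⟨s', t', hs', ht', rfl⟩⟩
  · intro σ hσ y δ hδ
    set κ := σ * (16 * C + 1) with hκ
    have habs : |κ| = 16 * C + 1 := by
      have : 0 < 16 * C + 1 := by positivity
      rw [hκ, abs_mul, abs_of_pos this]
      rcases hσ with h | h <;> simp [h]
    -- the intertwiner takes `(z₁, z₂)` to `(z₁ - i z₂, z₁ + i z₂) / 2`; the preimage of `y`
    -- under it is `(y₁ + y₂, -i (y₂ - y₁))`
    obtain ⟨z, s, t, w, hs, ht, -, hy⟩ := (h.double (B := B)).dense_range hS.diagRel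
      hT.offDiagRel_self (κ := κ) (by rw [habs]; linarith) (by rw [habs]; linarith)
      (dpair B (y.1 + y.2) (-I • (y.2 - y.1))) (half_pos hδ)
    set r := s + t - (I * κ : ℂ) • z - dpair B (y.1 + y.2) (-I • (y.2 - y.1)) with hr
    have r1 : r.1 = s.1 + t.1 - (I * κ : ℂ) • z.1 - (y.1 + y.2) := rfl
    have r2 : r.2 = s.2 + t.2 - (I * κ : ℂ) • z.2 - (-I • (y.2 - y.1)) := rfl
    have hs2 : (z.2, (-1 : ℂ) • s.2) ∈ S := by
      rw [neg_one_smul]; exact hs.2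
    refine ⟨(dpair B ((1 / 2 : ℂ) • z.1 + (-I / 2) • z.2) ((1 / 2 : ℂ) • z.1 + (I / 2) • z.2),
      dpair B
      ((1 : ℂ) • ((1 / 2 : ℂ) • s.1 + (I / 2) • ((-1 : ℂ) • s.2))
        + (-I) • ((1 / 2 : ℂ) • t.2 + (I / 2) • t.1))
      ((1 : ℂ) • ((1 / 2 : ℂ) • s.1 + (-I / 2) • ((-1 : ℂ) • s.2))
        + I • ((1 / 2 : ℂ) • t.2 + (-I / 2) • t.1))), ⟨?_, ?_⟩, ?_⟩
    · refine Submodule.le_topologicalClosure _ ⟨_, _, ?_, ?_, rfl⟩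
      · exact S.add_mem (S.smul_mem _ hs.1) (S.smul_mem _ hs2)
      · exact T.add_mem (T.smul_mem _ ht.1) (T.smul_mem _ ht.2)
    · refine Submodule.le_topologicalClosure _ ⟨_, _, ?_, ?_, rfl⟩
      · exact S.add_mem (S.smul_mem _ hs.1) (S.smul_mem _ hs2)
      · exact T.add_mem (T.smul_mem _ ht.1) (T.smul_mem _ ht.2)
    · have e : dpair B
          ((1 : ℂ) • ((1 / 2 : ℂ) • s.1 + (I / 2) • ((-1 : ℂ) • s.2))
            + (-I) • ((1 / 2 : ℂ) • t.2 + (I / 2) • t.1))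
          ((1 : ℂ) • ((1 / 2 : ℂ) • s.1 + (-I / 2) • ((-1 : ℂ) • s.2))
            + I • ((1 / 2 : ℂ) • t.2 + (-I / 2) • t.1))
          - (I * κ : ℂ) • dpair B ((1 / 2 : ℂ) • z.1 + (-I / 2) • z.2)
            ((1 / 2 : ℂ) • z.1 + (I / 2) • z.2) - y
          = dpair B ((1 / 2 : ℂ) • r.1 + (-I / 2) • r.2) ((1 / 2 : ℂ) • r.1 + (I / 2) • r.2) := by
        refine Prod.ext ?_ ?_
        · change (1 : ℂ) • ((1 / 2 : ℂ) • s.1 + (I / 2) • ((-1 : ℂ) • s.2))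
            + (-I) • ((1 / 2 : ℂ) • t.2 + (I / 2) • t.1)
            - (I * κ : ℂ) • ((1 / 2 : ℂ) • z.1 + (-I / 2) • z.2) - y.1
            = (1 / 2 : ℂ) • r.1 + (-I / 2) • r.2
          rw [r1, r2]
          match_scalars <;> (ring_nf; try simp; try ring_nf)
        · change (1 : ℂ) • ((1 / 2 : ℂ) • s.1 + (-I / 2) • ((-1 : ℂ) • s.2))
            + I • ((1 / 2 : ℂ) • t.2 + (-I / 2) • t.1)
            - (I * κ : ℂ) • ((1 / 2 : ℂ) • z.1 + (I / 2) • z.2) - y.2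
            = (1 / 2 : ℂ) • r.1 + (I / 2) • r.2
          rw [r1, r2]
          match_scalars <;> (ring_nf; try simp; try ring_nf)
      rw [e]
      have n1 : ‖(1 / 2 : ℂ)‖ = 1 / 2 := by norm_num
      have n2 : ‖(I / 2 : ℂ)‖ = 1 / 2 := by norm_num
      have n3 : ‖(-I / 2 : ℂ)‖ = 1 / 2 := by norm_num
      have m1 := norm_fst_le_double r
      have m2 := norm_snd_le_double r
      have m3 : ‖(1 / 2 : ℂ) • r.1 + (-I / 2) • r.2‖ ≤ ‖r‖ := by
        refine (norm_add_le _ _).trans ?_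
        rw [norm_smul, norm_smul, n1, n3]
        linarith
      have m4 : ‖(1 / 2 : ℂ) • r.1 + (I / 2) • r.2‖ ≤ ‖r‖ := by
        refine (norm_add_le _ _).trans ?_
        rw [norm_smul, norm_smul, n1, n2]
        linarith
      refine (norm_dpair_le _ _).trans_lt ?_
      linarith

end DoublingSum

/-! ### Graphs of partially defined operators -/

section LinearPMapGraph

variable {E : Type w} [NormedAddCommGroup E] [NormedSpace ℂ E]

theorem mem_graph_add {f g : E →ₗ.[ℂ] E} {x z : E} :
    (x, z) ∈ (f + g).graph ↔ ∃ y y', (x, y) ∈ f.graph ∧ (x, y') ∈ g.graph ∧ z = y + y' := by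
  constructor
  · intro h
    obtain ⟨⟨a, ha⟩, rfl, rfl⟩ := (LinearPMap.mem_graph_iff _).mp h
    exact ⟨f ⟨a, ha.1⟩, g ⟨a, ha.2⟩, f.mem_graph ⟨a, ha.1⟩, g.mem_graph ⟨a, ha.2⟩, rfl⟩
  · rintro ⟨y, y', hf, hg, rfl⟩
    obtain ⟨⟨a, ha⟩, rfl, rfl⟩ := (LinearPMap.mem_graph_iff _).mp hf
    obtain ⟨⟨b, hb⟩, hab, rfl⟩ := (LinearPMap.mem_graph_iff _).mp hg
    obtain rfl : b = a := hab
    exact (f + g).mem_graph ⟨b, ha, hb⟩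

theorem mem_graph_sub {f g : E →ₗ.[ℂ] E} {x z : E} :
    (x, z) ∈ (f - g).graph ↔ ∃ y y', (x, y) ∈ f.graph ∧ (x, y') ∈ g.graph ∧ z = y - y' := by
  constructor
  · intro h
    obtain ⟨⟨a, ha⟩, rfl, rfl⟩ := (LinearPMap.mem_graph_iff _).mp h
    exact ⟨f ⟨a, ha.1⟩, g ⟨a, ha.2⟩, f.mem_graph ⟨a, ha.1⟩, g.mem_graph ⟨a, ha.2⟩, rfl⟩
  · rintro ⟨y, y', hf, hg, rfl⟩
    obtain ⟨⟨a, ha⟩, rfl, rfl⟩ := (LinearPMap.mem_graph_iff _).mp hf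
    obtain ⟨⟨b, hb⟩, hab, rfl⟩ := (LinearPMap.mem_graph_iff _).mp hg
    obtain rfl : b = a := hab
    exact (f - g).mem_graph ⟨b, ha, hb⟩

theorem mem_graph_smul {c : ℂ} {f : E →ₗ.[ℂ] E} {x z : E} :
    (x, z) ∈ (c • f).graph ↔ ∃ y, (x, y) ∈ f.graph ∧ z = c • y := by
  constructor
  · intro h
    obtain ⟨⟨a, ha⟩, rfl, rfl⟩ := (LinearPMap.mem_graph_iff _).mp h
    exact ⟨f ⟨a, ha⟩, f.mem_graph _, rfl⟩
  · rintro ⟨y, hf, rfl⟩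
    obtain ⟨⟨a, ha⟩, rfl, rfl⟩ := (LinearPMap.mem_graph_iff _).mp hf
    exact (c • f).mem_graph ⟨a, ha⟩

theorem mem_graph_domRestrict {f : E →ₗ.[ℂ] E} {𝓔 : Submodule ℂ E} {x y : E} :
    (x, y) ∈ (f.domRestrict 𝓔).graph ↔ x ∈ 𝓔 ∧ (x, y) ∈ f.graph := by
  constructor
  · intro h
    obtain ⟨⟨a, ha⟩, rfl, rfl⟩ := (LinearPMap.mem_graph_iff _).mp h
    refine ⟨ha.1, ?_⟩
    exact f.mem_graph ⟨a, ha.2⟩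
  · rintro ⟨hx, hf⟩
    obtain ⟨⟨a, ha⟩, rfl, rfl⟩ := (LinearPMap.mem_graph_iff _).mp hf
    exact (f.domRestrict 𝓔).mem_graph ⟨a, hx, ha⟩

theorem graph_add_eq_combRel (f g : E →ₗ.[ℂ] E) : (f + g).graph = combRel 1 1 f.graph g.graph := by
  ext ⟨x, z⟩
  simp only [mem_graph_add, mem_combRel, one_smul]

theorem graph_sub_eq_combRel (f g : E →ₗ.[ℂ] E) :
    (f - g).graph = combRel 1 (-1) f.graph g.graph := by
  ext ⟨x, z⟩
  rw [mem_graph_sub, mem_combRel]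
  simp only [one_smul, neg_smul, sub_eq_add_neg]

theorem exists_mem_graph {f : E →ₗ.[ℂ] E} {x : E} (hx : x ∈ f.domain) : ∃ y, (x, y) ∈ f.graph :=
  LinearPMap.mem_domain_iff.mp hx

theorem setOf_exists_mem_graph (f : E →ₗ.[ℂ] E) :
    {x | ∃ y, (x, y) ∈ f.graph} = (f.domain : Set E) := by
  ext x
  exact LinearPMap.mem_domain_iff.symm

theorem graph_closure_of_le {f g : E →ₗ.[ℂ] E} (hg : g.IsClosed) (h : f ≤ g) :
    f.closure.graph = f.graph.topologicalClosure :=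
  (hg.isClosable.leIsClosable h).graph_closure_eq_closure_graph.symm

theorem closure_le_of_le {f g : E →ₗ.[ℂ] E} (hg : g.IsClosed) (h : f ≤ g) : f.closure ≤ g := by
  refine LinearPMap.le_of_le_graph ?_
  rw [graph_closure_of_le hg h]
  exact Submodule.topologicalClosure_minimal _ (LinearPMap.le_graph_of_le h) hg

/-- If the closure is closed, then its graph is the closure of the graph, also when closability is
not known beforehand. -/
theorem graph_closure_of_isClosed {f : E →ₗ.[ℂ] E} (h : f.closure.IsClosed) :
    f.closure.graph = f.graph.topologicalClosure :=
  graph_closure_of_le h f.le_closure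

theorem hasCore_iff {f : E →ₗ.[ℂ] E} (hf : f.IsClosed) {𝓔 : Submodule ℂ E} :
    f.HasCore 𝓔 ↔ 𝓔 ≤ f.domain ∧ f.graph = (f.domRestrict 𝓔).graph.topologicalClosure := by
  rw [← graph_closure_of_le hf LinearPMap.domRestrict_le]
  exact ⟨fun h => ⟨h.1, by rw [h.2]⟩, fun h => ⟨h.1, LinearPMap.eq_of_eq_graph h.2.symm⟩⟩

/-- A statement about pairs that is closed and holds on a core holds on the graph. -/
theorem graph_subset_of_hasCore {f : E →ₗ.[ℂ] E} (hf : f.IsClosed) {𝓔 : Submodule ℂ E}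
    (h : f.HasCore 𝓔) {P : Set (E × E)} (hP : IsClosed P)
    (hsub : ∀ x y, x ∈ 𝓔 → (x, y) ∈ f.graph → (x, y) ∈ P) : (f.graph : Set (E × E)) ⊆ P := by
  rw [((hasCore_iff hf).mp h).2, Submodule.topologicalClosure_coe]
  refine closure_minimal ?_ hP
  rintro ⟨x, y⟩ hxy
  obtain ⟨h1, h2⟩ := mem_graph_domRestrict.mp hxy
  exact hsub x y h1 h2

theorem hasCore_domain {f : E →ₗ.[ℂ] E} (hf : f.IsClosed) : f.HasCore f.domain := by
  have h := f.closureHasCore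
  rwa [LinearPMap.eq_of_eq_graph (f := f.closure) (g := f)
    (by rw [graph_closure_of_le hf le_rfl, hf.submodule_topologicalClosure_eq])] at h

theorem _root_.LinearPMap.HasCore.mono {f : E →ₗ.[ℂ] E} (hf : f.IsClosed)
    {𝓔 𝓕 : Submodule ℂ E} (h : f.HasCore 𝓔) (h𝓔 : 𝓔 ≤ 𝓕) (h𝓕 : 𝓕 ≤ f.domain) : f.HasCore 𝓕 := by
  rw [hasCore_iff hf] at h ⊢
  refine ⟨h𝓕, le_antisymm ?_ ?_⟩
  · rw [h.2]
    refine Submodule.topologicalClosure_mono ?_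
    rintro ⟨x, y⟩ hxy
    rw [mem_graph_domRestrict] at hxy ⊢
    exact ⟨h𝓔 hxy.1, hxy.2⟩
  · exact Submodule.topologicalClosure_minimal _
      (LinearPMap.le_graph_of_le LinearPMap.domRestrict_le) hf

end LinearPMapGraph

/-! ### Adjoints and regular operators -/

section RegularOperators

variable {B : Type v} [NonUnitalCStarAlgebra B] [PartialOrder B]
  {E : Type w} [NormedAddCommGroup E] [NormedSpace ℂ E] [SMul Bᵐᵒᵖ E] [CStarModule Bᵐᵒᵖ E]

theorem mem_adjointGraph_iff {D : E →ₗ.[ℂ] E} {p : E × E} :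
    p ∈ adjointGraph B D ↔ ∀ q ∈ D.graph, rinner B q.2 p.1 = rinner B q.1 p.2 := by
  constructor
  · rintro h ⟨x, y⟩ hq
    obtain ⟨a, rfl, rfl⟩ := (LinearPMap.mem_graph_iff _).mp hq
    exact h a
  · exact fun h x => h _ (D.mem_graph x)

variable (B) in
/-- `G` is invariant under the right action of `B`; for the graph of an operator this is
`B`-linearity. -/
def IsRightInvariant (G : Submodule ℂ (E × E)) : Prop :=
  ∀ (b : B) (x y : E), (x, y) ∈ G → (x <• b, y <• b) ∈ G

variable [StarOrderedRing B]

theorem mem_graph_adjoint_iff {D : E →ₗ.[ℂ] E} (hD : Dense (D.domain : Set E)) {p : E × E} :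
    p ∈ (adjoint B D).graph ↔ ∀ q ∈ D.graph, rinner B q.2 p.1 = rinner B q.1 p.2 := by
  rw [adjoint, Submodule.toLinearPMap_graph_eq, mem_adjointGraph_iff]
  rintro p hp h0
  rw [mem_adjointGraph_iff] at hp
  refine eq_zero_of_dense B hD fun x hx => ?_
  obtain ⟨y, hy⟩ := exists_mem_graph hx
  rw [← hp _ hy, h0, rinner_zero_right]

section Invariance

omit [StarOrderedRing B] in
theorem IsRightInvariant.combRel {a b : ℂ} {S T : Submodule ℂ (E × E)}
    (hS : IsRightInvariant B S)
    (hT : IsRightInvariant B T) : IsRightInvariant B (combRel a b S T) := by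
  rintro c x y ⟨s, t, hs, ht, hy⟩
  refine ⟨s <• c, t <• c, hS c _ _ hs, hT c _ _ ht, ?_⟩
  simp only at hy ⊢
  rw [← rightMulL_apply, ← rightMulL_apply, ← rightMulL_apply, hy, map_add, map_smul, map_smul]

omit [StarOrderedRing B] in
theorem IsRightInvariant.topologicalClosure {S : Submodule ℂ (E × E)} (hS : IsRightInvariant B S) :
    IsRightInvariant B S.topologicalClosure := by
  intro c x y hxy
  have hc : Continuous fun p : E × E => (rightMulL B c p.1, rightMulL B c p.2) := by fun_prop
  exact map_mem_closure (f := fun p : E × E => (rightMulL B c p.1, rightMulL B c p.2)) hc hxy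
    fun p hp => hS c _ _ hp

theorem isRightInvariant_adjoint {D : E →ₗ.[ℂ] E} (hD : Dense (D.domain : Set E)) :
    IsRightInvariant B (adjoint B D).graph := by
  intro b x y h
  rw [mem_graph_adjoint_iff hD] at h ⊢
  intro q hq
  rw [rinner_smul, rinner_smul, h q hq]

end Invariance

/-- `[[0, D], [D', 0]]` is unitarily equivalent to `[[0, D'], [D, 0]]`, by exchange of the
summands. -/
theorem IsSelfAdjointRel.offDiagRel_swap {D D' : Submodule ℂ (E × E)}
    (h : IsSelfAdjointRel B (offDiagRel B D D')) : IsSelfAdjointRel B (offDiagRel B D' D) := by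
  refine ⟨fun p hp q hq => ?_, ?_, fun μ hμ y => ?_⟩
  · have := h.symm (dpair B p.1.2 p.1.1, dpair B p.2.2 p.2.1) ⟨hp.2, hp.1⟩
      (dpair B q.1.2 q.1.1, dpair B q.2.2 q.2.1) ⟨hq.2, hq.1⟩
    rw [rinner_double, rinner_double] at this ⊢
    rw [add_comm, add_comm (rinner B p.1.1 q.2.1)]
    exact this
  · rw [Metric.dense_iff]
    intro x r hr
    have hd : Dense
        {x : Double B E | x.1 ∈ {a | ∃ c, (a, c) ∈ D'} ∧ x.2 ∈ {a | ∃ c, (a, c) ∈ D}} := by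
      refine dense_double ?_ ?_
      · refine (DenseRange.dense_image (f := fun x : Double B E => x.2)
          (Function.Surjective.denseRange fun a => ⟨dpair B 0 a, rfl⟩) continuous_snd_double
          h.dense).mono ?_
        rintro _ ⟨z, ⟨c, hc⟩, rfl⟩
        exact ⟨c.1, hc.2⟩
      · refine (DenseRange.dense_image (f := fun x : Double B E => x.1)
          (Function.Surjective.denseRange fun a => ⟨dpair B a 0, rfl⟩) continuous_fst_double
          h.dense).mono ?_
        rintro _ ⟨z, ⟨c, hc⟩, rfl⟩
        exact ⟨c.2, hc.1⟩
    obtain ⟨z, hz, ⟨c, hc⟩, ⟨d, hd⟩⟩ := Metric.dense_iff.mp hd x r hr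
    exact ⟨z, hz, dpair B d c, hc, hd⟩
  · obtain ⟨p, hp, hpy⟩ := h.surj μ hμ (dpair B y.2 y.1)
    refine ⟨(dpair B p.1.2 p.1.1, dpair B p.2.2 p.2.1), ⟨hp.2, hp.1⟩, Prod.ext ?_ ?_⟩
    · exact congrArg (fun z : Double B E => z.2) hpy
    · exact congrArg (fun z : Double B E => z.1) hpy

theorem IsSelfAdjointRel.dense_fst {D D' : Submodule ℂ (E × E)}
    (h : IsSelfAdjointRel B (offDiagRel B D D')) : Dense {x | ∃ y, (x, y) ∈ D} := by
  refine (DenseRange.dense_image (f := fun x : Double B E => x.1)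
    (Function.Surjective.denseRange fun a => ⟨dpair B a 0, rfl⟩) continuous_fst_double
          h.dense).mono ?_
  rintro _ ⟨z, ⟨c, hc⟩, rfl⟩
  exact ⟨c.2, hc.1⟩

/-- Consequences of the self-adjointness of `[[0, D'], [D, 0]]`: `D` and `D'` are formally
adjoint to each other. -/
theorem IsSelfAdjointRel.adjoint_eq {D D' : Submodule ℂ (E × E)}
    (h : IsSelfAdjointRel B (offDiagRel B D D')) {p q : E × E} (hp : p ∈ D) (hq : q ∈ D') :
    rinner B p.2 q.1 = rinner B p.1 q.2 := by
  have := h.symm (dpair B p.1 0, dpair B 0 p.2) ⟨hp, D'.zero_mem⟩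
    (dpair B 0 q.1, dpair B q.2 0) ⟨D.zero_mem, hq⟩
  rw [rinner_double, rinner_double] at this
  change rinner B (0 : E) (0 : E) + rinner B p.2 q.1
    = rinner B p.1 q.2 + rinner B (0 : E) (0 : E) at this
  simpa using this

/-- The converse of `isSelfAdjointRel_offDiagRel`: self-adjointness of the matrix contains the
regularity of `D` and determines its adjoint. -/
theorem isRegular_of_isSelfAdjointRel_offDiagRel {D D' : E →ₗ.[ℂ] E}
    (hD : IsRightInvariant B D.graph)
    (h : IsSelfAdjointRel B (offDiagRel B D.graph D'.graph)) :
    IsRegular B D ∧ adjoint B D = D' := by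
  have hdense : Dense (D.domain : Set E) := by
    rw [← setOf_exists_mem_graph]
    exact h.dense_fst
  have hadj : adjoint B D = D' := by
    refine LinearPMap.eq_of_eq_graph (SetLike.ext fun p => ?_)
    rw [mem_graph_adjoint_iff hdense]
    exact ⟨fun hp => h.mem_snd_of_adjoint hp, fun hp q hq => h.adjoint_eq hq hp⟩
  refine ⟨⟨?_, hD, hdense, ?_, ?_⟩, hadj⟩
  · have e : (D.graph : Set (E × E)) =
        ⋂ q ∈ D'.graph, {p : E × E | rinner B q.2 p.1 = rinner B q.1 p.2} := by
      ext p
      simp only [Set.mem_iInter]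
      refine ⟨fun hp q hq => ?_, fun hp => h.mem_fst_of_adjoint fun q hq => hp q hq⟩
      have := congrArg star (h.adjoint_eq hp hq)
      rw [star_rinner, star_rinner] at this
      exact this.symm
    rw [LinearPMap.IsClosed, e]
    exact isClosed_biInter fun q _ => isClosed_eq (Continuous.rinner' B (by fun_prop) (by fun_prop))
      (Continuous.rinner' B (by fun_prop) (by fun_prop))
  · rw [hadj, ← setOf_exists_mem_graph]
    exact h.offDiagRel_swap.dense_fst
  · rw [hadj]
    exact fun e => subset_closure (h.exists_one_add e)

theorem IsRegular.isSelfAdjointRel [CompleteSpace E] {D : E →ₗ.[ℂ] E} (hD : IsRegular B D) :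
    IsSelfAdjointRel B (offDiagRel B D.graph (adjoint B D).graph) := by
  refine isSelfAdjointRel_offDiagRel hD.closed ?_ (fun _ => mem_graph_adjoint_iff hD.dense) ?_
    hD.dense_range
  · rw [setOf_exists_mem_graph]
    exact hD.dense
  · rw [setOf_exists_mem_graph]
    exact hD.dense_adjoint

/-- Regular self-adjoint operators are those for which `T - iμ` is onto for all real `μ ≠ 0`. -/
theorem isRegular_and_isSelfAdjointOp_iff [CompleteSpace E] {T : E →ₗ.[ℂ] E} :
    IsRegular B T ∧ IsSelfAdjointOp B T ↔
      IsRightInvariant B T.graph ∧ IsSelfAdjointRel B T.graph := by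
  constructor
  · rintro ⟨hT, hT'⟩
    have h := hT.isSelfAdjointRel
    rw [hT'.2] at h
    refine ⟨hT.smul_mem_graph, fun p hp q hq => h.adjoint_eq hp hq, h.dense_fst, fun μ hμ y => ?_⟩
    obtain ⟨p, hp, hpy⟩ := h.surj μ hμ (dpair B y y)
    have h1 : p.2.1 - (I * μ : ℂ) • p.1.1 = y := congrArg (fun z : Double B E => z.1) hpy
    have h2 : p.2.2 - (I * μ : ℂ) • p.1.2 = y := congrArg (fun z : Double B E => z.2) hpy
    refine ⟨(1 / 2 : ℂ) • ((p.1.1, p.2.2) + (p.1.2, p.2.1)),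
      T.graph.smul_mem _ (T.graph.add_mem hp.1 hp.2), ?_⟩
    have : y = (1 / 2 : ℂ) • (y + y) := by module
    rw [this]
    nth_rewrite 1 [← h1]
    rw [← h2]
    simp only [Prod.mk_add_mk, Prod.smul_mk]
    module
  · rintro ⟨hT, hT'⟩
    obtain ⟨h1, h2⟩ := isRegular_of_isSelfAdjointRel_offDiagRel hT hT'.offDiagRel_self
    exact ⟨h1, h1.dense, h2⟩

/-- A densely defined symmetric operator equal to a self-adjoint one on a core has that operator as
its closure. -/
theorem closure_eq_of_core {f T : E →ₗ.[ℂ] E} {𝓔 : Submodule ℂ E} (hT : T.IsClosed)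
    (hc : T.HasCore 𝓔) (h1 : ∀ x y, x ∈ 𝓔 → (x, y) ∈ T.graph → (x, y) ∈ f.graph)
    (h2 : f ≤ T) : f.closure = T := by
  refine le_antisymm (closure_le_of_le hT h2) (LinearPMap.le_of_le_graph ?_)
  have hcl : f.closure.IsClosed := (hT.isClosable.leIsClosable h2).closure_isClosed
  refine graph_subset_of_hasCore hT hc hcl fun x y hx hxy => ?_
  exact LinearPMap.le_graph_of_le f.le_closure (h1 x y hx hxy)

end RegularOperators

/-! ### Almost anti-commuting pairs as relations -/

section AlmostAnticommuting

variable {B : Type v} [NonUnitalCStarAlgebra B] [PartialOrder B] [StarOrderedRing B]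
  {E : Type w} [NormedAddCommGroup E] [NormedSpace ℂ E] [SMul Bᵐᵒᵖ E] [CStarModule Bᵐᵒᵖ E]

/-- Adjointable operators are bounded, by the closed graph theorem. -/
theorem IsAdjointable.continuous [CompleteSpace E] {R : E →ₗ[ℂ] E} (hR : IsAdjointable B R) :
    Continuous R := by
  obtain ⟨R', h⟩ := hR
  refine R.continuous_of_isClosed_graph ?_
  have e : (R.graph : Set (E × E)) = ⋂ z : E, {p | rinner B p.2 z = rinner B p.1 (R' z)} := by
    ext p
    simp only [SetLike.mem_coe, LinearMap.mem_graph_iff, Set.mem_iInter]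
    refine ⟨fun hp z => ?_, fun hp => ?_⟩
    · change rinner B p.2 z = rinner B p.1 (R' z)
      rw [hp, h]
    · refine ext_rinner B fun z => ?_
      have h1 := congrArg star (show rinner B p.2 z = rinner B p.1 (R' z) from hp z)
      rw [← h, star_rinner, star_rinner] at h1
      exact h1
  rw [e]
  exact isClosed_iInter fun z => isClosed_eq (Continuous.rinner' B (by fun_prop) (by fun_prop))
    (Continuous.rinner' B (by fun_prop) (by fun_prop))

theorem IsAdjointable.exists_bound [CompleteSpace E] {R : E →ₗ[ℂ] E} (hR : IsAdjointable B R) :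
    ∃ C, 0 ≤ C ∧ ∀ x, ‖R x‖ ≤ C * ‖x‖ :=
  ⟨_, norm_nonneg _, fun x => ContinuousLinearMap.le_opNorm ⟨R, hR.continuous⟩ x⟩

theorem IsSelfAdjointRel.smoothing_I_div_smul {S : Submodule ℂ (E × E)} (hS : IsSelfAdjointRel B S)
    {μ : ℝ} (hμ : μ ≠ 0) {p : E × E} (hp : p ∈ S) :
    smoothing S μ ((I / μ : ℂ) • (p.2 - (I * μ : ℂ) • p.1)) = p.1 := by
  have := hS.smoothing_eq hμ hp
  rwa [show (I / μ : ℂ) • (p.2 - (I * μ : ℂ) • p.1) = p.1 + (I / μ : ℂ) • p.2 by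
    have h := I_div_mul_neg hμ
    rw [smul_sub, smul_smul, show (I / μ : ℂ) * (I * μ) = -1 by rw [← h]; ring]
    module]

/-- The defining property of an almost anti-commuting pair, with resolvent vectors of elements of
the core of `T`, extends to all of `Dom T`. -/
theorem IsAlmostAnticommuting.exists_resolvent_bound [CompleteSpace E] {S T : E →ₗ.[ℂ] E}
    (h : IsAlmostAnticommuting B S T) (hS : IsSelfAdjointRel B S.graph) {μ : ℝ} (hμ : μ ≠ 0) :
    ∃ C, 0 ≤ C ∧ ∀ η s ζ, (η, s) ∈ S.graph → (s - (I * μ : ℂ) • η, ζ) ∈ T.graph →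
      ∃ p q, (η, p) ∈ T.graph ∧ (p, q) ∈ S.graph ∧
        ‖q + (I * μ : ℂ) • p + ζ‖ ≤ C * ‖s - (I * μ : ℂ) • η‖ := by
  obtain ⟨𝓔, -, hcore, -, hR⟩ := h.exists_core
  obtain ⟨R, hRadj, hRval⟩ := hR μ hμ
  obtain ⟨C, hC, hRC⟩ := hRadj.exists_bound
  have hμ' : -μ ≠ 0 := neg_ne_zero.mpr hμ
  refine ⟨C, hC, ?_⟩
  -- the resolvents of `S` at `iμ` and `-iμ`
  let r : E → E := fun x => smoothing S.graph μ ((I / μ : ℂ) • x)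
  let r' : E → E := fun x => smoothing S.graph (-μ) ((I / (-μ : ℝ) : ℂ) • x)
  have hr : ∀ p ∈ S.graph, r (p.2 - (I * μ : ℂ) • p.1) = p.1 :=
    fun p hp => hS.smoothing_I_div_smul hμ hp
  have hr' : ∀ p ∈ S.graph, r' (p.2 + (I * μ : ℂ) • p.1) = p.1 := fun p hp => by
    have := hS.smoothing_I_div_smul hμ' hp
    rwa [show p.2 - (I * (-μ : ℝ) : ℂ) • p.1 = p.2 + (I * μ : ℂ) • p.1 by push_cast; module] at this
  -- `T r ξ = r' (R ξ - T ξ)` on the core; this is a closed condition on the pair `(ξ, T ξ)`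
  have hclosed : IsClosed {q : E × E | (r q.1, r' (R q.1 - q.2)) ∈ (T.graph : Set (E × E))} := by
    refine IsClosed.preimage ?_ h.regular_right.closed
    have := hRadj.continuous
    fun_prop
  have hall := graph_subset_of_hasCore h.regular_right.closed hcore hclosed ?_
  · intro η s ζ hη hζ
    have h1 : (r (s - (I * μ : ℂ) • η), r' (R (s - (I * μ : ℂ) • η) - ζ)) ∈ T.graph := hall hζ
    rw [hr _ hη] at h1
    obtain ⟨p, hp, hpy⟩ := hS.surj (-μ) hμ' (R (s - (I * μ : ℂ) • η) - ζ)
    have hpy' : p.2 + (I * μ : ℂ) • p.1 = R (s - (I * μ : ℂ) • η) - ζ := by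
      rw [← hpy]; push_cast; module
    rw [← hpy', hr' _ hp] at h1
    refine ⟨p.1, p.2, h1, hp, ?_⟩
    rw [hpy', sub_add_cancel]
    exact hRC _
  · intro ξ ζ hξ hζ
    obtain ⟨η, hη, p, q, a, b, hp, hq, ha, hb, hval⟩ := hRval ξ hξ
    change (r ξ, r' (R ξ - ζ)) ∈ T.graph
    have e1 : r ξ = η := by
      have := hr _ hη
      simpa using this
    have ea : a = ξ + (I * μ : ℂ) • η := LinearPMap.mem_graph_snd_inj _ ha hη rfl
    have eb : b = ζ + (I * μ : ℂ) • p := by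
      refine LinearPMap.mem_graph_snd_inj _ hb (T.graph.add_mem hζ (T.graph.smul_mem _ hp)) ?_
      rw [ea]; rfl
    have e2 : r' (R ξ - ζ) = p := by
      have := hr' _ hq
      rw [hval, eb]
      convert this using 2
      module
    rw [e1, e2]
    exact hp

theorem IsAlmostAnticommuting.isSelfAdjointRel_left [CompleteSpace E] {S T : E →ₗ.[ℂ] E}
    (h : IsAlmostAnticommuting B S T) : IsSelfAdjointRel B S.graph :=
  (isRegular_and_isSelfAdjointOp_iff.mp ⟨h.regular_left, h.selfAdjoint_left⟩).2

theorem IsAlmostAnticommuting.isSelfAdjointRel_right [CompleteSpace E] {S T : E →ₗ.[ℂ] E}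
    (h : IsAlmostAnticommuting B S T) : IsSelfAdjointRel B T.graph :=
  (isRegular_and_isSelfAdjointOp_iff.mp ⟨h.regular_right, h.selfAdjoint_right⟩).2

/-- Almost anti-commuting operators in terms of graphs, with a single constant. The resolvent at `i`
suffices for the bound on the anticommutator; the resolvents at `iμ` preserve `Dom T`. -/
theorem IsAlmostAnticommuting.exists_isAlmostCommRel [CompleteSpace E] {S T : E →ₗ.[ℂ] E}
    (h : IsAlmostAnticommuting B S T) : ∃ C, IsAlmostCommRel (-1) S.graph T.graph C := by
  have hS := h.isSelfAdjointRel_left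
  obtain ⟨C, hC, hb⟩ := h.exists_resolvent_bound hS one_ne_zero
  refine ⟨C, Or.inr rfl, hC, fun μ hμ u s hus ⟨y, hy⟩ => ?_, fun z s t w hs ht hw => ?_⟩
  · obtain ⟨_, _, hb'⟩ := h.exists_resolvent_bound hS hμ
    have e : s - (I * μ : ℂ) • u = (-(I * μ) : ℂ) • (u + (I / μ : ℂ) • s) := by
      have h := I_div_mul_neg hμ
      rw [smul_add, smul_smul, mul_comm (-(I * μ : ℂ)), h]
      module
    obtain ⟨p, q, hp, -⟩ := hb' u s ((-(I * μ) : ℂ) • y) hus (by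
      rw [e]
      exact T.graph.smul_mem _ hy)
    exact ⟨p, hp⟩
  · obtain ⟨p, q, hp, hq, hle⟩ := hb z s (w - (I * (1 : ℝ) : ℂ) • t) hs
      (T.graph.sub_mem hw (T.graph.smul_mem _ ht))
    obtain rfl : p = t := LinearPMap.mem_graph_snd_inj _ hp ht rfl
    refine ⟨q, hq, ?_⟩
    rw [show q - ((-1 : ℝ) : ℂ) • w = q + (I * (1 : ℝ) : ℂ) • p + (w - (I * (1 : ℝ) : ℂ) • p) by
      push_cast; module]
    refine hle.trans (mul_le_mul_of_nonneg_left ((norm_sub_le _ _).trans ?_) hC)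
    rw [norm_smul]
    simp

theorem mem_graph_neg {f : E →ₗ.[ℂ] E} {x y : E} : (x, y) ∈ (-f).graph ↔ (x, -y) ∈ f.graph := by
  rw [show (-f) = (-1 : ℂ) • f by
    refine LinearPMap.ext' ?_
    ext
    simp, mem_graph_smul]
  constructor
  · rintro ⟨z, hz, rfl⟩
    simpa using hz
  · intro h
    exact ⟨-y, h, by simp⟩

omit [StarOrderedRing B] in
theorem IsSelfAdjointRel.neg {T : E →ₗ.[ℂ] E} (hT : IsSelfAdjointRel B T.graph) :
    IsSelfAdjointRel B (-T).graph := by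
  refine ⟨fun p hp q hq => ?_, ?_, fun μ hμ y => ?_⟩
  · have := hT.symm _ (mem_graph_neg.mp hp) _ (mem_graph_neg.mp hq)
    simpa using this
  · refine hT.dense.mono ?_
    rintro x ⟨y, hy⟩
    exact ⟨-y, mem_graph_neg.mpr (by rwa [neg_neg])⟩
  · obtain ⟨p, hp, hpy⟩ := hT.surj (-μ) (neg_ne_zero.mpr hμ) (-y)
    refine ⟨(p.1, -p.2), mem_graph_neg.mpr (by rwa [neg_neg]), ?_⟩
    rw [← neg_neg y, ← hpy]
    push_cast
    module

omit [StarOrderedRing B] in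
theorem IsRightInvariant.neg {T : E →ₗ.[ℂ] E} (hT : IsRightInvariant B T.graph) :
    IsRightInvariant B (-T).graph := by
  intro b x y h
  rw [mem_graph_neg] at h ⊢
  have := hT b _ _ h
  rwa [← rightMulL_apply, ← rightMulL_apply, map_neg] at this

theorem IsAlmostCommRel.neg_right {ε C : ℝ} {S : Submodule ℂ (E × E)} {T : E →ₗ.[ℂ] E}
    (h : IsAlmostCommRel ε S T.graph C) : IsAlmostCommRel ε S (-T).graph C := by
  refine ⟨h.sign, h.nonneg, fun μ hμ u s hus ⟨y, hy⟩ => ?_, fun z s t w hs ht hw => ?_⟩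
  · obtain ⟨t, ht⟩ := h.resolvent μ hμ u s hus ⟨_, mem_graph_neg.mp hy⟩
    exact ⟨-t, mem_graph_neg.mpr (by rwa [neg_neg])⟩
  · obtain ⟨v, hv, hle⟩ := h.comm z s _ _ hs (mem_graph_neg.mp ht) (mem_graph_neg.mp hw)
    refine ⟨-v, by simpa using S.neg_mem hv, ?_⟩
    rwa [show -v - (ε : ℂ) • w = -(v - (ε : ℂ) • (-w)) by module, norm_neg]

theorem isRegular_and_isSelfAdjointOp_smul [CompleteSpace E] {T : E →ₗ.[ℂ] E} {c : ℝ} (hc : c ≠ 0)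
    (h : IsRegular B T ∧ IsSelfAdjointOp B T) :
    IsRegular B ((c : ℂ) • T) ∧ IsSelfAdjointOp B ((c : ℂ) • T) := by
  rw [isRegular_and_isSelfAdjointOp_iff] at h ⊢
  obtain ⟨hinv, hT⟩ := h
  have hc' : (c : ℂ) ≠ 0 := by exact_mod_cast hc
  refine ⟨fun b x y hxy => ?_, ?_, ?_, fun μ hμ y => ?_⟩
  · obtain ⟨z, hz, rfl⟩ := mem_graph_smul.mp hxy
    refine mem_graph_smul.mpr ⟨_, hinv b _ _ hz, ?_⟩
    rw [← rightMulL_apply, ← rightMulL_apply, map_smul]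
  · rintro ⟨x, y⟩ hp ⟨x', y'⟩ hq
    obtain ⟨z, hz, rfl⟩ := mem_graph_smul.mp hp
    obtain ⟨z', hz', rfl⟩ := mem_graph_smul.mp hq
    have := hT.symm _ hz _ hz'
    simp only at this
    simp only [rinner_csmul_left, rinner_csmul_right, conj_ofReal, this]
  · refine hT.dense.mono ?_
    rintro x ⟨y, hy⟩
    exact ⟨_, mem_graph_smul.mpr ⟨y, hy, rfl⟩⟩
  · obtain ⟨p, hp, hpy⟩ := hT.surj (μ / c) (div_ne_zero hμ hc) ((c : ℂ)⁻¹ • y)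
    refine ⟨(p.1, (c : ℂ) • p.2), mem_graph_smul.mpr ⟨_, hp, rfl⟩, ?_⟩
    have : y = (c : ℂ) • ((c : ℂ)⁻¹ • y) := by rw [smul_smul, mul_inv_cancel₀ hc', one_smul]
    rw [this, ← hpy, smul_sub, smul_smul]
    congr 2
    push_cast
    field_simp

theorem _root_.LinearPMap.HasCore.smul {T : E →ₗ.[ℂ] E} (hT : T.IsClosed) {c : ℂ}
    (hcT : (c • T).IsClosed) {𝓔 : Submodule ℂ E} (h : T.HasCore 𝓔) : (c • T).HasCore 𝓔 := by
  rw [hasCore_iff hcT]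
  refine ⟨h.1, le_antisymm ?_ (Submodule.topologicalClosure_minimal _
    (LinearPMap.le_graph_of_le LinearPMap.domRestrict_le) hcT)⟩
  have hcl : IsClosed {p : E × E | (p.1, c • p.2) ∈
      (((c • T).domRestrict 𝓔).graph.topologicalClosure : Set (E × E))} :=
    (Submodule.isClosed_topologicalClosure _).preimage (by fun_prop)
  rintro ⟨x, y⟩ hxy
  obtain ⟨z, hz, rfl⟩ := mem_graph_smul.mp hxy
  refine graph_subset_of_hasCore hT h hcl (fun a b ha hab => ?_) hz
  exact Submodule.le_topologicalClosure _
    (mem_graph_domRestrict.mpr ⟨ha, mem_graph_smul.mpr ⟨_, hab, rfl⟩⟩)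

/-- Rescaling both operators. Sums and differences of pairs differ from real and imaginary parts by
a factor `2`. -/
theorem IsAlmostAnticommuting.smul [CompleteSpace E] {S T : E →ₗ.[ℂ] E}
    (h : IsAlmostAnticommuting B S T) {c : ℝ} (hc : c ≠ 0) :
    IsAlmostAnticommuting B ((c : ℂ) • S) ((c : ℂ) • T) := by
  obtain ⟨h1, h2⟩ := isRegular_and_isSelfAdjointOp_smul hc ⟨h.regular_left, h.selfAdjoint_left⟩
  obtain ⟨h3, h4⟩ := isRegular_and_isSelfAdjointOp_smul hc ⟨h.regular_right, h.selfAdjoint_right⟩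
  have hc' : (c : ℂ) ≠ 0 := by exact_mod_cast hc
  obtain ⟨𝓔, hinv, hcore, hdom, hR⟩ := h.exists_core
  -- `(cS - iμ)⁻¹ = c⁻¹ (S - iμ/c)⁻¹`
  have key : ∀ (D : E →ₗ.[ℂ] E) {x y : E}, (x, y) ∈ D.graph →
      ((c : ℂ)⁻¹ • x, y) ∈ ((c : ℂ) • D).graph := fun D x y hxy =>
    mem_graph_smul.mpr ⟨(c : ℂ)⁻¹ • y, D.graph.smul_mem _ hxy, by
      rw [smul_smul, mul_inv_cancel₀ hc', one_smul]⟩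
  have eη : ∀ (μ : ℝ) (ξ η : E), ξ + (I * (μ / c : ℝ) : ℂ) • η
      = ξ + (I * μ : ℂ) • ((c : ℂ)⁻¹ • η) := fun μ ξ η => by
    rw [smul_smul]
    push_cast
    congr 2
    ring
  refine ⟨h1, h2, h3, h4, 𝓔, hinv,
    LinearPMap.HasCore.smul h.regular_right.closed h3.closed hcore, ?_, ?_⟩
  · intro ξ hξ μ hμ
    obtain ⟨η, p, hη, hp, hpS⟩ := hdom ξ hξ (μ / c) (div_ne_zero hμ hc)
    exact ⟨(c : ℂ)⁻¹ • η, p, eη μ ξ η ▸ key S hη, key T hp, hpS⟩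
  · intro μ hμ
    obtain ⟨R, ⟨R', hR'⟩, hval⟩ := hR (μ / c) (div_ne_zero hμ hc)
    refine ⟨(c : ℂ) • R, ⟨(c : ℂ) • R', fun x y => by
      simp only [LinearMap.smul_apply, rinner_csmul_left, rinner_csmul_right, conj_ofReal, hR']⟩,
      fun ξ hξ => ?_⟩
    obtain ⟨η, hη, p, q, r, s, hp, hq, hr, hs, hz⟩ := hval ξ hξ
    refine ⟨(c : ℂ)⁻¹ • η, eη μ ξ η ▸ key S hη, p, (c : ℂ) • q, r, (c : ℂ) • s, key T hp,
      mem_graph_smul.mpr ⟨q, hq, rfl⟩, key S hr, mem_graph_smul.mpr ⟨s, hs, rfl⟩, ?_⟩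
    rw [LinearMap.smul_apply, hz, smul_add]

theorem mem_graph_zero {x y : E} : (x, y) ∈ (0 : E →ₗ.[ℂ] E).graph ↔ y = 0 := by
  rw [LinearPMap.mem_graph_iff]
  constructor
  · rintro ⟨a, -, rfl⟩
    rfl
  · rintro rfl
    exact ⟨⟨x, trivial⟩, rfl, rfl⟩

theorem isClosed_zero : (0 : E →ₗ.[ℂ] E).IsClosed := by
  have : ((0 : E →ₗ.[ℂ] E).graph : Set (E × E)) = {p | p.2 = 0} := by
    ext ⟨x, y⟩
    exact mem_graph_zero
  rw [LinearPMap.IsClosed, this]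
  exact isClosed_eq continuous_snd continuous_const

theorem hasCore_zero {𝓔 : Submodule ℂ E} (h : Dense (𝓔 : Set E)) :
    (0 : E →ₗ.[ℂ] E).HasCore 𝓔 := by
  rw [hasCore_iff isClosed_zero]
  refine ⟨le_top, le_antisymm ?_ (Submodule.topologicalClosure_minimal _
    (LinearPMap.le_graph_of_le LinearPMap.domRestrict_le) isClosed_zero)⟩
  rintro ⟨x, y⟩ hxy
  obtain rfl := mem_graph_zero.mp hxy
  have hf : Continuous fun x : E => (x, (0 : E)) := by fun_prop
  exact map_mem_closure (f := fun x : E => (x, (0 : E))) hf (h x) fun z hz =>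
    mem_graph_domRestrict.mpr ⟨hz, mem_graph_zero.mpr rfl⟩

theorem isRegular_and_isSelfAdjointOp_zero [CompleteSpace E] :
    IsRegular B (0 : E →ₗ.[ℂ] E) ∧ IsSelfAdjointOp B (0 : E →ₗ.[ℂ] E) := by
  rw [isRegular_and_isSelfAdjointOp_iff]
  refine ⟨fun b x y hxy => ?_, fun p hp q hq => ?_, ?_, fun μ hμ y => ?_⟩
  · obtain rfl := mem_graph_zero.mp hxy
    rw [← rightMulL_apply, ← rightMulL_apply, map_zero]
    exact mem_graph_zero.mpr rfl
  · rw [mem_graph_zero.mp hp, mem_graph_zero.mp hq]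
    simp
  · exact fun x => subset_closure ⟨0, mem_graph_zero.mpr rfl⟩
  · refine ⟨((-(I / μ) * -1 : ℂ) • y, 0), mem_graph_zero.mpr rfl, ?_⟩
    have h := I_div_mul_neg hμ
    rw [zero_sub, smul_smul, ← neg_smul,
      show -(I * μ * (-(I / μ) * -1) : ℂ) = I / μ * -(I * μ) by ring, h, one_smul]

/-- Every regular self-adjoint operator almost anti-commutes with `0`, its imaginary part. -/
theorem isAlmostAnticommuting_zero [CompleteSpace E] {T : E →ₗ.[ℂ] E}
    (h : IsRegular B T ∧ IsSelfAdjointOp B T) : IsAlmostAnticommuting B T 0 := by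
  obtain ⟨h3, h4⟩ := isRegular_and_isSelfAdjointOp_zero (B := B) (E := E)
  have hT := (isRegular_and_isSelfAdjointOp_iff.mp h).2
  have hs : ∀ (ξ : E) (μ : ℝ), μ ≠ 0 → ∃ η, (η, ξ + (I * μ : ℂ) • η) ∈ T.graph := fun ξ μ hμ => by
    obtain ⟨p, hp, hpy⟩ := hT.surj μ hμ ξ
    refine ⟨p.1, ?_⟩
    rw [← hpy, sub_add_cancel]
    exact hp
  refine ⟨h.1, h.2, h3, h4, ⊤, fun _ _ _ => trivial, hasCore_zero (by simp), ?_, ?_⟩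
  · intro ξ _ μ hμ
    obtain ⟨η, hη⟩ := hs ξ μ hμ
    exact ⟨η, 0, hη, mem_graph_zero.mpr rfl, T.domain.zero_mem⟩
  · intro μ hμ
    refine ⟨0, ⟨0, fun x y => by simp⟩, fun ξ _ => ?_⟩
    obtain ⟨η, hη⟩ := hs ξ μ hμ
    exact ⟨η, hη, 0, 0, _, 0, mem_graph_zero.mpr rfl, T.graph.zero_mem, hη, mem_graph_zero.mpr rfl,
      by simp⟩

end AlmostAnticommuting

/-! ### Change of the norm in the compactness condition -/

section Compactness

variable {B : Type v} [NonUnitalCStarAlgebra B] [PartialOrder B]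
  {E : Type w} [NormedAddCommGroup E] [NormedSpace ℂ E] [SMul Bᵐᵒᵖ E] [CStarModule Bᵐᵒᵖ E]

theorem combinedInner_eq {S T : E →ₗ.[ℂ] E} {φ ψ : ↥(S.domain ⊓ T.domain)} {p q p' q' : E}
    (hp : ((φ : E), p) ∈ S.graph) (hq : ((φ : E), q) ∈ T.graph)
    (hp' : ((ψ : E), p') ∈ S.graph) (hq' : ((ψ : E), q') ∈ T.graph) :
    combinedInner B S T φ ψ = rinner B (φ : E) (ψ : E) + rinner B p p' + rinner B q q' := by
  rw [combinedInner, (LinearPMap.image_iff φ.2.1).mpr hp, (LinearPMap.image_iff φ.2.2).mpr hq,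
    (LinearPMap.image_iff ψ.2.1).mpr hp', (LinearPMap.image_iff ψ.2.2).mpr hq']

variable [StarOrderedRing B]

theorem le_combinedNorm {S T : E →ₗ.[ℂ] E} {ψ : ↥(S.domain ⊓ T.domain)} {p q : E}
    (hp : ((ψ : E), p) ∈ S.graph) (hq : ((ψ : E), q) ∈ T.graph) :
    ‖(ψ : E)‖ ≤ combinedNorm B S T ψ ∧ ‖p‖ ≤ combinedNorm B S T ψ ∧
      ‖q‖ ≤ combinedNorm B S T ψ := by
  rw [combinedNorm, combinedInner_eq hp hq hp hq]
  have h0 := rinner_self_nonneg (B := B) (ψ : E)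
  have h1 := rinner_self_nonneg (B := B) p
  have h2 := rinner_self_nonneg (B := B) q
  refine ⟨Real.le_sqrt_of_sq_le ?_, Real.le_sqrt_of_sq_le ?_, Real.le_sqrt_of_sq_le ?_⟩
  · rw [add_assoc]
    exact sq_norm_le_of_nonneg B _ (add_nonneg h1 h2)
  · rw [add_right_comm, add_comm _ (rinner B p p)]
    exact sq_norm_le_of_nonneg B p (add_nonneg h0 h2)
  · rw [add_comm]
    exact sq_norm_le_of_nonneg B _ (add_nonneg h0 h1)

omit [StarOrderedRing B] in
theorem combinedNorm_le {S T : E →ₗ.[ℂ] E} {ψ : ↥(S.domain ⊓ T.domain)} {p q : E}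
    (hp : ((ψ : E), p) ∈ S.graph) (hq : ((ψ : E), q) ∈ T.graph) :
    combinedNorm B S T ψ ≤ ‖(ψ : E)‖ + ‖p‖ + ‖q‖ := by
  rw [combinedNorm, combinedInner_eq hp hq hp hq]
  refine Real.sqrt_le_iff.mpr ⟨by positivity, ?_⟩
  have h0 := norm_nonneg (ψ : E)
  have h1 := norm_nonneg p
  have h2 := norm_nonneg q
  calc _ ≤ ‖(ψ : E)‖ ^ 2 + ‖p‖ ^ 2 + ‖q‖ ^ 2 := by
        rw [← norm_rinner_self (B := B), ← norm_rinner_self (B := B) p,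
          ← norm_rinner_self (B := B) q]
        exact norm_add₃_le
    _ ≤ _ := by nlinarith [mul_nonneg h0 h1, mul_nonneg h0 h2, mul_nonneg h1 h2]

/-- Compactness with respect to one inner product on a joint domain passes to another one, provided
that the first norm is bounded by the second and that every functional given by the first inner
product is given by the second. -/
theorem IsCompactOnDomains.of_representable {P Q P' Q' : E →ₗ.[ℂ] E} {K : E →ₗ[ℂ] E}
    (h : IsCompactOnDomains B P Q K) (hdom : P'.domain ⊓ Q'.domain ≤ P.domain ⊓ Q.domain)
    {M : ℝ} (hM : 0 ≤ M)
    (hbound : ∀ x p q p' q', (x, p) ∈ P.graph → (x, q) ∈ Q.graph → (x, p') ∈ P'.graph →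
      (x, q') ∈ Q'.graph → ‖p‖ + ‖q‖ ≤ M * (‖x‖ + ‖p'‖ + ‖q'‖))
    (hrep : ∀ x p q, (x, p) ∈ P.graph → (x, q) ∈ Q.graph →
      ∃ y p' q', (y, p') ∈ P'.graph ∧ (y, q') ∈ Q'.graph ∧ ∀ z a b a' b', (z, a) ∈ P.graph →
        (z, b) ∈ Q.graph → (z, a') ∈ P'.graph → (z, b') ∈ Q'.graph →
        rinner B x z + rinner B p a + rinner B q b
          = rinner B y z + rinner B p' a' + rinner B q' b') :
    IsCompactOnDomains B P' Q' K := by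
  intro ε hε
  obtain ⟨n, e, f, hf⟩ := h (ε / (1 + 3 * M)) (by positivity)
  have hrep' : ∀ i, ∃ y p' q', (y, p') ∈ P'.graph ∧ (y, q') ∈ Q'.graph ∧ ∀ z a b a' b',
      (z, a) ∈ P.graph → (z, b) ∈ Q.graph → (z, a') ∈ P'.graph → (z, b') ∈ Q'.graph →
        rinner B (f i : E) z + rinner B (P ⟨f i, (f i).2.1⟩) a + rinner B (Q ⟨f i, (f i).2.2⟩) b
          = rinner B y z + rinner B p' a' + rinner B q' b' :=
    fun i => hrep _ _ _ (P.mem_graph ⟨f i, (f i).2.1⟩) (Q.mem_graph ⟨f i, (f i).2.2⟩)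
  choose y p' q' hp' hq' hval using hrep'
  refine ⟨n, e, fun i => ⟨y i, LinearPMap.mem_domain_of_mem_graph (hp' i),
    LinearPMap.mem_domain_of_mem_graph (hq' i)⟩, fun ψ => ?_⟩
  let ψ' : ↥(P.domain ⊓ Q.domain) := ⟨ψ, hdom ψ.2⟩
  have hP := P.mem_graph ⟨ψ', ψ'.2.1⟩
  have hQ := Q.mem_graph ⟨ψ', ψ'.2.2⟩
  have hP' := P'.mem_graph ⟨ψ, ψ.2.1⟩
  have hQ' := Q'.mem_graph ⟨ψ, ψ.2.2⟩
  have hsum : ∀ i, combinedInner B P' Q' ⟨y i, LinearPMap.mem_domain_of_mem_graph (hp' i),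
      LinearPMap.mem_domain_of_mem_graph (hq' i)⟩ ψ = combinedInner B P Q (f i) ψ' := fun i => by
    rw [combinedInner_eq (hp' i) (hq' i) hP' hQ', ← hval i _ _ _ _ _ hP hQ hP' hQ']
    rfl
  simp only [hsum]
  refine (hf ψ').trans ?_
  obtain ⟨n0, n1, n2⟩ := le_combinedNorm (B := B) hP' hQ'
  have hb := hbound _ _ _ _ _ hP hQ hP' hQ'
  have hN : combinedNorm B P Q ψ' ≤ (1 + 3 * M) * combinedNorm B P' Q' ψ := by
    refine (combinedNorm_le (B := B) hP hQ).trans ?_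
    have : M * (‖(ψ : E)‖ + ‖P' ⟨ψ, ψ.2.1⟩‖ + ‖Q' ⟨ψ, ψ.2.2⟩‖)
        ≤ M * (combinedNorm B P' Q' ψ + combinedNorm B P' Q' ψ + combinedNorm B P' Q' ψ) := by
      gcongr
    have e1 : (ψ' : E) = ψ := rfl
    simp only [e1] at *
    linarith
  calc _ ≤ ε / (1 + 3 * M) * ((1 + 3 * M) * combinedNorm B P' Q' ψ) := by gcongr
    _ = _ := by field_simp

end Compactness

/-! ### Cartesian decompositions -/

section Cartesian

variable {B : Type v} [NonUnitalCStarAlgebra B] [PartialOrder B] [StarOrderedRing B]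
  {E : Type w} [NormedAddCommGroup E] [NormedSpace ℂ E] [SMul Bᵐᵒᵖ E] [CStarModule Bᵐᵒᵖ E]

/-- The decomposition of a pair `(d, d')` as `(s + it, s - it)`. -/
theorem eq_add_I_smul {F : Type*} [AddCommGroup F] [Module ℂ F] (d d' : F) :
    d = (1 / 2 : ℂ) • (d + d') + I • ((-I / 2 : ℂ) • (d - d')) ∧
      d' = (1 / 2 : ℂ) • (d + d') - I • ((-I / 2 : ℂ) • (d - d')) := by
  rw [smul_smul, show I * (-I / 2) = 1 / 2 by linear_combination (-1 / 2 : ℂ) * I_mul_I]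
  exact ⟨by module, by module⟩

/-- `D = S + iT` and `D' = S - iT` hold on the subspace `Dom S ∩ Dom T = Dom D ∩ Dom D'`. -/
structure IsCartesian (D D' S T : E →ₗ.[ℂ] E) : Prop where
  of_parts : ∀ {x s t}, (x, s) ∈ S.graph → (x, t) ∈ T.graph →
    (x, s + I • t) ∈ D.graph ∧ (x, s - I • t) ∈ D'.graph
  parts : ∀ {x d d'}, (x, d) ∈ D.graph → (x, d') ∈ D'.graph →
    (x, (1 / 2 : ℂ) • (d + d')) ∈ S.graph ∧ (x, (-I / 2 : ℂ) • (d - d')) ∈ T.graph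

namespace IsCartesian

variable {D D' S T : E →ₗ.[ℂ] E} (h : IsCartesian D D' S T)
include h

/-- Passing from `D` to its adjoint changes the sign of the imaginary part, hence exchanges the two
Wick rotations. -/
theorem swap : IsCartesian D' D S (-T) := by
  refine ⟨fun {x s t} hs ht => ?_, fun {x d d'} hd hd' => ?_⟩
  · obtain ⟨h1, h2⟩ := h.of_parts hs (mem_graph_neg.mp ht)
    rw [smul_neg] at h1 h2
    rw [sub_neg_eq_add] at h2
    exact ⟨h2, by rwa [← sub_eq_add_neg] at h1⟩
  · obtain ⟨h1, h2⟩ := h.parts hd' hd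
    refine ⟨by rwa [add_comm], mem_graph_neg.mpr ?_⟩
    convert h2 using 2
    module

theorem domain_eq : D.domain ⊓ D'.domain = S.domain ⊓ T.domain := by
  ext x
  constructor
  · rintro ⟨h1, h2⟩
    obtain ⟨d, hd⟩ := exists_mem_graph h1
    obtain ⟨d', hd'⟩ := exists_mem_graph h2
    obtain ⟨h3, h4⟩ := h.parts hd hd'
    exact ⟨LinearPMap.mem_domain_of_mem_graph h3, LinearPMap.mem_domain_of_mem_graph h4⟩
  · rintro ⟨h1, h2⟩
    obtain ⟨s, hs⟩ := exists_mem_graph h1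
    obtain ⟨t, ht⟩ := exists_mem_graph h2
    obtain ⟨h3, h4⟩ := h.of_parts hs ht
    exact ⟨LinearPMap.mem_domain_of_mem_graph h3, LinearPMap.mem_domain_of_mem_graph h4⟩

theorem exists_parts {x d d' : E} (hd : (x, d) ∈ D.graph) (hd' : (x, d') ∈ D'.graph) :
    ∃ s t, (x, s) ∈ S.graph ∧ (x, t) ∈ T.graph ∧ d = s + I • t ∧ d' = s - I • t := by
  obtain ⟨h1, h2⟩ := h.parts hd hd'
  obtain ⟨e1, e2⟩ := eq_add_I_smul d d'
  exact ⟨_, _, h1, h2, e1, e2⟩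

variable [CompleteSpace E] {C : ℝ} (hS : IsSelfAdjointRel B S.graph)
  (hT : IsSelfAdjointRel B T.graph) (hST : IsAlmostCommRel (-1) S.graph T.graph C)
include hS hT hST

/-- The two inner products on `Dom S ∩ Dom T` differ by a bounded anticommutator term, which is
represented by solving `h + 2 (S + T)² h = k`. -/
theorem isCompactOnDomains_add (hST' : IsAlmostAnticommuting B (S + T) 0) {K : E →ₗ[ℂ] E}
    (hK : IsCompactOnDomains B D D' K) : IsCompactOnDomains B (S + T) (S + T) K := by
  have hC := hST.nonneg
  obtain ⟨C', hC'⟩ := hST'.exists_isAlmostCommRel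
  refine hK.of_representable (M := 4 * C + 10) ?_ (by positivity) ?_ ?_
  · rw [h.domain_eq]
    exact inf_le_left
  · intro x d d' p q hd hd' hp hq
    obtain ⟨s, t, hs, ht, rfl, rfl⟩ := h.exists_parts hd hd'
    obtain rfl : p = s + t :=
      LinearPMap.mem_graph_snd_inj _ hp (mem_graph_add.mpr ⟨s, t, hs, ht, rfl⟩) rfl
    obtain ⟨h1, h2⟩ := hST.norm_le_sum hS hT hs ht
    have h3 := norm_add_le s (I • t)
    have h4 := norm_sub_le s (I • t)
    rw [norm_smul, norm_I, one_mul] at h3 h4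
    have := norm_nonneg q
    have := norm_nonneg (s + t)
    have := norm_nonneg x
    nlinarith [mul_nonneg hC (norm_nonneg q), mul_nonneg hC (norm_nonneg (s + t))]
  · intro x d d' hd hd'
    obtain ⟨s, t, hs, ht, rfl, rfl⟩ := h.exists_parts hd hd'
    obtain ⟨k, -, hk⟩ := hST.exists_anticommutator hS hT hs ht
    obtain ⟨y, p, q, hp, hq, hy⟩ := hC'.exists_form_solution hST'.isSelfAdjointRel_left
      hST'.isSelfAdjointRel_right k
    have hst := mem_graph_add.mpr ⟨s, t, hs, ht, rfl⟩
    have hr := (S + T).graph.sub_mem hst ((S + T).graph.smul_mem (2 : ℂ) hp)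
    refine ⟨x - (2 : ℂ) • y, s + t - (2 : ℂ) • p, s + t - (2 : ℂ) • p, hr, hr, ?_⟩
    intro z a b a' b' ha hb ha' hb'
    obtain ⟨s', t', hs', ht', rfl, rfl⟩ := h.exists_parts ha hb
    obtain rfl : a' = s' + t' :=
      LinearPMap.mem_graph_snd_inj _ ha' (mem_graph_add.mpr ⟨s', t', hs', ht', rfl⟩) rfl
    obtain rfl : b' = s' + t' :=
      LinearPMap.mem_graph_snd_inj _ hb' (mem_graph_add.mpr ⟨s', t', hs', ht', rfl⟩) rfl
    have e1 := hk z s' t' hs' ht'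
    have e2 := hy z _ 0 ha' (mem_graph_zero.mpr rfl)
    rw [← e2] at e1
    simp only [rinner_add_left, rinner_add_right, rinner_sub_left, rinner_sub_right,
      rinner_csmul_left, rinner_csmul_right, rinner_zero_right, conj_I, smul_smul, mul_neg,
      I_mul_I, map_ofNat, smul_add, smul_sub, add_zero] at e1 ⊢
    have e3 := (congrArg (fun b : B => (-2 : ℂ) • b) (sub_eq_zero.mpr e1)).trans (smul_zero _)
    refine sub_eq_zero.mp (Eq.trans ?_ e3)
    module

/-- The converse of `isCompactOnDomains_add`; the bounded term is represented by solving
`h + 2 S² h + 2 T² h = k` in the weak sense. -/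
theorem isCompactOnDomains_of_add {K : E →ₗ[ℂ] E}
    (hK : IsCompactOnDomains B (S + T) (S + T) K) : IsCompactOnDomains B D D' K := by
  refine hK.of_representable (M := 2) ?_ (by positivity) ?_ ?_
  · rw [h.domain_eq]
    exact le_inf le_rfl le_rfl
  · intro x p q d d' hp hq hd hd'
    obtain ⟨h1, h2⟩ := h.parts hd hd'
    have e := mem_graph_add.mpr ⟨_, _, h1, h2, rfl⟩
    rw [LinearPMap.mem_graph_snd_inj _ hp e rfl, LinearPMap.mem_graph_snd_inj _ hq e rfl]
    have n0 := norm_add_le ((1 / 2 : ℂ) • (d + d')) ((-I / 2 : ℂ) • (d - d'))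
    rw [norm_smul, norm_smul, show ‖(1 / 2 : ℂ)‖ = 1 / 2 by norm_num,
      show ‖(-I / 2 : ℂ)‖ = 1 / 2 by norm_num] at n0
    have n1 := norm_add_le d d'
    have n2 := norm_sub_le d d'
    have := norm_nonneg x
    linarith
  · intro x p q hp hq
    obtain ⟨s, t, hs, ht, rfl⟩ := mem_graph_add.mp hp
    obtain rfl : q = s + t := LinearPMap.mem_graph_snd_inj _ hq hp rfl
    obtain ⟨k, -, hk⟩ := hST.exists_anticommutator hS hT hs ht
    obtain ⟨y, s₀, t₀, hs₀, ht₀, hy⟩ := hST.exists_form_solution hS hT k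
    have h1 : (x + (2 : ℂ) • y, s + (2 : ℂ) • s₀) ∈ S.graph :=
      S.graph.add_mem hs (S.graph.smul_mem (2 : ℂ) hs₀)
    have h2 : (x + (2 : ℂ) • y, t + (2 : ℂ) • t₀) ∈ T.graph :=
      T.graph.add_mem ht (T.graph.smul_mem (2 : ℂ) ht₀)
    obtain ⟨h3, h4⟩ := h.of_parts h1 h2
    refine ⟨_, _, _, h3, h4, ?_⟩
    intro z a b a' b' ha hb ha' hb'
    obtain ⟨s', t', hs', ht', rfl, rfl⟩ := h.exists_parts ha' hb'
    obtain rfl : a = s' + t' :=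
      LinearPMap.mem_graph_snd_inj _ ha (mem_graph_add.mpr ⟨s', t', hs', ht', rfl⟩) rfl
    obtain rfl : b = s' + t' :=
      LinearPMap.mem_graph_snd_inj _ hb (mem_graph_add.mpr ⟨s', t', hs', ht', rfl⟩) rfl
    have e1 := hk z s' t' hs' ht'
    rw [← hy z s' t' hs' ht'] at e1
    simp only [rinner_add_left, rinner_add_right, rinner_sub_left, rinner_sub_right,
      rinner_csmul_left, rinner_csmul_right, conj_I, smul_smul, mul_neg,
      I_mul_I, map_mul, map_ofNat, smul_add, smul_sub] at e1 ⊢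
    have e3 := (congrArg (fun b : B => (2 : ℂ) • b) (sub_eq_zero.mpr e1)).trans (smul_zero _)
    refine sub_eq_zero.mp (Eq.trans ?_ e3)
    match_scalars <;> (ring_nf; try simp; try norm_num)

end IsCartesian

end Cartesian

/-! ### Real and imaginary parts -/

section Parts

variable {B : Type v} [NonUnitalCStarAlgebra B] [PartialOrder B] [StarOrderedRing B]
  {E : Type w} [NormedAddCommGroup E] [NormedSpace ℂ E] [SMul Bᵐᵒᵖ E] [CStarModule Bᵐᵒᵖ E]

omit [StarOrderedRing B] in
theorem mem_graph_half_add {D D' : E →ₗ.[ℂ] E} {x z : E} :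
    (x, z) ∈ ((1 / 2 : ℂ) • (D + D')).graph ↔
      ∃ d d', (x, d) ∈ D.graph ∧ (x, d') ∈ D'.graph ∧ z = (1 / 2 : ℂ) • (d + d') := by
  rw [mem_graph_smul]
  simp only [mem_graph_add]
  constructor
  · rintro ⟨_, ⟨d, d', hd, hd', rfl⟩, rfl⟩
    exact ⟨d, d', hd, hd', rfl⟩
  · rintro ⟨d, d', hd, hd', rfl⟩
    exact ⟨_, ⟨d, d', hd, hd', rfl⟩, rfl⟩

theorem mem_graph_smul_sub {D D' : E →ₗ.[ℂ] E} {c : ℂ} {x z : E} :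
    (x, z) ∈ (c • (D - D')).graph ↔
      ∃ d d', (x, d) ∈ D.graph ∧ (x, d') ∈ D'.graph ∧ z = c • (d - d') := by
  rw [mem_graph_smul]
  simp only [mem_graph_sub]
  constructor
  · rintro ⟨_, ⟨d, d', hd, hd', rfl⟩, rfl⟩
    exact ⟨d, d', hd, hd', rfl⟩
  · rintro ⟨d, d', hd, hd', rfl⟩
    exact ⟨_, ⟨d, d', hd, hd', rfl⟩, rfl⟩

/-- A closed symmetric operator is the closure of any essentially self-adjoint restriction. -/
theorem IsEssentiallySelfAdjointOn.hasCore {T : E →ₗ.[ℂ] E} (hcl : T.IsClosed)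
    (hT : ∀ p ∈ T.graph, ∀ q ∈ T.graph, rinner B p.2 q.1 = rinner B p.1 q.2) {𝓔 : Submodule ℂ E}
    (h : IsEssentiallySelfAdjointOn B T 𝓔) : T.HasCore 𝓔 := by
  refine ⟨h.1, le_antisymm (closure_le_of_le hcl LinearPMap.domRestrict_le) ?_⟩
  have hle := closure_le_of_le hcl (show T.domRestrict 𝓔 ≤ T from LinearPMap.domRestrict_le)
  refine LinearPMap.le_of_le_graph fun p hp => ?_
  rw [← h.2.2, mem_graph_adjoint_iff h.2.1]
  exact fun q hq => hT q (LinearPMap.le_graph_of_le hle hq) p hp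

omit [StarOrderedRing B] in
/-- Self-adjoint operators have no proper self-adjoint extensions. -/
theorem eq_of_le_of_isSelfAdjointRel {f g : E →ₗ.[ℂ] E} (hle : f ≤ g)
    (hf : IsSelfAdjointRel B f.graph) (hg : IsSelfAdjointRel B g.graph) : f = g :=
  le_antisymm hle <| LinearPMap.le_of_le_graph fun p hp =>
    hf.mem_of_adjoint fun q hq => hg.symm q (LinearPMap.le_graph_of_le hle hq) p hp

omit [StarOrderedRing B] in
theorem IsCartesian.rePart_eq {D S T : E →ₗ.[ℂ] E} (h : IsCartesian D (adjoint B D) S T)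
    (hS : S.IsClosed) (hc : S.HasCore (S.domain ⊓ T.domain)) : rePart B D = S := by
  refine closure_eq_of_core hS hc (fun x y hx hxy => ?_) (LinearPMap.le_of_le_graph ?_)
  · obtain ⟨t, ht⟩ := exists_mem_graph hx.2
    obtain ⟨h1, h2⟩ := h.of_parts hxy ht
    exact mem_graph_half_add.mpr ⟨_, _, h1, h2, by module⟩
  · rintro ⟨x, z⟩ hxz
    obtain ⟨d, d', hd, hd', rfl⟩ := mem_graph_half_add.mp hxz
    exact (h.parts hd hd').1

omit [StarOrderedRing B] in
theorem IsCartesian.imPart_eq {D S T : E →ₗ.[ℂ] E} (h : IsCartesian D (adjoint B D) S T)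
    (hT : T.IsClosed) (hc : T.HasCore (S.domain ⊓ T.domain)) : imPart B D = T := by
  refine closure_eq_of_core hT hc (fun x y hx hxy => ?_) (LinearPMap.le_of_le_graph ?_)
  · obtain ⟨s, hs⟩ := exists_mem_graph hx.1
    obtain ⟨h1, h2⟩ := h.of_parts hs hxy
    refine mem_graph_smul_sub.mpr ⟨_, _, h1, h2, ?_⟩
    rw [show s + I • y - (s - I • y) = (2 * I) • y by module, smul_smul,
      show -I / 2 * (2 * I) = 1 by linear_combination -I_mul_I, one_smul]
  · rintro ⟨x, z⟩ hxz
    obtain ⟨d, d', hd, hd', rfl⟩ := mem_graph_smul_sub.mp hxz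
    exact (h.parts hd hd').2

/-- The real and imaginary part recover a regular operator and its adjoint on the joint domain,
as soon as that contains a core for both. -/
theorem isCartesian_rePart_imPart [CompleteSpace E] {D : E →ₗ.[ℂ] E} (hD : IsRegular B D)
    {𝓔 : Submodule ℂ E} (h𝓔 : 𝓔 ≤ D.domain ⊓ (adjoint B D).domain) (hc : D.HasCore 𝓔)
    (hc' : (adjoint B D).HasCore 𝓔) (hS : IsSelfAdjointRel B (rePart B D).graph)
    (hT : IsSelfAdjointRel B (imPart B D).graph) :
    IsCartesian D (adjoint B D) (rePart B D) (imPart B D) := by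
  have hrel := hD.isSelfAdjointRel
  have hparts : ∀ {x d d'}, (x, d) ∈ D.graph → (x, d') ∈ (adjoint B D).graph →
      (x, (1 / 2 : ℂ) • (d + d')) ∈ (rePart B D).graph ∧
      (x, (-I / 2 : ℂ) • (d - d')) ∈ (imPart B D).graph := fun {x d d'} hd hd' =>
    ⟨LinearPMap.le_graph_of_le (LinearPMap.le_closure _)
        (mem_graph_half_add.mpr ⟨d, d', hd, hd', rfl⟩),
      LinearPMap.le_graph_of_le (LinearPMap.le_closure _)
        (mem_graph_smul_sub.mpr ⟨d, d', hd, hd', rfl⟩)⟩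
  have hD' : (adjoint B D).IsClosed := by
    have := (isRegular_of_isSelfAdjointRel_offDiagRel (isRightInvariant_adjoint hD.dense)
      hrel.offDiagRel_swap).1
    exact this.closed
  refine ⟨fun {x s t} hs ht => ⟨?_, ?_⟩, hparts⟩
  · refine hrel.mem_fst_of_adjoint fun q hq => ?_
    have hcl : IsClosed {q : E × E | rinner B q.2 x = rinner B q.1 (s + I • t)} :=
      isClosed_eq (Continuous.rinner' B (by fun_prop) (by fun_prop))
        (Continuous.rinner' B (by fun_prop) (by fun_prop))
    refine graph_subset_of_hasCore hD' hc' hcl (fun y d' hy hd' => ?_) hq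
    obtain ⟨d, hd⟩ := exists_mem_graph (h𝓔 hy).1
    obtain ⟨h1, h2⟩ := hparts hd hd'
    have e1 := hS.symm _ h1 _ hs
    have e2 := hT.symm _ h2 _ ht
    simp only at e1 e2
    change rinner B d' x = rinner B y (s + I • t)
    have ed := (eq_add_I_smul d d').2
    generalize (1 / 2 : ℂ) • (d + d') = σ at e1 ed
    generalize (-I / 2 : ℂ) • (d - d') = τ at e2 ed
    rw [ed, rinner_sub_left, rinner_csmul_left, conj_I, e1, e2, rinner_add_right,
      rinner_csmul_right]
    module
  · refine hrel.mem_snd_of_adjoint fun q hq => ?_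
    have hcl : IsClosed {q : E × E | rinner B q.2 x = rinner B q.1 (s - I • t)} :=
      isClosed_eq (Continuous.rinner' B (by fun_prop) (by fun_prop))
        (Continuous.rinner' B (by fun_prop) (by fun_prop))
    refine graph_subset_of_hasCore hD.closed hc hcl (fun y d hy hd => ?_) hq
    obtain ⟨d', hd'⟩ := exists_mem_graph (h𝓔 hy).2
    obtain ⟨h1, h2⟩ := hparts hd hd'
    have e1 := hS.symm _ h1 _ hs
    have e2 := hT.symm _ h2 _ ht
    simp only at e1 e2
    change rinner B d x = rinner B y (s - I • t)
    have ed := (eq_add_I_smul d d').1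
    generalize (1 / 2 : ℂ) • (d + d') = σ at e1 ed
    generalize (-I / 2 : ℂ) • (d - d') = τ at e2 ed
    rw [ed, rinner_add_left, rinner_csmul_left, conj_I, e1, e2, rinner_sub_right,
      rinner_csmul_right]
    module

/-- If `[[0, G'], [G, 0]]` is self-adjoint, then `G` is the graph of an operator. -/
theorem IsSelfAdjointRel.graph_toLinearPMap {G G' : Submodule ℂ (E × E)}
    (h : IsSelfAdjointRel B (offDiagRel B G G')) : G.toLinearPMap.graph = G := by
  refine Submodule.toLinearPMap_graph_eq _ fun p hp h0 => ?_
  refine eq_zero_of_dense B h.offDiagRel_swap.dense_fst ?_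
  rintro x ⟨y, hy⟩
  have := congrArg star (h.adjoint_eq hp hy)
  rwa [h0, rinner_zero_left, star_zero, star_rinner] at this

/-- The closure of `S + iT` is regular with real part `S` and imaginary part `T`. -/
theorem IsAlmostAnticommuting.isRegular_closure_add_I [CompleteSpace E] {S T R : E →ₗ.[ℂ] E}
    (h : IsAlmostAnticommuting B S T) (hcS : S.HasCore (S.domain ⊓ T.domain))
    (hcT : T.HasCore (S.domain ⊓ T.domain)) (hR : R.graph = combRel 1 I S.graph T.graph) :
    IsRegular B R.closure ∧ IsCartesian R.closure (adjoint B R.closure) S T ∧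
      R.closure.HasCore (S.domain ⊓ T.domain) ∧
      (adjoint B R.closure).HasCore (S.domain ⊓ T.domain) := by
  obtain ⟨hSinv, hS⟩ := isRegular_and_isSelfAdjointOp_iff.mp ⟨h.regular_left, h.selfAdjoint_left⟩
  obtain ⟨hTinv, hT⟩ := isRegular_and_isSelfAdjointOp_iff.mp ⟨h.regular_right, h.selfAdjoint_right⟩
  obtain ⟨C, hST⟩ := h.exists_isAlmostCommRel
  have hrel := hST.isSelfAdjointRel_add_I hS hT
  have g1 := hrel.graph_toLinearPMap
  have g2 := hrel.offDiagRel_swap.graph_toLinearPMap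
  have hcl : R.closure.graph = (combRel 1 I S.graph T.graph).topologicalClosure := by
    rw [← hR]
    refine (LinearPMap.IsClosable.graph_closure_eq_closure_graph
      ⟨_, Eq.trans ?_ g1.symm⟩).symm
    rw [hR]
  have hrel' := hrel
  rw [← hcl] at hrel'
  nth_rewrite 1 [← g2] at hrel'
  obtain ⟨hreg, hadj⟩ := isRegular_of_isSelfAdjointRel_offDiagRel
    (hcl ▸ (hSinv.combRel hTinv).topologicalClosure) hrel'
  have hreg' := (isRegular_of_isSelfAdjointRel_offDiagRel
    (by rw [g2]; exact (hSinv.combRel hTinv).topologicalClosure) hrel'.offDiagRel_swap).1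
  rw [← hadj] at g2 hrel' hreg'
  have hof : ∀ {x s t}, (x, s) ∈ S.graph → (x, t) ∈ T.graph →
      (x, s + I • t) ∈ R.closure.graph ∧ (x, s - I • t) ∈ (adjoint B R.closure).graph := by
    intro x s t hs ht
    rw [hcl, g2]
    exact ⟨Submodule.le_topologicalClosure _ ⟨s, t, hs, ht, by rw [one_smul]⟩,
      Submodule.le_topologicalClosure _ ⟨s, t, hs, ht, by simp [sub_eq_add_neg]⟩⟩
  refine ⟨hreg, ⟨hof, fun {x d d'} hd hd' => ⟨?_, ?_⟩⟩, ?_, ?_⟩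
  · refine hS.mem_of_adjoint fun q hq => ?_
    have hcl : IsClosed {q : E × E | rinner B q.2 x = rinner B q.1 ((1 / 2 : ℂ) • (d + d'))} :=
      isClosed_eq (Continuous.rinner' B (by fun_prop) (by fun_prop))
        (Continuous.rinner' B (by fun_prop) (by fun_prop))
    refine graph_subset_of_hasCore h.regular_left.closed hcS hcl (fun y s hy hs => ?_) hq
    obtain ⟨t, ht⟩ := exists_mem_graph hy.2
    obtain ⟨h1, h2⟩ := hof hs ht
    have e1 := hrel'.adjoint_eq h1 hd'
    have e2 := hrel'.offDiagRel_swap.adjoint_eq h2 hd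
    change rinner B s x = rinner B y ((1 / 2 : ℂ) • (d + d'))
    simp only at e1 e2
    rw [rinner_csmul_right, rinner_add_right, ← e1, ← e2]
    simp only [rinner_add_left, rinner_sub_left]
    module
  · refine hT.mem_of_adjoint fun q hq => ?_
    have hcl : IsClosed {q : E × E | rinner B q.2 x = rinner B q.1 ((-I / 2 : ℂ) • (d - d'))} :=
      isClosed_eq (Continuous.rinner' B (by fun_prop) (by fun_prop))
        (Continuous.rinner' B (by fun_prop) (by fun_prop))
    refine graph_subset_of_hasCore h.regular_right.closed hcT hcl (fun y t hy ht => ?_) hq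
    obtain ⟨s, hs⟩ := exists_mem_graph hy.1
    obtain ⟨h1, h2⟩ := hof hs ht
    have e1 := hrel'.adjoint_eq h1 hd'
    have e2 := hrel'.offDiagRel_swap.adjoint_eq h2 hd
    change rinner B t x = rinner B y ((-I / 2 : ℂ) • (d - d'))
    simp only at e1 e2
    rw [rinner_csmul_right, rinner_sub_right, ← e1, ← e2]
    simp only [rinner_add_left, rinner_sub_left, rinner_csmul_left, conj_I, smul_add, smul_sub,
      smul_smul]
    have hI : -I / 2 * -I = -(1 / 2) := by linear_combination (1 / 2 : ℂ) * I_mul_I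
    rw [hI]
    module
  · rw [hasCore_iff hreg.closed]
    refine ⟨fun x hx => ?_, le_antisymm ?_ (Submodule.topologicalClosure_minimal _
      (LinearPMap.le_graph_of_le LinearPMap.domRestrict_le) hreg.closed)⟩
    · obtain ⟨s, hs⟩ := exists_mem_graph hx.1
      obtain ⟨t, ht⟩ := exists_mem_graph hx.2
      exact LinearPMap.mem_domain_of_mem_graph (hof hs ht).1
    · rw [hcl]
      refine Submodule.topologicalClosure_mono ?_
      rintro ⟨x, y⟩ hxy
      refine mem_graph_domRestrict.mpr ⟨?_, hcl ▸ Submodule.le_topologicalClosure _ hxy⟩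
      obtain ⟨s, t, hs, ht, -⟩ := hxy
      exact ⟨LinearPMap.mem_domain_of_mem_graph hs, LinearPMap.mem_domain_of_mem_graph ht⟩
  · rw [hasCore_iff hreg'.closed]
    refine ⟨fun x hx => ?_, le_antisymm ?_ (Submodule.topologicalClosure_minimal _
      (LinearPMap.le_graph_of_le LinearPMap.domRestrict_le) hreg'.closed)⟩
    · obtain ⟨s, hs⟩ := exists_mem_graph hx.1
      obtain ⟨t, ht⟩ := exists_mem_graph hx.2
      exact LinearPMap.mem_domain_of_mem_graph (hof hs ht).2
    · rw [g2]
      refine Submodule.topologicalClosure_mono ?_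
      rintro ⟨x, y⟩ hxy
      refine mem_graph_domRestrict.mpr ⟨?_, g2 ▸ Submodule.le_topologicalClosure _ hxy⟩
      obtain ⟨s, t, hs, ht, -⟩ := hxy
      exact ⟨LinearPMap.mem_domain_of_mem_graph hs, LinearPMap.mem_domain_of_mem_graph ht⟩

/-- For `D₁ = S + T` and `D₂ = S - T`, the operator whose closure is the reverse Wick rotation
is `S + iT`. -/
theorem graph_reverseWick_add_sub (S T : E →ₗ.[ℂ] E) :
    ((1 / 2 : ℂ) • ((S + T) + (S - T)) + (I / 2 : ℂ) • ((S + T) - (S - T))).graph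
      = combRel 1 I S.graph T.graph := by
  ext ⟨x, y⟩
  rw [mem_graph_add]
  simp only [mem_graph_half_add, mem_graph_smul_sub, mem_graph_add, mem_graph_sub, mem_combRel]
  constructor
  · rintro ⟨_, _, ⟨_, _, ⟨s, t, hs, ht, rfl⟩, ⟨s', t', hs', ht', rfl⟩, rfl⟩,
      ⟨_, _, ⟨a, b, ha, hb, rfl⟩, ⟨a', b', ha', hb', rfl⟩, rfl⟩, rfl⟩
    obtain rfl := LinearPMap.mem_graph_snd_inj _ hs' hs rfl
    obtain rfl := LinearPMap.mem_graph_snd_inj _ ha hs rfl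
    obtain rfl := LinearPMap.mem_graph_snd_inj _ ha' ha rfl
    obtain rfl := LinearPMap.mem_graph_snd_inj _ ht' ht rfl
    obtain rfl := LinearPMap.mem_graph_snd_inj _ hb ht rfl
    obtain rfl := LinearPMap.mem_graph_snd_inj _ hb' hb rfl
    exact ⟨_, _, hs, ht, by module⟩
  · rintro ⟨s, t, hs, ht, rfl⟩
    exact ⟨_, _, ⟨_, _, ⟨s, t, hs, ht, rfl⟩, ⟨s, t, hs, ht, rfl⟩, rfl⟩,
      ⟨_, _, ⟨s, t, hs, ht, rfl⟩, ⟨s, t, hs, ht, rfl⟩, rfl⟩, by module⟩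

/-- The sum of `S + T` and `S - T` has closure `2 S`, provided that `Dom S ∩ Dom T` is a core
for `S`. -/
theorem closure_add_add_sub {S T : E →ₗ.[ℂ] E} (hc : S.HasCore (S.domain ⊓ T.domain))
    (hS : S.IsClosed) (h2 : ((2 : ℂ) • S).IsClosed) :
    ((S + T) + (S - T)).closure = (2 : ℂ) • S := by
  have hdbl : ∀ s t : E, s + t + (s - t) = (2 : ℂ) • s := fun s t => by module
  refine LinearPMap.eq_of_eq_graph (le_antisymm ?_ ?_)
  · refine LinearPMap.le_graph_of_le (closure_le_of_le h2 (LinearPMap.le_of_le_graph ?_))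
    rintro ⟨x, y⟩ hxy
    obtain ⟨_, _, hst, hst', rfl⟩ := mem_graph_add.mp hxy
    obtain ⟨s, t, hs, ht, rfl⟩ := mem_graph_add.mp hst
    obtain ⟨s', t', hs', ht', rfl⟩ := mem_graph_sub.mp hst'
    obtain rfl := LinearPMap.mem_graph_snd_inj _ hs' hs rfl
    obtain rfl := LinearPMap.mem_graph_snd_inj _ ht' ht rfl
    exact mem_graph_smul.mpr ⟨_, hs, hdbl _ _⟩
  · have hc2 := LinearPMap.HasCore.smul hS h2 hc
    have hle : (S + T) + (S - T) ≤ (2 : ℂ) • S := by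
      refine LinearPMap.le_of_le_graph ?_
      rintro ⟨x, y⟩ hxy
      obtain ⟨_, _, hst, hst', rfl⟩ := mem_graph_add.mp hxy
      obtain ⟨s, t, hs, ht, rfl⟩ := mem_graph_add.mp hst
      obtain ⟨s', t', hs', ht', rfl⟩ := mem_graph_sub.mp hst'
      obtain rfl := LinearPMap.mem_graph_snd_inj _ hs' hs rfl
      obtain rfl := LinearPMap.mem_graph_snd_inj _ ht' ht rfl
      exact mem_graph_smul.mpr ⟨_, hs, hdbl _ _⟩
    refine graph_subset_of_hasCore h2 hc2
      (h2.isClosable.leIsClosable hle).closure_isClosed fun x y hx hxy => ?_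
    obtain ⟨s, hs, rfl⟩ := mem_graph_smul.mp hxy
    obtain ⟨t, ht⟩ := exists_mem_graph hx.2
    refine LinearPMap.le_graph_of_le (LinearPMap.le_closure _) ?_
    exact mem_graph_add.mpr ⟨_, _, mem_graph_add.mpr ⟨s, t, hs, ht, rfl⟩,
      mem_graph_sub.mpr ⟨s, t, hs, ht, rfl⟩, (hdbl _ _).symm⟩

omit [StarOrderedRing B] in
theorem combinedNorm_sub_self_lt {S T : E →ₗ.[ℂ] E} (ψ : ↥(S.domain ⊓ T.domain)) {ε : ℝ}
    (hε : 0 < ε) : combinedNorm B S T (ψ - ψ) < ε := by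
  have h : combinedNorm B S T (ψ - ψ) ≤ _ := combinedNorm_le (p := 0) (q := 0)
    (by rw [sub_self]; exact S.graph.zero_mem) (by rw [sub_self]; exact T.graph.zero_mem)
  refine h.trans_lt ?_
  simpa using hε

omit [StarOrderedRing B] in
theorem IsSelfAdjointOp.rePart_eq {D : E →ₗ.[ℂ] E}
    (hD : adjoint B D = D) (hcl : D.IsClosed) : rePart B D = D := by
  rw [rePart, hD]
  refine closure_eq_of_core hcl (hasCore_domain hcl) (fun x y _ hxy => ?_)
    (LinearPMap.le_of_le_graph ?_)
  · exact mem_graph_half_add.mpr ⟨y, y, hxy, hxy, by module⟩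
  · rintro ⟨x, z⟩ hxz
    obtain ⟨d, d', hd, hd', rfl⟩ := mem_graph_half_add.mp hxz
    obtain rfl := LinearPMap.mem_graph_snd_inj _ hd' hd rfl
    rwa [show (1 / 2 : ℂ) • (d' + d') = d' by module]

omit [StarOrderedRing B] in
theorem IsSelfAdjointOp.imPart_eq {D : E →ₗ.[ℂ] E}
    (hD : IsSelfAdjointOp B D) : imPart B D = 0 := by
  rw [imPart, hD.2]
  refine closure_eq_of_core isClosed_zero (hasCore_zero hD.1) (fun x y hx hxy => ?_)
    (LinearPMap.le_of_le_graph ?_)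
  · obtain rfl := mem_graph_zero.mp hxy
    obtain ⟨d, hd⟩ := exists_mem_graph hx
    exact mem_graph_smul_sub.mpr ⟨d, d, hd, hd, by rw [sub_self, smul_zero]⟩
  · rintro ⟨x, z⟩ hxz
    obtain ⟨d, d', hd, hd', rfl⟩ := mem_graph_smul_sub.mp hxz
    obtain rfl := LinearPMap.mem_graph_snd_inj _ hd' hd rfl
    rw [sub_self, smul_zero]
    exact mem_graph_zero.mpr rfl

omit [StarOrderedRing B] in
theorem _root_.LinearPMap.HasCore.isEssentiallySelfAdjointOn {D : E →ₗ.[ℂ] E}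
    {𝓔 : Submodule ℂ E} (hc : D.HasCore 𝓔) (hD : IsSelfAdjointOp B D) :
    IsEssentiallySelfAdjointOn B D 𝓔 :=
  ⟨hc.1, by rwa [hc.2]⟩

end Parts

/-! ### Kasparov modules -/

section KasparovModules

variable {A : Type u} {B : Type v} [NonUnitalCStarAlgebra A] [NonUnitalCStarAlgebra B]
  [PartialOrder B] [StarOrderedRing B] [Z2Graded A] [Z2Graded B]
  {X : KasparovBimodule.{u, v, w} A B}

omit [StarOrderedRing B] in
theorem KasparovBimodule.isAdjointable_π (X : KasparovBimodule.{u, v, w} A B) (a : A) :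
    IsAdjointable B (X.π a) := ⟨X.π (star a), X.π_star a⟩

theorem KasparovBimodule.continuous_π (X : KasparovBimodule.{u, v, w} A B) (a : A) :
    Continuous (X.π a) := (X.isAdjointable_π a).continuous

omit [PartialOrder B] [StarOrderedRing B] in
theorem norm_grading (b : B) : ‖(Z2Graded.grading b : B)‖ = ‖b‖ :=
  NonUnitalStarAlgHom.norm_map (Z2Graded.grading (A := B)) (Z2Graded.grading (A := B)).injective b

omit [StarOrderedRing B] in
theorem KasparovBimodule.norm_γ (X : KasparovBimodule.{u, v, w} A B) (x : X.E) : ‖X.γ x‖ = ‖x‖ := by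
  have h := norm_rinner_self (B := B) (X.γ x)
  rw [X.γ_inner, norm_grading, norm_rinner_self] at h
  exact ((sq_eq_sq₀ (norm_nonneg _) (norm_nonneg _)).mp h).symm

omit [StarOrderedRing B] in
theorem KasparovBimodule.continuous_γ (X : KasparovBimodule.{u, v, w} A B) : Continuous X.γ :=
  AddMonoidHomClass.continuous_of_bound X.γ 1 fun x => by rw [X.norm_γ, one_mul]

/-- `G` is the graph of an odd operator. -/
def IsOddRel (X : KasparovBimodule.{u, v, w} A B) (G : Submodule ℂ (X.E × X.E)) : Prop :=
  ∀ x y, (x, y) ∈ G → (X.γ x, -X.γ y) ∈ G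

omit [StarOrderedRing B] in
theorem IsOddRel.topologicalClosure {G : Submodule ℂ (X.E × X.E)} (h : IsOddRel X G) :
    IsOddRel X G.topologicalClosure := by
  intro x y hxy
  have hc : Continuous fun p : X.E × X.E => (X.γ p.1, -X.γ p.2) := by
    have := X.continuous_γ
    fun_prop
  exact map_mem_closure (f := fun p : X.E × X.E => (X.γ p.1, -X.γ p.2)) hc hxy
    fun p hp => h _ _ hp

omit [StarOrderedRing B] in
theorem IsOddRel.combRel {a b : ℂ} {S T : Submodule ℂ (X.E × X.E)} (hS : IsOddRel X S)
    (hT : IsOddRel X T) : IsOddRel X (combRel a b S T) := by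
  rintro x y ⟨s, t, hs, ht, hy⟩
  refine ⟨_, _, hS _ _ hs, hT _ _ ht, ?_⟩
  simp only at hy ⊢
  rw [hy, map_add, map_smul, map_smul]
  module

theorem isOddRel_adjoint {D : X.E →ₗ.[ℂ] X.E} (hD : Dense (D.domain : Set X.E))
    (h : IsOddRel X D.graph) : IsOddRel X (adjoint B D).graph := by
  intro x y hxy
  rw [mem_graph_adjoint_iff hD] at hxy ⊢
  intro q hq
  have h1 := hxy _ (h _ _ hq)
  have h2 := congrArg Z2Graded.grading h1
  rw [← X.γ_inner, ← X.γ_inner, map_neg, X.γ_γ, X.γ_γ, rinner_neg_left] at h2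
  change rinner B q.2 (X.γ x) = rinner B q.1 (-X.γ y)
  rw [rinner_neg_right, ← h2, neg_neg]

omit [StarOrderedRing B] in
theorem IsOddRel.smul {c : ℂ} {D : X.E →ₗ.[ℂ] X.E} (h : IsOddRel X D.graph) :
    IsOddRel X (c • D).graph := by
  intro x y hxy
  obtain ⟨z, hz, rfl⟩ := mem_graph_smul.mp hxy
  exact mem_graph_smul.mpr ⟨_, h _ _ hz, by rw [map_smul, smul_neg]⟩

omit [StarOrderedRing B] in
theorem IsOddRel.neg {D : X.E →ₗ.[ℂ] X.E} (h : IsOddRel X D.graph) : IsOddRel X (-D).graph := by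
  intro x y hxy
  rw [mem_graph_neg] at hxy ⊢
  have := h _ _ hxy
  rwa [map_neg] at this

omit [StarOrderedRing B] in
theorem HasBoundedCommutators.mono {D : X.E →ₗ.[ℂ] X.E} {𝓔 𝓕 : Submodule ℂ X.E}
    (h : HasBoundedCommutators X D 𝓕) (hle : 𝓔 ≤ 𝓕) : HasBoundedCommutators X D 𝓔 := by
  intro a ha
  obtain ⟨C, hC⟩ := h a ha
  exact ⟨C, fun ψ hψ => hC ψ (hle hψ)⟩

/-- Bounded commutators on a core give bounded commutators on the domain. -/
theorem HasBoundedCommutators.domain {D : X.E →ₗ.[ℂ] X.E} (hD : D.IsClosed) {𝓔 : Submodule ℂ X.E}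
    (hc : D.HasCore 𝓔) (h : HasBoundedCommutators X D 𝓔) : HasBoundedCommutators X D D.domain := by
  intro a ha
  obtain ⟨C, hC⟩ := h a ha
  refine ⟨C, fun x hx => ?_⟩
  obtain ⟨y, hy⟩ := exists_mem_graph hx
  have hxy : (x, y) ∈ closure ((D.domRestrict 𝓔).graph : Set (X.E × X.E)) := by
    rw [← Submodule.topologicalClosure_coe, ← ((hasCore_iff hD).mp hc).2]
    exact hy
  obtain ⟨p, hp, hlim⟩ := mem_closure_iff_seq_limit.mp hxy
  have hp' : ∀ n, (p n).1 ∈ 𝓔 ∧ (p n).1 ∈ 𝓔 ∧ ((p n).1, (p n).2) ∈ D.graph := fun n =>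
    ⟨(mem_graph_domRestrict.mp (hp n)).1, mem_graph_domRestrict.mp (hp n)⟩
  have hval : ∀ ψ y, ψ ∈ 𝓔 → (ψ, y) ∈ D.graph → ∃ z, (X.π a ψ, z) ∈ D.graph ∧
      ‖z - X.π (Z2Graded.grading a) y‖ ≤ C * ‖ψ‖ := fun ψ y hψ hy => by
    obtain ⟨y', z, hy', hz, hle⟩ := hC ψ hψ
    obtain rfl := LinearPMap.mem_graph_snd_inj _ hy' hy rfl
    exact ⟨z, hz, hle⟩
  choose z hz hzle using fun n => hval _ _ (hp' n).1 (hp' n).2.2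
  -- the commutator is linear, so the estimate applies to differences
  have hdiff : ∀ k l, ‖(z k - X.π (Z2Graded.grading a) (p k).2)
      - (z l - X.π (Z2Graded.grading a) (p l).2)‖ ≤ C * ‖(p k).1 - (p l).1‖ := fun k l => by
    obtain ⟨z', hz', hle⟩ := hval _ _ (𝓔.sub_mem (hp' k).1 (hp' l).1)
      (D.graph.sub_mem (hp' k).2.2 (hp' l).2.2)
    have e := D.graph.sub_mem (hz k) (hz l)
    have e' : z' = z k - z l := by
      refine LinearPMap.mem_graph_snd_inj _ hz' e ?_
      rw [map_sub]
    rw [e', map_sub] at hle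
    convert hle using 2
    abel
  have h1 : Tendsto (fun n => (p n).1) atTop (𝓝 x) := (continuous_fst.tendsto _).comp hlim
  have h2 : Tendsto (fun n => X.π (Z2Graded.grading a) (p n).2) atTop
      (𝓝 (X.π (Z2Graded.grading a) y)) :=
    ((X.continuous_π _).tendsto _).comp ((continuous_snd.tendsto _).comp hlim)
  obtain ⟨c, hcl⟩ := cauchySeq_tendsto_of_complete (cauchySeq_of_norm_sub_le C hdiff h1.cauchySeq)
  refine ⟨y, c + X.π (Z2Graded.grading a) y, hy, ?_, ?_⟩
  · have h3 : Tendsto (fun n => (X.π a (p n).1, z n)) atTop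
        (𝓝 (X.π a x, c + X.π (Z2Graded.grading a) y)) := by
      refine (((X.continuous_π a).tendsto _).comp h1).prodMk_nhds ?_
      simpa using hcl.add h2
    exact hD.mem_of_tendsto h3 (Eventually.of_forall hz)
  · rw [add_sub_cancel_right]
    exact le_of_tendsto_of_tendsto hcl.norm (h1.norm.const_mul C) (Eventually.of_forall hzle)

omit [StarOrderedRing B] in
/-- Bounded commutators with `P` and `Q` give bounded commutators with `a P + b Q`, and with any
extension `R` of it. -/
theorem HasBoundedCommutators.comb {P Q R : X.E →ₗ.[ℂ] X.E} {𝓔 : Submodule ℂ X.E}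
    (hP : HasBoundedCommutators X P 𝓔) (hQ : HasBoundedCommutators X Q 𝓔) (a b : ℂ)
    (hR : ∀ {x p q}, (x, p) ∈ P.graph → (x, q) ∈ Q.graph → (x, a • p + b • q) ∈ R.graph) :
    HasBoundedCommutators X R 𝓔 := by
  intro c hc
  obtain ⟨C, hC⟩ := hP c hc
  obtain ⟨C', hC'⟩ := hQ c hc
  refine ⟨‖a‖ * C + ‖b‖ * C', fun ψ hψ => ?_⟩
  obtain ⟨y, z, hy, hz, hle⟩ := hC ψ hψ
  obtain ⟨y', z', hy', hz', hle'⟩ := hC' ψ hψ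
  refine ⟨_, _, hR hy hy', hR hz hz', ?_⟩
  rw [map_add, map_smul, map_smul, show a • z + b • z' - (a • X.π (Z2Graded.grading c) y
    + b • X.π (Z2Graded.grading c) y') = a • (z - X.π (Z2Graded.grading c) y)
    + b • (z' - X.π (Z2Graded.grading c) y') by module]
  refine (norm_add_le _ _).trans ?_
  rw [norm_smul, norm_smul, add_mul, mul_assoc, mul_assoc]
  gcongr

omit [StarOrderedRing B] in
theorem HasBoundedCommutators.neg {D : X.E →ₗ.[ℂ] X.E} {𝓔 : Submodule ℂ X.E}
    (h : HasBoundedCommutators X D 𝓔) : HasBoundedCommutators X (-D) 𝓔 :=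
  h.comb h (-1) 0 fun {x p q} hp _ => mem_graph_neg.mpr (by simpa using hp)

omit [StarOrderedRing B] in
theorem HasBoundedCommutators.mem_domain {D : X.E →ₗ.[ℂ] X.E} {𝓔 : Submodule ℂ X.E}
    (h : HasBoundedCommutators X D 𝓔) {a : A} (ha : a ∈ X.𝒜) {ψ : X.E} (hψ : ψ ∈ 𝓔) :
    X.π a ψ ∈ D.domain := by
  obtain ⟨C, hC⟩ := h a ha
  obtain ⟨_, _, -, hz, -⟩ := hC ψ hψ
  exact LinearPMap.mem_domain_of_mem_graph hz

/-- For a regular self-adjoint operator the conditions on real and imaginary part are automatic. -/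
theorem isUnboundedKasparov_of_isSelfAdjointOp {D : X.E →ₗ.[ℂ] X.E}
    (hD : IsRegular B D ∧ IsSelfAdjointOp B D) (hodd : IsOddRel X D.graph)
    (hcomm : HasBoundedCommutators X D D.domain)
    (hK : ∀ a, IsCompactOnDomains B D D (X.π a)) : IsUnboundedKasparov X D := by
  have h1 := IsSelfAdjointOp.rePart_eq hD.2.2 hD.1.closed
  have h2 := hD.2.imPart_eq
  have hcore := hasCore_domain hD.1.closed
  have hz := isRegular_and_isSelfAdjointOp_zero (B := B) (E := X.E)
  refine ⟨⟨hD.1, hodd, ⟨D.domain, ?_⟩, ?_, ?_⟩, hD.2⟩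
  · rw [h1, h2, hD.2.2]
    exact ⟨le_inf le_rfl le_rfl, fun ψ ε hε => ⟨ψ, ψ.2.1, combinedNorm_sub_self_lt ψ hε⟩, hcore,
      hcore, hD.1, hcore.isEssentiallySelfAdjointOn hD.2, hz.1,
      (hasCore_zero hD.1.dense).isEssentiallySelfAdjointOn hz.2,
      fun a ha ψ hψ => ⟨hcomm.mem_domain ha hψ, hcomm.mem_domain ha hψ⟩, hcomm, hcomm⟩
  · rw [h1, h2]
    exact isAlmostAnticommuting_zero hD
  · rw [hD.2.2]
    exact hK

theorem IsIndefiniteKasparov.isOddRel_adjoint {D : X.E →ₗ.[ℂ] X.E} (h : IsIndefiniteKasparov X D) :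
    IsOddRel X (adjoint B D).graph :=
  IndefKasparov.isOddRel_adjoint h.regular.dense h.odd

theorem IsUnboundedKasparov.hasBoundedCommutators {D : X.E →ₗ.[ℂ] X.E}
    (h : IsUnboundedKasparov X D) : HasBoundedCommutators X D D.domain := by
  obtain ⟨𝓔, -, -, hc, -, -, -, -, -, -, hb, -⟩ := h.1.exists_core
  exact hb.domain h.1.regular.closed hc

/-- The part of an indefinite Kasparov module, or of a pair of Kasparov modules, that is expressed
by the operators `S = Re D` and `T = Im D`; the condition on compactness is left out. -/
structure IsPartsPair (X : KasparovBimodule.{u, v, w} A B) (S T : X.E →ₗ.[ℂ] X.E) : Prop where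
  almostAnticommuting : IsAlmostAnticommuting B S T
  odd_left : IsOddRel X S.graph
  odd_right : IsOddRel X T.graph
  core_left : S.HasCore (S.domain ⊓ T.domain)
  core_right : T.HasCore (S.domain ⊓ T.domain)
  commutators_left : HasBoundedCommutators X S (S.domain ⊓ T.domain)
  commutators_right : HasBoundedCommutators X T (S.domain ⊓ T.domain)

/-- One Wick rotation of an indefinite Kasparov module is an unbounded Kasparov module. -/
theorem isUnboundedKasparov_add {D D' S T : X.E →ₗ.[ℂ] X.E} (h : IsCartesian D D' S T)
    (hS : IsRightInvariant B S.graph ∧ IsSelfAdjointRel B S.graph)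
    (hT : IsRightInvariant B T.graph ∧ IsSelfAdjointRel B T.graph) {C : ℝ}
    (hST : IsAlmostCommRel (-1) S.graph T.graph C) (hoddS : IsOddRel X S.graph)
    (hoddT : IsOddRel X T.graph) (hcS : HasBoundedCommutators X S (S.domain ⊓ T.domain))
    (hcT : HasBoundedCommutators X T (S.domain ⊓ T.domain))
    (hK : ∀ a, IsCompactOnDomains B D D' (X.π a)) : IsUnboundedKasparov X (S + T) := by
  have hg := graph_add_eq_combRel S T
  have hreg : IsRegular B (S + T) ∧ IsSelfAdjointOp B (S + T) := by
    rw [isRegular_and_isSelfAdjointOp_iff, hg]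
    exact ⟨hS.1.combRel hT.1, hST.isSelfAdjointRel_add hS.2 hT.2⟩
  refine isUnboundedKasparov_of_isSelfAdjointOp hreg ?_ ?_ fun a => ?_
  · rw [hg]
    exact hoddS.combRel hoddT
  · exact hcS.comb hcT 1 1 fun {x p q} hp hq =>
      mem_graph_add.mpr ⟨p, q, hp, hq, by rw [one_smul, one_smul]⟩
  · exact h.isCompactOnDomains_add hS.2 hT.2 hST (isAlmostAnticommuting_zero hreg) (hK a)

/-- The conditions on `D` and `D*` pass to the real and imaginary part. The commutators are bounded
on all of `Dom D ∩ Dom D*` because they are bounded on a core for `D` and for `D*`. -/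
theorem IsIndefiniteKasparov.isPartsPair {D : X.E →ₗ.[ℂ] X.E} (h : IsIndefiniteKasparov X D) :
    IsPartsPair X (rePart B D) (imPart B D) ∧
      IsCartesian D (adjoint B D) (rePart B D) (imPart B D) := by
  obtain ⟨𝓔, h𝓔, -, hc, hc', hS, hS𝓔, hT, hT𝓔, -, hb, hb'⟩ := h.exists_core
  have hSr := h.almostAnticommuting.isSelfAdjointRel_left
  have hTr := h.almostAnticommuting.isSelfAdjointRel_right
  have hcart := isCartesian_rePart_imPart h.regular h𝓔 hc hc' hSr hTr
  have hW := hcart.domain_eq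
  have hS1 := hS𝓔.hasCore hS.closed hSr.symm
  have hT1 := hT𝓔.hasCore hT.closed hTr.symm
  have hD' : (adjoint B D).IsClosed :=
    ((isRegular_of_isSelfAdjointRel_offDiagRel (isRightInvariant_adjoint h.regular.dense)
      h.regular.isSelfAdjointRel.offDiagRel_swap).1).closed
  have hbW := (hb.domain h.regular.closed hc).mono (𝓔 := (rePart B D).domain ⊓ (imPart B D).domain)
    (hW ▸ inf_le_left)
  have hbW' := (hb'.domain hD' hc').mono (𝓔 := (rePart B D).domain ⊓ (imPart B D).domain)
    (hW ▸ inf_le_right)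
  refine ⟨⟨h.almostAnticommuting, ?_, ?_,
    LinearPMap.HasCore.mono hS.closed hS1 (hW ▸ h𝓔) inf_le_left,
    LinearPMap.HasCore.mono hT.closed hT1 (hW ▸ h𝓔) inf_le_right, ?_, ?_⟩, hcart⟩
  · have e : (rePart B D).graph
        = (combRel (1 / 2) (1 / 2) D.graph (adjoint B D).graph).topologicalClosure := by
      rw [rePart, graph_closure_of_isClosed hS.closed]
      congr 1
      ext ⟨x, y⟩
      rw [mem_graph_half_add, mem_combRel]
      simp only [smul_add]
    rw [e]
    exact (IsOddRel.combRel h.odd h.isOddRel_adjoint).topologicalClosure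
  · have e : (imPart B D).graph
        = (combRel (-I / 2) (-(-I / 2)) D.graph (adjoint B D).graph).topologicalClosure := by
      rw [imPart, graph_closure_of_isClosed hT.closed]
      congr 1
      ext ⟨x, y⟩
      rw [mem_graph_smul_sub, mem_combRel]
      simp only [smul_sub, neg_smul, ← sub_eq_add_neg]
    rw [e]
    exact (IsOddRel.combRel h.odd h.isOddRel_adjoint).topologicalClosure
  · refine hbW.comb hbW' (1 / 2) (1 / 2) fun hp hq => ?_
    rw [← smul_add]
    exact (hcart.parts hp hq).1
  · refine hbW.comb hbW' (-I / 2) (-(-I / 2)) fun hp hq => ?_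
    rw [neg_smul, ← sub_eq_add_neg, ← smul_sub]
    exact (hcart.parts hp hq).2

/-- The sum and the difference of the parts form a Kasparov pair. The difference is treated as the
sum for the adjoint, whose imaginary part has the opposite sign. -/
theorem IsPartsPair.isKasparovPair {D D' S T : X.E →ₗ.[ℂ] X.E} (h : IsPartsPair X S T)
    (hcart : IsCartesian D D' S T) (hK : ∀ a, IsCompactOnDomains B D D' (X.π a)) :
    IsKasparovPair X (S + T) (S - T) := by
  have hanti := h.almostAnticommuting
  have hS := isRegular_and_isSelfAdjointOp_iff.mp ⟨hanti.regular_left, hanti.selfAdjoint_left⟩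
  have hT := isRegular_and_isSelfAdjointOp_iff.mp ⟨hanti.regular_right, hanti.selfAdjoint_right⟩
  obtain ⟨C, hST⟩ := hanti.exists_isAlmostCommRel
  have hplus := isUnboundedKasparov_add hcart hS hT hST h.odd_left h.odd_right h.commutators_left
    h.commutators_right hK
  have hK' : ∀ a, IsCompactOnDomains B D' D (X.π a) := fun a =>
    (hK a).of_representable (M := 1) (inf_comm _ _).le zero_le_one
      (fun x p q p' q' hp hq hp' hq' => by
        obtain rfl := LinearPMap.mem_graph_snd_inj _ hp' hq rfl
        obtain rfl := LinearPMap.mem_graph_snd_inj _ hq' hp rfl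
        linarith [norm_nonneg x])
      (fun x p q hp hq => ⟨x, q, p, hq, hp, fun z a b a' b' ha hb ha' hb' => by
        obtain rfl := LinearPMap.mem_graph_snd_inj _ ha' hb rfl
        obtain rfl := LinearPMap.mem_graph_snd_inj _ hb' ha rfl
        abel⟩)
  have hminus : IsUnboundedKasparov X (S - T) := by
    rw [sub_eq_add_neg]
    exact isUnboundedKasparov_add hcart.swap hS ⟨hT.1.neg, hT.2.neg⟩ hST.neg_right h.odd_left
      h.odd_right.neg h.commutators_left h.commutators_right.neg hK'
  have hanti2 := hanti.smul (two_ne_zero' ℝ)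
  rw [ofReal_ofNat] at hanti2
  have e1 : ((S + T) + (S - T)).closure = (2 : ℂ) • S :=
    closure_add_add_sub h.core_left hanti.regular_left.closed hanti2.regular_left.closed
  have e2 : ((S + T) - (S - T)).closure = (2 : ℂ) • T := by
    have hc : T.HasCore (T.domain ⊓ S.domain) := by
      rw [inf_comm]
      exact h.core_right
    have := closure_add_add_sub hc hanti.regular_right.closed hanti2.regular_right.closed
    rwa [show (S + T) - (S - T) = (T + S) + (T - S) by
      rw [sub_eq_add_neg, neg_sub, add_comm S T]]
  have hrestr : ∀ {P : X.E →ₗ.[ℂ] X.E}, P.domain ≤ S.domain ⊓ T.domain →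
      P.domRestrict (S.domain ⊓ T.domain) = P := fun {P} hP => by
    refine LinearPMap.eq_of_eq_graph (SetLike.ext ?_)
    rintro ⟨x, y⟩
    rw [mem_graph_domRestrict]
    exact ⟨fun hx => hx.2, fun hx => ⟨hP (LinearPMap.mem_domain_of_mem_graph hx), hx⟩⟩
  refine ⟨hplus, hminus, ⟨S.domain ⊓ T.domain, le_inf le_rfl le_rfl,
    hasCore_domain (f := S + T) hplus.1.regular.closed,
    hasCore_domain (f := S - T) hminus.1.regular.closed, ?_, ⟨le_inf le_rfl le_rfl, ?_⟩, ?_,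
    ⟨le_inf le_rfl le_rfl, ?_⟩⟩, ?_⟩
  · rw [e1]
    exact hanti2.regular_left
  · rw [hrestr (P := (S + T) + (S - T)) inf_le_left, e1]
    exact hanti2.selfAdjoint_left
  · rw [e2]
    exact hanti2.regular_right
  · rw [hrestr (P := (S + T) - (S - T)) inf_le_left, e2]
    exact hanti2.selfAdjoint_right
  · rw [e1, e2]
    exact hanti2

/-- The Wick rotations of an indefinite Kasparov module form a pair of Kasparov modules. -/
theorem IsIndefiniteKasparov.isKasparovPair {D : X.E →ₗ.[ℂ] X.E} (h : IsIndefiniteKasparov X D) :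
    IsKasparovPair X (wickPlus B D) (wickMinus B D) :=
  h.isPartsPair.1.isKasparovPair h.isPartsPair.2 h.compact

/-- The reverse Wick rotation recovers an indefinite Kasparov module from its Wick rotations. -/
theorem IsIndefiniteKasparov.reverseWick_eq {D : X.E →ₗ.[ℂ] X.E} (h : IsIndefiniteKasparov X D) :
    reverseWick (wickPlus B D) (wickMinus B D) = D := by
  obtain ⟨-, hcart⟩ := h.isPartsPair
  obtain ⟨𝓔, h𝓔, -, hc, -⟩ := h.exists_core
  refine closure_eq_of_core h.regular.closed hc (fun x y hx hxy => ?_)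
    (LinearPMap.le_of_le_graph ?_)
  · obtain ⟨d', hd'⟩ := exists_mem_graph (h𝓔 hx).2
    obtain ⟨s, t, hs, ht, rfl, -⟩ := hcart.exists_parts hxy hd'
    rw [wickPlus, wickMinus, graph_reverseWick_add_sub]
    exact ⟨s, t, hs, ht, by rw [one_smul]⟩
  · rw [wickPlus, wickMinus, graph_reverseWick_add_sub]
    rintro ⟨x, y⟩ ⟨s, t, hs, ht, hy⟩
    obtain rfl : y = (1 : ℂ) • s + I • t := hy
    rw [one_smul]
    exact (hcart.of_parts hs ht).1

/-- Every Kasparov pair is `(S + T, S - T)` for an almost anti-commuting pair, namely half the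
closures of its sum and its difference. Maximality of self-adjoint operators gives equality of the
domains. -/
theorem IsKasparovPair.exists_isPartsPair {D₁ D₂ : X.E →ₗ.[ℂ] X.E} (h : IsKasparovPair X D₁ D₂) :
    ∃ S T, IsPartsPair X S T ∧ D₁ = S + T ∧ D₂ = S - T := by
  obtain ⟨𝓔, h𝓔, hc₁, hc₂, -⟩ := h.exists_core
  have hanti := h.almostAnticommuting.smul (c := 1 / 2) (by norm_num)
  rw [show ((1 / 2 : ℝ) : ℂ) = 1 / 2 by push_cast; rfl] at hanti
  have hS := isRegular_and_isSelfAdjointOp_iff.mp ⟨hanti.regular_left, hanti.selfAdjoint_left⟩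
  have hT := isRegular_and_isSelfAdjointOp_iff.mp ⟨hanti.regular_right, hanti.selfAdjoint_right⟩
  obtain ⟨C, hST⟩ := hanti.exists_isAlmostCommRel
  have hP := h.almostAnticommuting.regular_left.closed
  have hQ := h.almostAnticommuting.regular_right.closed
  have hS0 := hanti.regular_left.closed
  have hT0 := hanti.regular_right.closed
  have hmemS : ∀ {x d d'}, (x, d) ∈ D₁.graph → (x, d') ∈ D₂.graph →
      (x, (1 / 2 : ℂ) • (d + d')) ∈ ((1 / 2 : ℂ) • (D₁ + D₂).closure).graph :=
    fun {x d d'} hd hd' => mem_graph_smul.mpr ⟨_, LinearPMap.le_graph_of_le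
      (LinearPMap.le_closure _) (mem_graph_add.mpr ⟨d, d', hd, hd', rfl⟩), rfl⟩
  have hmemT : ∀ {x d d'}, (x, d) ∈ D₁.graph → (x, d') ∈ D₂.graph →
      (x, (1 / 2 : ℂ) • (d - d')) ∈ ((1 / 2 : ℂ) • (D₁ - D₂).closure).graph :=
    fun {x d d'} hd hd' => mem_graph_smul.mpr ⟨_, LinearPMap.le_graph_of_le
      (LinearPMap.le_closure _) (mem_graph_sub.mpr ⟨d, d', hd, hd', rfl⟩), rfl⟩
  have hcS : ((1 / 2 : ℂ) • (D₁ + D₂).closure).HasCore (D₁.domain ⊓ D₂.domain) :=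
    LinearPMap.HasCore.smul hP hS0 (LinearPMap.closureHasCore (D₁ + D₂))
  have hcT : ((1 / 2 : ℂ) • (D₁ - D₂).closure).HasCore (D₁.domain ⊓ D₂.domain) :=
    LinearPMap.HasCore.smul hQ hT0 (LinearPMap.closureHasCore (D₁ - D₂))
  have hoddS : IsOddRel X ((1 / 2 : ℂ) • (D₁ + D₂).closure).graph := by
    refine IsOddRel.smul ?_
    rw [graph_closure_of_isClosed hP, graph_add_eq_combRel]
    exact (IsOddRel.combRel h.left.1.odd h.right.1.odd).topologicalClosure
  have hoddT : IsOddRel X ((1 / 2 : ℂ) • (D₁ - D₂).closure).graph := by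
    refine IsOddRel.smul ?_
    rw [graph_closure_of_isClosed hQ, graph_sub_eq_combRel]
    exact (IsOddRel.combRel h.left.1.odd h.right.1.odd).topologicalClosure
  have hb₁ : HasBoundedCommutators X D₁ (D₁.domain ⊓ D₂.domain) :=
    h.left.hasBoundedCommutators.mono inf_le_left
  have hb₂ : HasBoundedCommutators X D₂ (D₁.domain ⊓ D₂.domain) :=
    h.right.hasBoundedCommutators.mono inf_le_right
  have hbS : HasBoundedCommutators X ((1 / 2 : ℂ) • (D₁ + D₂).closure) (D₁.domain ⊓ D₂.domain) :=
    hb₁.comb hb₂ (1 / 2) (1 / 2) fun hp hq => by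
      rw [← smul_add]
      exact hmemS hp hq
  have hbT : HasBoundedCommutators X ((1 / 2 : ℂ) • (D₁ - D₂).closure) (D₁.domain ⊓ D₂.domain) :=
    hb₁.comb hb₂ (1 / 2) (-(1 / 2)) fun hp hq => by
      rw [neg_smul, ← sub_eq_add_neg, ← smul_sub]
      exact hmemT hp hq
  generalize (1 / 2 : ℂ) • (D₁ + D₂).closure = S at *
  generalize (1 / 2 : ℂ) • (D₁ - D₂).closure = T at *
  have hsum : IsSelfAdjointRel B (S + T).graph := by
    rw [graph_add_eq_combRel]
    exact hST.isSelfAdjointRel_add hS.2 hT.2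
  have hdiff : IsSelfAdjointRel B (S - T).graph := by
    rw [sub_eq_add_neg, graph_add_eq_combRel]
    exact hST.neg_right.isSelfAdjointRel_add hS.2 hT.2.neg
  have hD₁ := (isRegular_and_isSelfAdjointOp_iff.mp ⟨h.left.1.regular, h.left.2⟩).2
  have hD₂ := (isRegular_and_isSelfAdjointOp_iff.mp ⟨h.right.1.regular, h.right.2⟩).2
  have e₁ : D₁ = S + T := by
    refine eq_of_le_of_isSelfAdjointRel (LinearPMap.le_of_le_graph ?_) hD₁ hsum
    refine graph_subset_of_hasCore hD₁.isClosed hc₁ hsum.isClosed fun x d hx hd => ?_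
    obtain ⟨d', hd'⟩ := exists_mem_graph (h𝓔 hx).2
    exact mem_graph_add.mpr ⟨_, _, hmemS hd hd', hmemT hd hd', by module⟩
  have e₂ : D₂ = S - T := by
    refine eq_of_le_of_isSelfAdjointRel (LinearPMap.le_of_le_graph ?_) hD₂ hdiff
    refine graph_subset_of_hasCore hD₂.isClosed hc₂ hdiff.isClosed fun x d' hx hd' => ?_
    obtain ⟨d, hd⟩ := exists_mem_graph (h𝓔 hx).1
    exact mem_graph_sub.mpr ⟨_, _, hmemS hd hd', hmemT hd hd', by module⟩
  have hW : D₁.domain ⊓ D₂.domain = S.domain ⊓ T.domain := by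
    rw [e₁, e₂]
    exact inf_idem _
  rw [hW] at hcS hcT hbS hbT
  exact ⟨S, T, ⟨hanti, hoddS, hoddT, hcS, hcT, hbS, hbT⟩, e₁, e₂⟩

/-- The reverse Wick rotation of a Kasparov pair, in terms of its sum and difference. -/
theorem IsPartsPair.isCartesian_reverseWick {S T : X.E →ₗ.[ℂ] X.E} (h : IsPartsPair X S T) :
    IsRegular B (reverseWick (S + T) (S - T)) ∧
      IsCartesian (reverseWick (S + T) (S - T)) (adjoint B (reverseWick (S + T) (S - T))) S T ∧
      (reverseWick (S + T) (S - T)).HasCore (S.domain ⊓ T.domain) ∧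
      (adjoint B (reverseWick (S + T) (S - T))).HasCore (S.domain ⊓ T.domain) :=
  h.almostAnticommuting.isRegular_closure_add_I h.core_left h.core_right
    (graph_reverseWick_add_sub S T)

theorem IsPartsPair.parts_reverseWick {S T : X.E →ₗ.[ℂ] X.E} (h : IsPartsPair X S T) :
    rePart B (reverseWick (S + T) (S - T)) = S ∧ imPart B (reverseWick (S + T) (S - T)) = T := by
  obtain ⟨-, hcart, -⟩ := h.isCartesian_reverseWick
  exact ⟨hcart.rePart_eq h.almostAnticommuting.regular_left.closed h.core_left,
    hcart.imPart_eq h.almostAnticommuting.regular_right.closed h.core_right⟩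

/-- The closure of `S + iT` is an indefinite Kasparov module, with core `Dom S ∩ Dom T`. The
compactness is only needed for `S + T`. -/
theorem IsPartsPair.isIndefiniteKasparov {S T : X.E →ₗ.[ℂ] X.E} (h : IsPartsPair X S T)
    (hK : ∀ a, IsCompactOnDomains B (S + T) (S + T) (X.π a)) :
    IsIndefiniteKasparov X (reverseWick (S + T) (S - T)) := by
  have hanti := h.almostAnticommuting
  obtain ⟨hreg, hcart, hc, hc'⟩ := h.isCartesian_reverseWick
  obtain ⟨hre, him⟩ := h.parts_reverseWick
  have hcl : (reverseWick (S + T) (S - T)).graph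
      = (combRel 1 I S.graph T.graph).topologicalClosure := by
    rw [← graph_reverseWick_add_sub]
    exact graph_closure_of_isClosed hreg.closed
  obtain ⟨C, hST⟩ := hanti.exists_isAlmostCommRel
  generalize reverseWick (S + T) (S - T) = D at *
  refine ⟨hreg, ?_, ⟨S.domain ⊓ T.domain, ?_⟩, ?_, fun a => ?_⟩
  · have : IsOddRel X D.graph := by
      rw [hcl]
      exact (h.odd_left.combRel h.odd_right).topologicalClosure
    exact this
  · rw [hre, him]
    refine ⟨hcart.domain_eq.ge, fun ψ ε hε => ⟨ψ, hcart.domain_eq ▸ ψ.2,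
      combinedNorm_sub_self_lt ψ hε⟩, hc, hc', hanti.regular_left,
      h.core_left.isEssentiallySelfAdjointOn hanti.selfAdjoint_left, hanti.regular_right,
      h.core_right.isEssentiallySelfAdjointOn hanti.selfAdjoint_right,
      fun a ha ψ hψ => ?_, ?_, ?_⟩
    · rw [hcart.domain_eq]
      exact ⟨h.commutators_left.mem_domain ha hψ, h.commutators_right.mem_domain ha hψ⟩
    · refine h.commutators_left.comb h.commutators_right 1 I fun hp hq => ?_
      rw [one_smul]
      exact (hcart.of_parts hp hq).1
    · refine h.commutators_left.comb h.commutators_right 1 (-I) fun hp hq => ?_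
      rw [one_smul, neg_smul, ← sub_eq_add_neg]
      exact (hcart.of_parts hp hq).2
  · rwa [hre, him]
  · exact hcart.isCompactOnDomains_of_add hanti.isSelfAdjointRel_left hanti.isSelfAdjointRel_right
      hST (hK a)

/-- The reverse Wick rotation of a pair of Kasparov modules is an indefinite Kasparov module. -/
theorem IsKasparovPair.isIndefiniteKasparov {D₁ D₂ : X.E →ₗ.[ℂ] X.E}
    (h : IsKasparovPair X D₁ D₂) : IsIndefiniteKasparov X (reverseWick D₁ D₂) := by
  obtain ⟨S, T, hST, rfl, rfl⟩ := h.exists_isPartsPair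
  refine hST.isIndefiniteKasparov fun a => ?_
  have := h.left.1.compact a
  rwa [h.left.2.2] at this

/-- The Wick rotations of the reverse Wick rotation of a pair are that pair. -/
theorem IsKasparovPair.wick_eq {D₁ D₂ : X.E →ₗ.[ℂ] X.E} (h : IsKasparovPair X D₁ D₂) :
    wickPlus B (reverseWick D₁ D₂) = D₁ ∧ wickMinus B (reverseWick D₁ D₂) = D₂ := by
  obtain ⟨S, T, hST, rfl, rfl⟩ := h.exists_isPartsPair
  obtain ⟨hre, him⟩ := hST.parts_reverseWick
  rw [wickPlus, wickMinus, hre, him]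
  exact ⟨rfl, rfl⟩

end KasparovModules

/-! ### Unitary equivalence and the bijection -/

section UnitaryEquivalence

variable {A : Type u} {B : Type v} [NonUnitalCStarAlgebra A] [NonUnitalCStarAlgebra B]
  [PartialOrder B] [Z2Graded A] [Z2Graded B]
  {X Y : KasparovBimodule.{u, v, w} A B} {U : X.E ≃ₗ[ℂ] Y.E}

theorem IsEvenUnitary.continuous (hU : IsEvenUnitary X Y U) : Continuous U :=
  AddMonoidHomClass.continuous_of_bound U 1 fun x => by
    have h := norm_rinner_self (B := B) (U x)
    rw [hU.inner, norm_rinner_self] at h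
    rw [one_mul, (sq_eq_sq₀ (norm_nonneg _) (norm_nonneg _)).mp h]

namespace IsConjugate

theorem add {D₁ D₁' : X.E →ₗ.[ℂ] X.E} {D₂ D₂' : Y.E →ₗ.[ℂ] Y.E} (h : IsConjugate U D₁ D₂)
    (h' : IsConjugate U D₁' D₂') : IsConjugate U (D₁ + D₁') (D₂ + D₂') := by
  intro x y
  rw [mem_graph_add, mem_graph_add]
  constructor
  · rintro ⟨a, b, ha, hb, hy⟩
    refine ⟨U.symm a, U.symm b, (h _ _).mp (by simpa using ha), (h' _ _).mp (by simpa using hb), ?_⟩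
    rw [← map_add, ← hy, U.symm_apply_apply]
  · rintro ⟨a, b, ha, hb, rfl⟩
    exact ⟨U a, U b, (h _ _).mpr ha, (h' _ _).mpr hb, map_add U a b⟩

theorem smul {D₁ : X.E →ₗ.[ℂ] X.E} {D₂ : Y.E →ₗ.[ℂ] Y.E} (h : IsConjugate U D₁ D₂) (c : ℂ) :
    IsConjugate U (c • D₁) (c • D₂) := by
  intro x y
  rw [mem_graph_smul, mem_graph_smul]
  constructor
  · rintro ⟨a, ha, hy⟩
    refine ⟨U.symm a, (h _ _).mp (by simpa using ha), ?_⟩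
    rw [← map_smul, ← hy, U.symm_apply_apply]
  · rintro ⟨a, ha, rfl⟩
    exact ⟨U a, (h _ _).mpr ha, map_smul U c a⟩

theorem neg {D₁ : X.E →ₗ.[ℂ] X.E} {D₂ : Y.E →ₗ.[ℂ] Y.E} (h : IsConjugate U D₁ D₂) :
    IsConjugate U (-D₁) (-D₂) := by
  intro x y
  rw [mem_graph_neg, mem_graph_neg, ← map_neg]
  exact h x (-y)

theorem sub {D₁ D₁' : X.E →ₗ.[ℂ] X.E} {D₂ D₂' : Y.E →ₗ.[ℂ] Y.E} (h : IsConjugate U D₁ D₂)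
    (h' : IsConjugate U D₁' D₂') : IsConjugate U (D₁ - D₁') (D₂ - D₂') := by
  rw [sub_eq_add_neg, sub_eq_add_neg]
  exact h.add h'.neg

/-- The closures have to be closed, since the closure of an operator that is not closable is that
operator itself. -/
theorem closure (hU : IsEvenUnitary X Y U) {D₁ : X.E →ₗ.[ℂ] X.E} {D₂ : Y.E →ₗ.[ℂ] Y.E}
    (h : IsConjugate U D₁ D₂) (h₁ : D₁.closure.IsClosed) (h₂ : D₂.closure.IsClosed) :
    IsConjugate U D₁.closure D₂.closure := by
  intro x y
  rw [graph_closure_of_isClosed h₁, graph_closure_of_isClosed h₂]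
  have hc : Continuous fun p : X.E × X.E => (U p.1, U p.2) := by
    have := hU.continuous
    fun_prop
  have hc' : Continuous fun p : Y.E × Y.E => (U.symm p.1, U.symm p.2) := by
    have := hU.symm.continuous
    fun_prop
  constructor
  · intro hxy
    have := map_mem_closure (f := fun p : Y.E × Y.E => (U.symm p.1, U.symm p.2)) hc' hxy
      fun p hp => (h.symm p.1 p.2).mpr hp
    rwa [U.symm_apply_apply, U.symm_apply_apply] at this
  · intro hxy
    exact map_mem_closure (f := fun p : X.E × X.E => (U p.1, U p.2)) hc hxy
      fun p hp => (h p.1 p.2).mpr hp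

variable [StarOrderedRing B]

theorem adjoint (hU : IsEvenUnitary X Y U) {D₁ : X.E →ₗ.[ℂ] X.E} {D₂ : Y.E →ₗ.[ℂ] Y.E}
    (h : IsConjugate U D₁ D₂) (h₁ : Dense (D₁.domain : Set X.E))
    (h₂ : Dense (D₂.domain : Set Y.E)) :
    IsConjugate U (IndefKasparov.adjoint B D₁) (IndefKasparov.adjoint B D₂) := by
  intro x y
  rw [mem_graph_adjoint_iff h₁, mem_graph_adjoint_iff h₂]
  constructor
  · intro hxy q hq
    have := hxy (U q.1, U q.2) ((h _ _).mpr hq)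
    rwa [hU.inner, hU.inner] at this
  · intro hxy q hq
    have := hxy (U.symm q.1, U.symm q.2) ((h.symm _ _).mpr hq)
    rw [← hU.inner, ← hU.inner (U.symm q.1), U.apply_symm_apply, U.apply_symm_apply] at this
    exact this

theorem wick (hU : IsEvenUnitary X Y U) {D₁ : X.E →ₗ.[ℂ] X.E} {D₂ : Y.E →ₗ.[ℂ] Y.E}
    (h : IsConjugate U D₁ D₂) (h₁ : IsIndefiniteKasparov X D₁) (h₂ : IsIndefiniteKasparov Y D₂) :
    IsConjugate U (wickPlus B D₁) (wickPlus B D₂) ∧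
      IsConjugate U (wickMinus B D₁) (wickMinus B D₂) := by
  have hadj := h.adjoint hU h₁.regular.dense h₂.regular.dense
  have hre : IsConjugate U (rePart B D₁) (rePart B D₂) := ((h.add hadj).smul _).closure hU
    h₁.almostAnticommuting.regular_left.closed h₂.almostAnticommuting.regular_left.closed
  have him : IsConjugate U (imPart B D₁) (imPart B D₂) := ((h.sub hadj).smul _).closure hU
    h₁.almostAnticommuting.regular_right.closed h₂.almostAnticommuting.regular_right.closed
  exact ⟨hre.add him, hre.sub him⟩

theorem reverseWick (hU : IsEvenUnitary X Y U) {D₁ D₁' : X.E →ₗ.[ℂ] X.E}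
    {D₂ D₂' : Y.E →ₗ.[ℂ] Y.E} (h : IsConjugate U D₁ D₂) (h' : IsConjugate U D₁' D₂')
    (h₁ : IsKasparovPair X D₁ D₁') (h₂ : IsKasparovPair Y D₂ D₂') :
    IsConjugate U (IndefKasparov.reverseWick D₁ D₁') (IndefKasparov.reverseWick D₂ D₂') :=
  (((h.add h').smul _).add ((h.sub h').smul _)).closure hU
    h₁.isIndefiniteKasparov.regular.closed h₂.isIndefiniteKasparov.regular.closed

end IsConjugate

variable [StarOrderedRing B]

variable (A B) in
/-- Wick rotation as a bijection between indefinite modules and pairs. -/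
noncomputable def wickEquiv :
    IndefiniteKasparovModule.{u, v, w} A B ≃ KasparovModulePair.{u, v, w} A B where
  toFun M := ⟨wickRotation M.1, M.2.isKasparovPair⟩
  invFun N := ⟨reverseWickRotation N.1, N.2.isIndefiniteKasparov⟩
  left_inv := by
    rintro ⟨⟨X, D⟩, h⟩
    refine Subtype.ext ?_
    exact congrArg (Sigma.mk X) h.reverseWick_eq
  right_inv := by
    rintro ⟨⟨X, D₁, D₂⟩, h⟩
    refine Subtype.ext ?_
    exact congrArg (Sigma.mk X) (Prod.ext h.wick_eq.1 h.wick_eq.2)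

/-- Two indefinite modules are unitarily equivalent if and only if their Wick rotations are. -/
theorem wickEquiv_rel_iff (M N : IndefiniteKasparovModule.{u, v, w} A B) :
    indefiniteSetoid A B M N ↔ pairSetoid A B (wickEquiv A B M) (wickEquiv A B N) := by
  constructor
  · rintro ⟨U, hU, h⟩
    obtain ⟨h1, h2⟩ := h.wick hU M.2 N.2
    exact ⟨U, hU, h1, h2⟩
  · rintro ⟨U, hU, h1, h2⟩
    refine ⟨U, hU, ?_⟩
    have := h1.reverseWick hU h2 (wickEquiv A B M).2 (wickEquiv A B N).2
    rw [← M.2.reverseWick_eq, ← N.2.reverseWick_eq]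
    exact this

end UnitaryEquivalence

end IndefKasparov

theorem mainTheorem1 {A : Type u} {B : Type v} [NonUnitalCStarAlgebra A]
    [NonUnitalCStarAlgebra B] [PartialOrder B] [StarOrderedRing B]
    [IndefKasparov.Z2Graded A] [IndefKasparov.Z2Graded B] :
    ∃ e : IndefKasparov.IndefiniteKasparovModule.{u, v, w} A B ≃
        IndefKasparov.KasparovModulePair.{u, v, w} A B,
      (∀ M, (e M).1 = IndefKasparov.wickRotation M.1) ∧
      (∀ N, (e.symm N).1 = IndefKasparov.reverseWickRotation N.1) ∧
      ∃ q : Quotient (IndefKasparov.indefiniteSetoid.{u, v, w} A B) ≃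
          Quotient (IndefKasparov.pairSetoid.{u, v, w} A B),
        (∀ M, q (Quotient.mk _ M) = Quotient.mk _ (e M)) ∧
        (∀ N, q.symm (Quotient.mk _ N) = Quotient.mk _ (e.symm N)) :=
  ⟨IndefKasparov.wickEquiv A B, fun _ => rfl, fun _ => rfl,
    Quotient.congr (IndefKasparov.wickEquiv A B) IndefKasparov.wickEquiv_rel_iff,
    fun _ => rfl, fun _ => rfl⟩
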